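/- Let $\kappa>0$ be real and $\alpha=1/\kappa$. For $\Re(z)>0$ let $L_\kappa(z)=-\sum_{\ell\ge 1}\log\left(1-e^{-z\lfloor \ell^\kappa\rfloor}\right)$ (the series converges and $L_\kappa$ is holomorphic there), and for $\Re(s)>\alpha$ let $\zeta_\kappa(s)=\sum_{n\ge 1}\lfloor n^\kappa\rfloor^{-s}$. Call a real number $\sigma\in(0,1]$ admissible if $\zeta_\kappa$ has a meromorphic continuation to $\Re(s)>-\sigma$ whose only singularities are simple poles at $s=\alpha-h$, $h\in\mathbb Z$, $0\le h<\alpha$, with residues $\frac{\Gamma(\alpha+1)}{(h+1)!\,\Gamma(\alpha-h)}$, and if, for every $\varepsilon>0$, $\zeta_\kappa(s)\ll_{\kappa,\sigma,\varepsilon}|s|(|s|+1)^{\lfloor\alpha\rfloor+1}$ for all $s$ with $\Re(s)\ge\varepsilon-\sigma$ and $|\Im(s)|\ge 1$. Then an admissible $\sigma_\kappa\in(0,1]$ exists, and for every admissible $\sigma_\kappa$, every $\varepsilon>0$ and every integer $j\ge 0$, as $x\to 0^+$, $$\frac{d^j}{dx^j}L_\kappa(x)=\frac{d^j}{dx^j}\left(\sum_{0\le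 h<\alpha}\frac{\Gamma(\alpha+1)\zeta(\alpha-h+1)}{(h+1)!\,x^{\alpha-h}}-\zeta_\kappa(0)\log x+\zeta_\kappa'(0)\right)+O\left(x^{\sigma_\kappa-\varepsilon-j}\right),$$ where $\zeta$ is the Riemann zeta function, $\zeta_\kappa(0)$ and $\zeta_\kappa'(0)$ are values of the continuation, and the implied constant depends only on $\kappa,\sigma_\kappa,\varepsilon,j$. -/

import Mathlib

open Filter Topology Asymptotics

noncomputable section

namespace PSZeta

/-- The term `⌊ℓ ^ κ⌋` of the Piatetski-Shapiro sequence, with `ℓ = n + 1`, so that `n = 0, 1, 2, …`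
runs over `ℓ = 1, 2, 3, …`. -/
def psTerm (κ : ℝ) (n : ℕ) : ℕ := ⌊((n : ℝ) + 1) ^ κ⌋₊

/-- `L_κ(z) = - ∑_{ℓ ≥ 1} log (1 - e ^ (-z ⌊ℓ ^ κ⌋))`, meant for `Re z > 0`. -/
def L (κ : ℝ) (z : ℂ) : ℂ :=
  -∑' n : ℕ, Complex.log (1 - Complex.exp (-(z * (psTerm κ n : ℂ))))

/-- `Z` is the meromorphic continuation of `ζ_κ(s) = ∑_{ℓ ≥ 1} ⌊ℓ ^ κ⌋ ^ (-s)`, `Re s > α = 1 / κ`,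
to the half-plane `Re s > -σ`: its only singularities there are simple poles at the points `α - h`
with `h` a natural number, `h < α`, with residues `Γ(α + 1) / ((h + 1)! Γ(α - h))`, and it satisfies
`Z(s) ≪_ε |s| (|s| + 1) ^ (⌊α⌋ + 1)` for `Re s ≥ ε - σ`, `|Im s| ≥ 1`. -/
structure IsZetaContinuation (κ σ : ℝ) (Z : ℂ → ℂ) : Prop where
  hasSum : ∀ s : ℂ, 1 / κ < s.re → HasSum (fun n : ℕ => 1 / (psTerm κ n : ℂ) ^ s) (Z s)
  holomorphic : DifferentiableOn ℂ Z
    ({s : ℂ | -σ < s.re} \ {s : ℂ | ∃ h : ℕ, (h : ℝ) < 1 / κ ∧ s = ((1 / κ - h : ℝ) : ℂ)})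
  residue : ∀ h : ℕ, (h : ℝ) < 1 / κ →
    Tendsto (fun s : ℂ => (s - ((1 / κ - h : ℝ) : ℂ)) * Z s) (𝓝[≠] ((1 / κ - h : ℝ) : ℂ))
      (𝓝 ((Real.Gamma (1 / κ + 1) / ((Nat.factorial (h + 1) : ℝ) * Real.Gamma (1 / κ - h)) : ℝ) : ℂ))
  growth : ∀ ε : ℝ, 0 < ε → ∃ C : ℝ, ∀ s : ℂ, ε - σ ≤ s.re → 1 ≤ |s.im| →
    ‖Z s‖ ≤ C * (‖s‖ * (‖s‖ + 1) ^ (⌊1 / κ⌋₊ + 1))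

/-- The function `∑_{0 ≤ h < α} Γ(α + 1) ζ(α - h + 1) / ((h + 1)! x ^ (α - h)) - z₀ log x + z₁` of
`x > 0`, where `α = 1 / κ`. -/
def mainTerm (κ : ℝ) (z₀ z₁ : ℂ) (x : ℝ) : ℂ :=
  (∑ h ∈ Finset.range ⌈1 / κ⌉₊,
    (Real.Gamma (1 / κ + 1) : ℂ) * riemannZeta ((1 / κ - h + 1 : ℝ) : ℂ) /
      ((Nat.factorial (h + 1) : ℂ) * ((x ^ (1 / κ - h) : ℝ) : ℂ)))
    - z₀ * (Real.log x : ℂ) + z₁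

end PSZeta

end

/-!
The Mellin transform of `L_κ` is `Γ(s) ζ(s + 1) ζ_κ(s)`: expanding the logarithm and inserting the
Cahen–Mellin integral for `e ^ (-y)` gives, for `c > α = 1 / κ`,

  `2π L_κ(x) = ∫ Γ(s) ζ(s + 1) ζ_κ(s) x ^ (-s) dt`, `s = c + i t` (`integral_eq_L`).

The line of integration is shifted to `Re s = δ - σ` with a small `δ > 0`
(`integral_vertical_sub`), which is legitimate because `Γ` decays faster than any power of `|Im s|`
while `ζ` and `ζ_κ` grow polynomially. The simple poles at `s = α - h` contribute the terms
`x ^ (h - α)`; at `s = 0` the poles of `Γ(s)` and `ζ(s + 1)` meet in a double pole, in which the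
Euler constants cancel, and which contributes `ζ_κ'(0) - ζ_κ(0) log x`. The remaining integral is an
exact formula for the error; differentiating it `j` times under the integral sign multiplies the
integrand by a polynomial in `s` and by `x ^ (-j)`, whence the bound for all derivatives
(`exists_norm_iteratedDeriv_verticalIntegral_le`).

An admissible `σ` comes from the counting function `#{ℓ : ⌊ℓ ^ κ⌋ ≤ m} = ⌈(m + 1) ^ α⌉ - 1`. By
partial summation, `ζ_κ(s)` is a combination of the shifted zeta functions `ζ(s - α + h + 1)`, whose
coefficients are binomial coefficients and produce the residues, plus a series holomorphic beyond
`Re s = 0`, up to the contribution of the fractional parts `{-m ^ α}`. For an integer `α` these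
vanish. Otherwise they have mean value `1 / 2` with a power saving
(`exists_abs_sum_fract_rpow_le`), as the exponential sums `∑ e (t m ^ α)` have one by the method of
van der Corput (`kth_derivative_test`). The growth condition follows from polynomial bounds for `ζ`
on vertical strips (`exists_norm_riemannZeta_le`), obtained by summing the binomial expansion of
`(n + 1) ^ (1 - w) - n ^ (1 - w)` over `n`, which expresses `ζ(w)` through `ζ(w + 1)`, `ζ(w + 2)`, ….
-/

namespace PSZeta

/-! ### The inequality of van der Corput -/

open ComplexConjugate in
/-- Correlations of a finitely supported sequence on `ℤ` depend only on the difference of the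
shifts. -/
lemma tsum_shift_mul_conj_shift (z : ℤ → ℂ) (i j : ℤ) :
    ∑' m, z (m + i) * conj (z (m + j)) = ∑' m, z (m + (i - j)) * conj (z m) := by
  rw [← (Equiv.addRight j).tsum_eq (fun m => z (m + (i - j)) * conj (z m))]
  congr 1; ext m
  simp only [Equiv.coe_addRight]
  congr 2; ring_nf

open ComplexConjugate in
lemma norm_tsum_corr_neg (z : ℤ → ℂ) (r : ℤ) :
    ‖∑' m, z (m + -r) * conj (z m)‖ = ‖∑' m, z (m + r) * conj (z m)‖ := by
  have h := tsum_shift_mul_conj_shift z 0 r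
  rw [zero_sub] at h
  rw [← h, ← Complex.norm_conj, Complex.conj_tsum]
  congr 2; ext m
  simp [mul_comm]

open ComplexConjugate in
/-- **Van der Corput's inequality**: a sum is controlled by the correlations of its terms with
their shifts by `r < H`. -/
theorem vanDerCorput_inequality (z : ℕ → ℂ) (N H : ℕ) :
    (H : ℝ) * ‖∑ n ∈ Finset.range N, z n‖ ^ 2 ≤
      (N + H) * (2 * ∑ r ∈ Finset.range H,
        ‖∑ n ∈ Finset.range (N - r), z (n + r) * conj (z n)‖) := by
  -- extend by zero to `ℤ`, so that shifts become bijections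
  set y : ℤ → ℂ := fun m => if 0 ≤ m ∧ m < N then z m.toNat else 0 with hy
  set J : Finset ℤ := Finset.Ico (-(H : ℤ)) N with hJ
  set γ : ℕ → ℝ := fun r => ‖∑ n ∈ Finset.range (N - r), z (n + r) * conj (z n)‖ with hγ
  have hcorr : ∀ r : ℕ, ‖∑' m, y (m + r) * conj (y m)‖ = γ r := by
    intro r
    rw [hγ]
    dsimp only
    congr 1
    rw [tsum_eq_sum (s := (Finset.range (N - r)).map Nat.castEmbedding)]
    · rw [Finset.sum_map]
      refine Finset.sum_congr rfl fun n hn => ?_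
      rw [Finset.mem_range] at hn
      simp only [hy, Nat.castEmbedding_apply]
      rw [if_pos (by omega), if_pos (by omega)]
      congr 2
    · intro m hm
      by_cases h1 : 0 ≤ m ∧ m < N
      · by_cases h2 : 0 ≤ m + r ∧ m + r < N
        · exfalso
          apply hm
          simp only [Finset.mem_map, Finset.mem_range, Nat.castEmbedding_apply]
          exact ⟨m.toNat, by omega, by omega⟩
        · simp only [hy]; rw [if_neg h2, zero_mul]
      · simp only [hy]; rw [if_neg h1]; simp
  have hS : ∀ i ∈ Finset.range H, ∑ m ∈ J, y (m + i) = ∑ n ∈ Finset.range N, z n := by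
    intro i hi
    rw [Finset.mem_range] at hi
    have hJi : ∑' m, y (m + i) = ∑ m ∈ J, y (m + i) := by
      refine tsum_eq_sum fun m hm => ?_
      simp only [hy]
      rw [if_neg]
      intro h
      apply hm
      simp only [hJ, Finset.mem_Ico]
      omega
    rw [← hJi, show ∑' m, y (m + i) = ∑' m, y m from (Equiv.addRight (i : ℤ)).tsum_eq y,
      tsum_eq_sum (s := (Finset.range N).map Nat.castEmbedding)]
    · rw [Finset.sum_map]
      refine Finset.sum_congr rfl fun n hn => ?_
      rw [Finset.mem_range] at hn
      simp only [hy, Nat.castEmbedding_apply]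
      rw [if_pos (by omega)]
      congr 1
    · intro m hm
      simp only [hy]
      rw [if_neg]
      intro h
      apply hm
      simp only [Finset.mem_map, Finset.mem_range, Nat.castEmbedding_apply]
      exact ⟨m.toNat, by omega, by omega⟩
  -- averaging over the shifts `i < H`, then Cauchy–Schwarz over `J`
  have hcard : (J.card : ℝ) = N + H := by
    rw [hJ, Int.card_Ico]
    have : ((N : ℤ) - -(H : ℤ)).toNat = N + H := by omega
    rw [this]; push_cast; ring
  have h1 : ((H : ℝ) * ‖∑ n ∈ Finset.range N, z n‖) ^ 2 ≤
      (N + H) * ∑ m ∈ J, ‖∑ i ∈ Finset.range H, y (m + i)‖ ^ 2 := by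
    have e1 : (H : ℝ) * ‖∑ n ∈ Finset.range N, z n‖ ≤ ∑ m ∈ J, ‖∑ i ∈ Finset.range H, y (m + i)‖ := by
      have : (H : ℂ) * ∑ n ∈ Finset.range N, z n = ∑ m ∈ J, ∑ i ∈ Finset.range H, y (m + i) := by
        rw [Finset.sum_comm, Finset.sum_congr rfl hS]; simp
      calc (H : ℝ) * ‖∑ n ∈ Finset.range N, z n‖ = ‖(H : ℂ) * ∑ n ∈ Finset.range N, z n‖ := by simp
        _ ≤ _ := by rw [this]; exact norm_sum_le _ _
    calc _ ≤ (∑ m ∈ J, ‖∑ i ∈ Finset.range H, y (m + i)‖) ^ 2 := by gcongr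
      _ ≤ _ := by rw [← hcard]; exact sq_sum_le_card_mul_sum_sq
  -- expanding the square, each difference `±r` of two shifts occurs at most `H` times
  have h2 : ∑ m ∈ J, ‖∑ i ∈ Finset.range H, y (m + i)‖ ^ 2 ≤
      H * (2 * ∑ r ∈ Finset.range H, γ r) := by
    have e1 : ((∑ m ∈ J, ‖∑ i ∈ Finset.range H, y (m + i)‖ ^ 2 : ℝ) : ℂ) =
        ∑ i ∈ Finset.range H, ∑ j ∈ Finset.range H, ∑' m, y (m + ((i : ℤ) - j)) * conj (y m) := by
      push_cast
      have : ∀ m ∈ J, ((‖∑ i ∈ Finset.range H, y (m + i)‖ : ℝ) : ℂ) ^ 2 =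
          ∑ i ∈ Finset.range H, ∑ j ∈ Finset.range H, y (m + i) * conj (y (m + j)) := by
        intro m _
        rw [← Complex.mul_conj', map_sum, Finset.sum_mul_sum]
      rw [Finset.sum_congr rfl this, Finset.sum_comm]
      refine Finset.sum_congr rfl fun i hi => ?_
      rw [Finset.sum_comm]
      refine Finset.sum_congr rfl fun j hj => ?_
      rw [Finset.mem_range] at hi hj
      rw [← tsum_shift_mul_conj_shift, tsum_eq_sum]
      intro m hm
      simp only [hy]
      rw [if_neg, zero_mul]
      intro h
      apply hm
      simp only [hJ, Finset.mem_Ico]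
      omega
    have e2 : ∀ i ∈ Finset.range H, ∀ j ∈ Finset.range H,
        ‖∑' m, y (m + ((i : ℤ) - j)) * conj (y m)‖ ≤
          ∑ r ∈ Finset.range H, ((if i = j + r then γ r else 0) + (if j = i + r then γ r else 0)) := by
      intro i hi j hj
      rw [Finset.mem_range] at hi hj
      have hnn : ∀ r ∈ Finset.range H,
          0 ≤ ((if i = j + r then γ r else 0) + (if j = i + r then γ r else 0)) := by
        intro r _
        have : 0 ≤ γ r := norm_nonneg _
        positivity
      rcases le_total j i with h | h
      · obtain ⟨r, rfl⟩ := Nat.exists_eq_add_of_le h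
        refine le_trans ?_ (Finset.single_le_sum hnn (Finset.mem_range.2 (show r < H by omega)))
        rw [if_pos rfl]
        have : ((j + r : ℕ) : ℤ) - j = r := by push_cast; ring
        rw [this, hcorr]
        have : 0 ≤ γ r := norm_nonneg _
        split_ifs <;> linarith
      · obtain ⟨r, rfl⟩ := Nat.exists_eq_add_of_le h
        refine le_trans ?_ (Finset.single_le_sum hnn (Finset.mem_range.2 (show r < H by omega)))
        rw [if_pos rfl]
        have : (i : ℤ) - (i + r : ℕ) = -r := by push_cast; ring
        rw [this, norm_tsum_corr_neg, hcorr]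
        have : 0 ≤ γ r := norm_nonneg _
        split_ifs <;> linarith
    have e3 : ∀ i ∈ Finset.range H, ∑ j ∈ Finset.range H, ∑ r ∈ Finset.range H,
        ((if i = j + r then γ r else 0) + (if j = i + r then γ r else 0)) ≤
          2 * ∑ r ∈ Finset.range H, γ r := by
      intro i _
      rw [Finset.sum_comm, Finset.mul_sum]
      refine Finset.sum_le_sum fun r _ => ?_
      have hr : 0 ≤ γ r := norm_nonneg _
      rw [Finset.sum_add_distrib, two_mul]
      refine add_le_add ?_ ?_
      · rw [← Finset.sum_filter, Finset.sum_const, nsmul_eq_mul]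
        refine mul_le_of_le_one_left hr ?_
        rw [Nat.cast_le_one, Finset.card_le_one]
        intro a ha b hb
        simp only [Finset.mem_filter] at ha hb
        omega
      · rw [← Finset.sum_filter, Finset.sum_const, nsmul_eq_mul]
        refine mul_le_of_le_one_left hr ?_
        rw [Nat.cast_le_one, Finset.card_le_one]
        intro a ha b hb
        simp only [Finset.mem_filter] at ha hb
        omega
    calc ∑ m ∈ J, ‖∑ i ∈ Finset.range H, y (m + i)‖ ^ 2
        = ‖((∑ m ∈ J, ‖∑ i ∈ Finset.range H, y (m + i)‖ ^ 2 : ℝ) : ℂ)‖ := by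
          rw [Complex.norm_real, Real.norm_of_nonneg (Finset.sum_nonneg fun _ _ => by positivity)]
      _ ≤ ∑ i ∈ Finset.range H, ∑ j ∈ Finset.range H,
            ‖∑' m, y (m + ((i : ℤ) - j)) * conj (y m)‖ := by
          rw [e1]
          exact (norm_sum_le _ _).trans (Finset.sum_le_sum fun i _ => norm_sum_le _ _)
      _ ≤ ∑ i ∈ Finset.range H, 2 * ∑ r ∈ Finset.range H, γ r :=
          Finset.sum_le_sum fun i hi => (Finset.sum_le_sum (e2 i hi)).trans (e3 i hi)
      _ = _ := by simp
  rcases Nat.eq_zero_or_pos H with rfl | hH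
  · simp
  have hH' : (0 : ℝ) < H := by exact_mod_cast hH
  have h3 := h1.trans (mul_le_mul_of_nonneg_left h2 (by positivity : (0 : ℝ) ≤ N + H))
  refine le_of_mul_le_mul_left ?_ hH'
  calc _ = ((H : ℝ) * ‖∑ n ∈ Finset.range N, z n‖) ^ 2 := by ring
    _ ≤ _ := h3
    _ = _ := by ring

/-! ### Exponential sums by derivative tests -/

/-- `e(x) = exp (2πix)`. -/
noncomputable def e (x : ℝ) : ℂ := Complex.exp (Complex.I * ((2 * Real.pi * x : ℝ) : ℂ))

lemma norm_e (x : ℝ) : ‖e x‖ = 1 := by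
  rw [e, mul_comm, Complex.norm_exp_ofReal_mul_I]

lemma e_add (x y : ℝ) : e (x + y) = e x * e y := by
  rw [e, e, e, ← Complex.exp_add]; congr 1; push_cast; ring

lemma conj_e (x : ℝ) : (starRingEnd ℂ) (e x) = e (-x) := by
  rw [e, e, ← Complex.exp_conj]; congr 1
  rw [map_mul, Complex.conj_I, Complex.conj_ofReal]; push_cast; ring

lemma norm_e_sub_one_le (x : ℝ) : ‖e x - 1‖ ≤ 2 * Real.pi * |x| := by
  have := Real.norm_exp_I_mul_ofReal_sub_one_le (x := 2 * Real.pi * x)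
  rw [e]
  refine this.trans (le_of_eq ?_)
  rw [Real.norm_eq_abs, abs_mul, abs_of_pos Real.two_pi_pos]

lemma norm_e_sub_e_le (x y : ℝ) : ‖e x - e y‖ ≤ 2 * Real.pi * |x - y| := by
  have : e x - e y = e y * (e (x - y) - 1) := by
    rw [mul_sub, ← e_add]; simp
  rw [this, norm_mul, norm_e, one_mul]
  exact norm_e_sub_one_le _

lemma le_norm_e_sub_one {x : ℝ} (h0 : 0 ≤ x) (h1 : x ≤ 1 / 2) : 4 * x ≤ ‖e x - 1‖ := by
  rw [e, Complex.norm_exp_I_mul_ofReal_sub_one]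
  have hx : 2 * Real.pi * x / 2 = Real.pi * x := by ring
  rw [hx, norm_mul, Real.norm_ofNat, Real.norm_eq_abs]
  have h2 := Real.mul_le_sin (x := Real.pi * x) (by positivity) (by nlinarith [Real.pi_pos])
  have h3 : 2 / Real.pi * (Real.pi * x) = 2 * x := by field_simp
  rw [h3] at h2
  have := le_abs_self (Real.sin (Real.pi * x))
  linarith

lemma norm_sum_e_le (f : ℕ → ℝ) (N : ℕ) : ‖∑ n ∈ Finset.range N, e (f n)‖ ≤ N := by
  refine (norm_sum_le _ _).trans ?_
  simp [norm_e]

lemma sum_range_by_parts_fwdDiff (w E : ℕ → ℂ) (N : ℕ) :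
    ∑ n ∈ Finset.range N, w n * (E (n + 1) - E n) =
      w N * E N - w 0 * E 0 - ∑ n ∈ Finset.range N, (w (n + 1) - w n) * E (n + 1) := by
  induction N with
  | zero => simp
  | succ N ih => rw [Finset.sum_range_succ, ih, Finset.sum_range_succ]; ring

/-- The **Kusmin–Landau inequality** for a phase whose increments are decreasing and of the same
order of magnitude: summation by parts against `e (f (n + 1)) - e (f n)`. -/
lemma kusmin_landau {A l : ℝ} (hl : 0 < l) (hA : A * l ≤ 1 / 2) {f : ℕ → ℝ} {N : ℕ}
    (h1 : ∀ n ≤ N, l ≤ fwdDiff 1 f n ∧ fwdDiff 1 f n ≤ A * l)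
    (h2 : ∀ n < N, (fwdDiff 1)^[2] f n ≤ 0) :
    ‖∑ n ∈ Finset.range N, e (f n)‖ ≤ (1 + A) / l := by
  set d : ℕ → ℝ := fwdDiff 1 f with hd
  set w : ℕ → ℂ := fun n => 1 / (e (d n) - 1) with hw
  have hlow : ∀ n ≤ N, 4 * l ≤ ‖e (d n) - 1‖ := fun n hn =>
    (by linarith [(h1 n hn).1] : 4 * l ≤ 4 * d n).trans
      (le_norm_e_sub_one (hl.le.trans (h1 n hn).1) ((h1 n hn).2.trans hA))
  have hne : ∀ n ≤ N, e (d n) - 1 ≠ 0 := fun n hn h => by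
    have := hlow n hn; rw [h, norm_zero] at this; linarith
  have hterm : ∀ n ∈ Finset.range N, e (f n) = w n * (e (f (n + 1)) - e (f n)) := by
    intro n hn
    have hn' := (Finset.mem_range.1 hn).le
    have : e (f (n + 1)) = e (d n) * e (f n) := by
      rw [← e_add]; congr 1; simp [hd, fwdDiff]
    rw [this, hw]
    have := hne n hn'
    field_simp
  have hwn : ∀ n ≤ N, ‖w n‖ ≤ 1 / (4 * l) := by
    intro n hn
    rw [hw]; dsimp only
    rw [norm_div, norm_one]
    exact one_div_le_one_div_of_le (by linarith) (hlow n hn)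
  have hdw : ∀ n ∈ Finset.range N,
      ‖(w (n + 1) - w n) * e (f (n + 1))‖ ≤ 2 * Real.pi / (16 * l ^ 2) * (d n - d (n + 1)) := by
    intro n hn
    have hn' := Finset.mem_range.1 hn
    have hd2 : d (n + 1) - d n ≤ 0 := by
      have := h2 n hn'
      simpa [Function.iterate_succ_apply', hd, fwdDiff] using this
    rw [norm_mul, norm_e, mul_one]
    have : w (n + 1) - w n = (e (d n) - e (d (n + 1))) / ((e (d (n + 1)) - 1) * (e (d n) - 1)) := by
      have := hne n hn'.le
      have := hne (n + 1) hn'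
      rw [hw]; field_simp; ring
    rw [this, norm_div, norm_mul]
    have h3 := norm_e_sub_e_le (d n) (d (n + 1))
    rw [abs_of_nonneg (by linarith)] at h3
    have h4 : 16 * l ^ 2 ≤ ‖e (d (n + 1)) - 1‖ * ‖e (d n) - 1‖ := by
      calc 16 * l ^ 2 = (4 * l) * (4 * l) := by ring
        _ ≤ _ := mul_le_mul (hlow _ hn') (hlow _ hn'.le) (by linarith) (norm_nonneg _)
    calc _ ≤ (2 * Real.pi * (d n - d (n + 1))) / (16 * l ^ 2) :=
          div_le_div₀ ((norm_nonneg _).trans h3) h3 (by positivity) h4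
      _ = _ := by ring
  rw [Finset.sum_congr rfl hterm, sum_range_by_parts_fwdDiff w (fun n => e (f n)) N]
  have hsum : ‖∑ n ∈ Finset.range N, (w (n + 1) - w n) * e (f (n + 1))‖ ≤
      2 * Real.pi / (16 * l ^ 2) * (A * l) := by
    refine (norm_sum_le _ _).trans ((Finset.sum_le_sum hdw).trans ?_)
    rw [← Finset.mul_sum, Finset.sum_range_sub']
    have := (h1 0 (Nat.zero_le _)).2
    have := (h1 N le_rfl).1
    gcongr
    linarith
  have hA0 : 0 ≤ A * l := by
    have := h1 0 (Nat.zero_le _); linarith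
  calc _ ≤ ‖w N * e (f N)‖ + ‖w 0 * e (f 0)‖ +
        ‖∑ n ∈ Finset.range N, (w (n + 1) - w n) * e (f (n + 1))‖ :=
        (norm_sub_le _ _).trans (add_le_add_left (norm_sub_le _ _) _)
    _ ≤ 1 / (4 * l) + 1 / (4 * l) + 2 * Real.pi / (16 * l ^ 2) * (A * l) := by
        rw [norm_mul, norm_mul, norm_e, norm_e, mul_one, mul_one]
        exact add_le_add (add_le_add (hwn _ le_rfl) (hwn _ (Nat.zero_le _))) hsum
    _ ≤ (1 + A) / l := by
        have e1 : 1 / (4 * l) + 1 / (4 * l) + 2 * Real.pi / (16 * l ^ 2) * (A * l) =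
          (1 / 2 + Real.pi / 8 * A) / l := by field_simp; ring
        rw [e1]
        have hA1 : 0 ≤ A := nonneg_of_mul_nonneg_left hA0 hl
        gcongr
        · norm_num
        · nlinarith [Real.pi_le_four]

lemma fwdDiff_iter_shift_sub (f : ℕ → ℝ) (j r n : ℕ) :
    (fwdDiff 1)^[j] (fun n => f (n + r) - f n) n =
      ∑ i ∈ Finset.range r, (fwdDiff 1)^[j + 1] f (n + i) := by
  have h : (fun n => f (n + r) - f n) = ∑ i ∈ Finset.range r, fun n => fwdDiff 1 f (n + i) := by
    ext n
    rw [Finset.sum_apply]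
    have := Finset.sum_range_sub (fun i => f (n + i)) r
    simp only [add_zero] at this
    rw [← this]
    rfl
  rw [h, fwdDiff_iter_finsetSum, Finset.sum_apply]
  refine Finset.sum_congr rfl fun i _ => ?_
  rw [fwdDiff_iter_comp_add, ← Function.iterate_succ_apply]

/-- The bound of `kth_derivative_test` is monotone in the length of the sum, so that it may be
applied to a shortened sum and stated with the full length. -/
lemma mul_rpow_add_inv_mono {M N c a : ℝ} (hM : 0 < M) (hMN : M ≤ N) (hc : 0 < c) (ha : 0 ≤ a)
    (ha1 : a ≤ 1) : M * (c + 1 / (M * c)) ^ a ≤ N * (c + 1 / (N * c)) ^ a := by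
  have gen : ∀ T : ℝ, 0 < T → T * (c + 1 / (T * c)) ^ a = T ^ (1 - a) * (T * c + 1 / c) ^ a := by
    intro T hT
    have h1 : T * c + 1 / c = T * (c + 1 / (T * c)) := by field_simp
    have h2 : T ^ (1 - a) * T ^ a = T := by rw [← Real.rpow_add hT]; simp
    rw [h1, Real.mul_rpow hT.le (by positivity), ← mul_assoc, h2]
  rw [gen M hM, gen N (hM.trans_le hMN)]
  have : 0 ≤ 1 - a := by linarith
  have := hM.trans_le hMN
  gcongr

set_option maxHeartbeats 1000000 in
/-- A discrete **van der Corput `k`-th derivative test** (with `k + 1` in place of `k`): a phase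
whose `(k + 1)`-st differences have size about `l` and are decreasing makes the exponential sum
smaller than `N` by a power of `l + 1 / (N l)`. The exponent `4 ^ (-(k + 1))` is far from optimal;
any positive exponent is enough here. -/
theorem kth_derivative_test (A : ℝ) (hA : 1 ≤ A) (k : ℕ) :
    ∃ C : ℝ, 0 < C ∧ ∀ (N : ℕ) (l : ℝ) (f : ℕ → ℝ), 0 < N → 0 < l →
      (∀ n ≤ N, l ≤ (fwdDiff 1)^[k + 1] f n ∧ (fwdDiff 1)^[k + 1] f n ≤ A * l) →
      (∀ n < N, (fwdDiff 1)^[k + 2] f n ≤ 0) →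
      ‖∑ n ∈ Finset.range N, e (f n)‖ ≤ C * N * (l + 1 / (N * l)) ^ ((1 / 4 : ℝ) ^ (k + 1)) := by
  induction k with
  | zero =>
    refine ⟨2 * (1 + A), by positivity, fun N l f hN hl h1 h2 => ?_⟩
    have hN' : (0 : ℝ) < N := by exact_mod_cast hN
    set X : ℝ := l + 1 / (N * l) with hX
    have hX0 : 0 < X := by positivity
    have hnum : (1 / 4 : ℝ) ^ (0 + 1) = 1 / 4 := by norm_num
    rw [hnum]
    have htriv := norm_sum_e_le f N
    rcases le_total 1 X with h | h
    · have : (1 : ℝ) ≤ X ^ (1 / 4 : ℝ) := Real.one_le_rpow h (by norm_num)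
      calc _ ≤ (N : ℝ) := htriv
        _ = 1 * N * 1 := by ring
        _ ≤ 2 * (1 + A) * N * X ^ (1 / 4 : ℝ) := by gcongr; linarith
    · have hXX : X ≤ X ^ (1 / 4 : ℝ) := by
        have := Real.rpow_le_rpow_of_exponent_ge hX0 h (by norm_num : (1 / 4 : ℝ) ≤ 1)
        rwa [Real.rpow_one] at this
      refine le_trans ?_ (mul_le_mul_of_nonneg_left hXX (by positivity))
      have hNX : N * X = N * l + 1 / l := by rw [hX]; field_simp
      rcases le_total (A * l) (1 / 2) with h3 | h3
      · refine (kusmin_landau hl h3 h1 h2).trans ?_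
        have : (1 + A) / l = (1 + A) * (1 / l) := by ring
        rw [this, mul_assoc (2 * (1 + A)), hNX]
        have : 0 < 1 / l := by positivity
        have : 0 < (N : ℝ) * l := by positivity
        nlinarith
      · refine htriv.trans ?_
        rw [mul_assoc (2 * (1 + A)), hNX]
        have : 0 < 1 / l := by positivity
        nlinarith [mul_pos hN' hl]
  | succ k ih =>
    obtain ⟨C, hC, ih⟩ := ih
    set a : ℝ := (1 / 4 : ℝ) ^ (k + 1) with ha
    have ha0 : 0 < a := by positivity
    have ha1 : a ≤ 1 / 4 := by
      rw [ha, pow_succ]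
      have : (1 / 4 : ℝ) ^ k ≤ 1 := pow_le_one₀ (by norm_num) (by norm_num)
      linarith
    have ha' : (1 / 4 : ℝ) ^ (k + 1 + 1) = a / 4 := by rw [ha, pow_succ _ (k + 1)]; ring
    refine ⟨1 + √(8 + 8 * C), by positivity, fun N l f hN hl h1 h2 => ?_⟩
    rw [ha']
    have hN' : (0 : ℝ) < N := by exact_mod_cast hN
    have hN1 : (1 : ℝ) ≤ N := by exact_mod_cast hN
    set X : ℝ := l + 1 / (N * l) with hX
    have hX0 : 0 < X := by positivity
    have htriv := norm_sum_e_le f N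
    rcases le_total 1 X with h | h
    · have : (1 : ℝ) ≤ X ^ (a / 4 : ℝ) := Real.one_le_rpow h (by positivity)
      calc _ ≤ (N : ℝ) := htriv
        _ = 1 * N * 1 := by ring
        _ ≤ (1 + √(8 + 8 * C)) * N * X ^ (a / 4) := by
          gcongr; linarith [Real.sqrt_nonneg (8 + 8 * C)]
    -- the number of shifts is about `X ^ (-1/2)`
    set Y : ℝ := √X with hY
    have hY0 : 0 < Y := Real.sqrt_pos.2 hX0
    have hYX : Y ^ 2 = X := Real.sq_sqrt hX0.le
    have hY1 : Y ≤ 1 := by rw [hY]; exact Real.sqrt_le_one.2 h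
    set H : ℕ := ⌊1 / Y⌋₊ with hH
    have hHle : (H : ℝ) ≤ 1 / Y := Nat.floor_le (by positivity)
    have hH1 : 1 ≤ H := Nat.one_le_floor_iff _ |>.2 (by rw [le_div_iff₀ hY0]; linarith)
    have hH1' : (1 : ℝ) ≤ H := by exact_mod_cast hH1
    have hHY : H * Y ≤ 1 := by rwa [le_div_iff₀ hY0] at hHle
    have hHge : 1 ≤ 2 * Y * H := by
      have : 1 / Y < H + 1 := Nat.lt_floor_add_one _
      rw [div_lt_iff₀ hY0] at this
      nlinarith
    have hXN : 1 ≤ X ^ 2 * N := by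
      have h3 : 0 < 1 / (N * l) := by positivity
      have : X ^ 2 * N = l ^ 2 * N + 2 + 1 / (N * l ^ 2) := by
        rw [hX]; field_simp; ring
      rw [this]
      have : 0 < 1 / (N * l ^ 2) := by positivity
      have : 0 < l ^ 2 * N := by positivity
      linarith
    have hHN : (H : ℝ) ≤ N := by
      have h4 : (H : ℝ) * Y ^ 4 ≤ 1 := by
        have : Y ^ 3 ≤ 1 := pow_le_one₀ hY0.le hY1
        nlinarith [pow_pos hY0 3]
      have h5 : 1 ≤ Y ^ 4 * N := by
        have : X ^ 2 = Y ^ 4 := by rw [← hYX]; ring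
        rwa [this] at hXN
      have h6 : 0 < Y ^ 4 := by positivity
      nlinarith
    have hvdc := vanDerCorput_inequality (fun n => e (f n)) N H
    have hcorr : ∀ r ∈ Finset.range H,
        ‖∑ n ∈ Finset.range (N - r), e (f (n + r)) * (starRingEnd ℂ) (e (f n))‖ ≤
          (if r = 0 then (N : ℝ) else 0) + C * N * Y ^ a := by
      intro r hr
      rw [Finset.mem_range] at hr
      have hrw : ∀ n, e (f (n + r)) * (starRingEnd ℂ) (e (f n)) = e (f (n + r) - f n) := by
        intro n; rw [conj_e, ← e_add, sub_eq_add_neg]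
      simp_rw [hrw]
      rcases Nat.eq_zero_or_pos r with rfl | hr0
      · have := norm_sum_e_le (fun n => f (n + 0) - f n) (N - 0)
        rw [Nat.sub_zero] at this
        rw [if_pos rfl]
        have h4 : 0 ≤ C * N * Y ^ a := by positivity
        simp only [Nat.sub_zero]
        linarith
      rw [if_neg hr0.ne', zero_add]
      have hrN : r < N := lt_of_lt_of_le hr (by exact_mod_cast hHN)
      have hr0' : (0 : ℝ) < r := by exact_mod_cast hr0
      have hr1' : (1 : ℝ) ≤ r := by exact_mod_cast hr0
      have hM0 : (0 : ℝ) < (N - r : ℕ) := by exact_mod_cast Nat.sub_pos_of_lt hrN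
      have hMN : ((N - r : ℕ) : ℝ) ≤ N := by exact_mod_cast Nat.sub_le _ _
      have key := ih (N - r) (r * l) (fun n => f (n + r) - f n) (Nat.sub_pos_of_lt hrN)
        (by positivity) ?_ ?_
      · refine key.trans ?_
        set M : ℝ := ((N - r : ℕ) : ℝ) with hM
        have hmono := mul_rpow_add_inv_mono hM0 hMN (by positivity : 0 < r * l) ha0.le
          (by linarith : a ≤ 1)
        calc C * M * (r * l + 1 / (M * (r * l))) ^ a
            = C * (M * (r * l + 1 / (M * (r * l))) ^ a) := by ring
          _ ≤ C * (N * Y ^ a) := by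
            refine mul_le_mul_of_nonneg_left (hmono.trans ?_) hC.le
            refine mul_le_mul_of_nonneg_left ?_ hN'.le
            refine Real.rpow_le_rpow (by positivity) ?_ ha0.le
            have h5 : (r : ℝ) * l + 1 / (N * (r * l)) ≤ H * X := by
              have hrH : (r : ℝ) ≤ H := by exact_mod_cast hr.le
              have h6 : 1 / (N * (r * l)) ≤ 1 / (N * l) := by
                apply one_div_le_one_div_of_le (by positivity)
                have : 0 < N * l := by positivity
                nlinarith
              have h7 : 0 < 1 / (N * l) := by positivity
              rw [hX, mul_add]
              have : r * l ≤ H * l := by gcongr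
              have : 1 / (N * l) ≤ H * (1 / (N * l)) := le_mul_of_one_le_left h7.le hH1'
              linarith
            refine h5.trans ?_
            rw [← hYX]
            nlinarith
          _ = _ := by ring
      · intro n hn
        rw [fwdDiff_iter_shift_sub]
        have hb : ∀ i ∈ Finset.range r, l ≤ (fwdDiff 1)^[k + 1 + 1] f (n + i) ∧
            (fwdDiff 1)^[k + 1 + 1] f (n + i) ≤ A * l := by
          intro i hi; rw [Finset.mem_range] at hi
          exact h1 (n + i) (by omega)
        constructor
        · have := Finset.card_nsmul_le_sum _ _ _ fun i hi => (hb i hi).1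
          simpa using this
        · have := Finset.sum_le_card_nsmul _ _ _ fun i hi => (hb i hi).2
          simp only [Finset.card_range, nsmul_eq_mul] at this
          linarith
      · intro n hn
        rw [fwdDiff_iter_shift_sub]
        refine Finset.sum_nonpos fun i hi => ?_
        rw [Finset.mem_range] at hi
        exact h2 (n + i) (by omega)
    have hYa : Y ≤ Y ^ a := by
      have := Real.rpow_le_rpow_of_exponent_ge hY0 hY1 (by linarith : a ≤ 1)
      rwa [Real.rpow_one] at this
    have hsum : ∑ r ∈ Finset.range H,
        ‖∑ n ∈ Finset.range (N - r), e (f (n + r)) * (starRingEnd ℂ) (e (f n))‖ ≤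
          H * ((2 + C) * N * Y ^ a) := by
      refine (Finset.sum_le_sum hcorr).trans ?_
      rw [Finset.sum_add_distrib, Finset.sum_ite_eq' (Finset.range H) 0 fun _ => (N : ℝ)]
      simp only [Finset.mem_range, Finset.sum_const, Finset.card_range, nsmul_eq_mul]
      rw [if_pos (by omega)]
      have : (N : ℝ) ≤ 2 * H * N * Y ^ a := by
        calc (N : ℝ) = 1 * N := by ring
          _ ≤ (2 * Y * H) * N := by gcongr
          _ ≤ (2 * Y ^ a * H) * N := by gcongr
          _ = _ := by ring
      linarith
    have hsq : ‖∑ n ∈ Finset.range N, e (f n)‖ ^ 2 ≤ (8 + 8 * C) * N ^ 2 * Y ^ a := by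
      have h6 : (H : ℝ) * ‖∑ n ∈ Finset.range N, e (f n)‖ ^ 2 ≤
          H * ((8 + 8 * C) * N ^ 2 * Y ^ a) := by
        refine hvdc.trans ?_
        calc _ ≤ ((N : ℝ) + N) * (2 * (H * ((2 + C) * N * Y ^ a))) := by gcongr
          _ = H * ((8 + 4 * C) * N ^ 2 * Y ^ a) := by ring
          _ ≤ _ := by gcongr; norm_num
      exact le_of_mul_le_mul_left h6 (by linarith)
    have hfin : ‖∑ n ∈ Finset.range N, e (f n)‖ ≤ √(8 + 8 * C) * N * X ^ (a / 4) := by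
      refine (pow_le_pow_iff_left₀ (norm_nonneg _) (by positivity) two_ne_zero).1 ?_
      refine hsq.trans (le_of_eq ?_)
      have h7 : (X ^ (a / 4)) ^ 2 = Y ^ a := by
        rw [← Real.rpow_natCast, ← Real.rpow_mul hX0.le, hY, Real.sqrt_eq_rpow,
          ← Real.rpow_mul hX0.le]
        congr 1; push_cast; ring
      rw [mul_pow, mul_pow, Real.sq_sqrt (by positivity), h7]
    refine hfin.trans ?_
    gcongr
    linarith

/-! ### Exponential sums over powers -/

lemma hasDerivAt_fwdDiff_iter (k : ℕ) {g g' : ℝ → ℝ} (h : ∀ y > 0, HasDerivAt g (g' y) y) :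
    ∀ y > 0, HasDerivAt ((fwdDiff 1)^[k] g) ((fwdDiff 1)^[k] g' y) y := by
  induction k generalizing g g' with
  | zero => exact h
  | succ k ih =>
    rw [Function.iterate_succ]
    refine ih fun y hy => ?_
    exact ((h (y + 1) (by linarith)).comp_add_const y 1).sub (h y hy)

/-- An iterated mean value theorem for the differences of a power. -/
lemma fwdDiff_iter_rpow (k : ℕ) : ∀ (β x : ℝ), 0 < x → ∃ ξ ∈ Set.Icc x (x + k),
    (fwdDiff 1)^[k] (fun y : ℝ => y ^ β) x = (∏ i ∈ Finset.range k, (β - i)) * ξ ^ (β - k) := by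
  induction k with
  | zero => intro β x hx; exact ⟨x, by simp, by simp⟩
  | succ k ih =>
    intro β x hx
    have hd := hasDerivAt_fwdDiff_iter k (g := fun y : ℝ => y ^ β) (g' := β • fun y : ℝ => y ^ (β - 1))
      (fun y hy => Real.hasDerivAt_rpow_const (Or.inl hy.ne'))
    obtain ⟨c, hc, hc'⟩ := exists_hasDerivAt_eq_slope _ _ (show x < x + 1 by linarith)
      (fun y hy => (hd y (hx.trans_le hy.1)).continuousAt.continuousWithinAt)
      (fun y hy => hd y (hx.trans hy.1))
    obtain ⟨ξ, hξ, hξ'⟩ := ih (β - 1) c (hx.trans hc.1)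
    refine ⟨ξ, ⟨hc.1.le.trans hξ.1, hξ.2.trans ?_⟩, ?_⟩
    · push_cast; linarith [hc.2]
    · rw [fwdDiff_iter_const_smul, Pi.smul_apply, hξ'] at hc'
      rw [Function.iterate_succ_apply', fwdDiff, Finset.prod_range_succ']
      have e1 : ∏ i ∈ Finset.range k, (β - ((i + 1 : ℕ) : ℝ)) =
          ∏ i ∈ Finset.range k, (β - 1 - (i : ℝ)) :=
        Finset.prod_congr rfl fun i _ => by push_cast; ring
      have e2 : β - ((k + 1 : ℕ) : ℝ) = β - 1 - k := by push_cast; ring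
      rw [e1, e2]
      rw [add_sub_cancel_left, div_one, smul_eq_mul] at hc'
      rw [← hc']
      push_cast
      ring

lemma fwdDiff_iter_comp_natCast (f : ℝ → ℝ) (x : ℝ) (k n : ℕ) :
    (fwdDiff 1)^[k] (fun n : ℕ => f (x + n)) n = (fwdDiff 1)^[k] f (x + n) := by
  rw [fwdDiff_iter_eq_sum_shift, fwdDiff_iter_eq_sum_shift]
  refine Finset.sum_congr rfl fun i _ => ?_
  simp [add_assoc]

/-- The exponential sum of `t m ^ α` over a block `M ≤ m < M + N`, `N ≤ M`. On such a block all
values of a derivative of `m ^ α` have the same size, and `kth_derivative_test` applies with the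
order of the derivative chosen so that it is a negative power of `M` with exponent in `(-1, 0)`. -/
lemma exists_norm_block_sum_le {α : ℝ} (hα : 0 < α) (hint : ∀ n : ℕ, α ≠ n) :
    ∃ C a δ : ℝ, 0 < C ∧ 0 < a ∧ a ≤ 1 / 4 ∧ 0 < δ ∧ δ < 1 ∧
      ∀ (t : ℝ) (M N : ℕ), 1 ≤ t → N ≤ M →
        ‖∑ n ∈ Finset.range N, e (t * ((M : ℝ) + n) ^ α)‖ ≤ C * t ^ a * (M : ℝ) ^ (1 - δ) := by
  obtain ⟨k, hk⟩ : ∃ k, ⌈α⌉₊ = k + 1 := Nat.exists_eq_succ_of_ne_zero (Nat.ceil_pos.2 hα).ne'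
  have hk1 : α < k + 1 := by
    have := Nat.le_ceil α
    rw [hk] at this
    have h2 := hint (k + 1)
    push_cast at this h2
    exact lt_of_le_of_ne this h2
  have hk2 : (k : ℝ) < α := by
    have := Nat.ceil_lt_add_one hα.le
    rw [hk] at this; push_cast at this; linarith
  set θ : ℝ := k + 1 - α with hθ
  have hθ0 : 0 < θ := by linarith
  have hθ1 : θ < 1 := by linarith
  set P : ℝ := ∏ i ∈ Finset.range (k + 1), (α - i) with hP
  have hP0 : 0 < P := Finset.prod_pos fun i hi => by
    have : (i : ℝ) ≤ k := by exact_mod_cast Nat.lt_succ_iff.1 (Finset.mem_range.1 hi)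
    linarith
  set A : ℝ := ((k : ℝ) + 3) ^ θ with hA
  have hA1 : 1 ≤ A := Real.one_le_rpow (by have : (0 : ℝ) ≤ k := k.cast_nonneg; linarith) hθ0.le
  obtain ⟨C, hC, hker⟩ := kth_derivative_test A hA1 k
  set a : ℝ := (1 / 4 : ℝ) ^ (k + 1) with ha
  have ha0 : 0 < a := by positivity
  have ha1 : a ≤ 1 / 4 := by
    rw [ha, pow_succ]
    have : (1 / 4 : ℝ) ^ k ≤ 1 := pow_le_one₀ (by norm_num) (by norm_num)
    linarith
  set c : ℝ := P / A with hc
  have hc0 : 0 < c := by positivity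
  set δ₀ : ℝ := min θ (1 - θ) with hδ₀
  have hδ₀0 : 0 < δ₀ := lt_min hθ0 (by linarith)
  have hδ₀1 : δ₀ < 1 := (min_le_left _ _).trans_lt hθ1
  refine ⟨C * (c + 1 / c) ^ a, a, δ₀ * a, by positivity, ha0, ha1, by positivity,
    by nlinarith, fun t M N ht hNM => ?_⟩
  rcases Nat.eq_zero_or_pos N with rfl | hN
  · simp; positivity
  have hM : 0 < M := hN.trans_le hNM
  have hM0 : (0 : ℝ) < M := by exact_mod_cast hM
  have hM1 : (1 : ℝ) ≤ M := by exact_mod_cast hM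
  have hN0 : (0 : ℝ) < N := by exact_mod_cast hN
  have hNM' : (N : ℝ) ≤ M := by exact_mod_cast hNM
  have ht0 : 0 < t := by linarith
  have hdiff : ∀ j n : ℕ, (fwdDiff 1)^[j] (fun n : ℕ => t * ((M : ℝ) + n) ^ α) n =
      t * (fwdDiff 1)^[j] (fun y : ℝ => y ^ α) (M + n) := by
    intro j n
    have := fwdDiff_iter_const_smul 1 t (fun n : ℕ => ((M : ℝ) + n) ^ α) j
    rw [← fwdDiff_iter_comp_natCast]
    exact congrFun this n
  set l : ℝ := c * t * (M : ℝ) ^ (-θ) with hl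
  have hl0 : 0 < l := by positivity
  have key := hker N l (fun n : ℕ => t * ((M : ℝ) + n) ^ α) hN hl0 ?_ ?_
  · refine key.trans ?_
    have h1 := mul_rpow_add_inv_mono hN0 hNM' hl0 ha0.le (by linarith)
    have h2 : l + 1 / (M * l) ≤ (c + 1 / c) * t * (M : ℝ) ^ (-δ₀) := by
      have e1 : (M : ℝ) ^ (-θ) ≤ (M : ℝ) ^ (-δ₀) :=
        Real.rpow_le_rpow_of_exponent_le hM1 (neg_le_neg (min_le_left _ _))
      have e2 : 1 / (M * l) = 1 / c * (1 / t) * (M : ℝ) ^ (θ - 1) := by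
        rw [hl, Real.rpow_sub_one hM0.ne', Real.rpow_neg hM0.le]
        field_simp
      have e3 : (M : ℝ) ^ (θ - 1) ≤ (M : ℝ) ^ (-δ₀) :=
        Real.rpow_le_rpow_of_exponent_le hM1 (by linarith [min_le_right θ (1 - θ)])
      have e4 : 1 / t ≤ t := by
        rw [div_le_iff₀ ht0]; nlinarith
      rw [e2, hl]
      calc _ ≤ c * t * (M : ℝ) ^ (-δ₀) + 1 / c * t * (M : ℝ) ^ (-δ₀) := by gcongr
        _ = _ := by ring
    calc C * N * (l + 1 / (N * l)) ^ a = C * (N * (l + 1 / (N * l)) ^ a) := by ring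
      _ ≤ C * (M * ((c + 1 / c) * t * (M : ℝ) ^ (-δ₀)) ^ a) := by
        refine mul_le_mul_of_nonneg_left (h1.trans ?_) hC.le
        gcongr
      _ = _ := by
        rw [Real.mul_rpow (by positivity) (by positivity), Real.mul_rpow (by positivity) ht0.le,
          ← Real.rpow_mul hM0.le, sub_eq_add_neg, Real.rpow_add hM0, Real.rpow_one, neg_mul]
        ring
  · intro n hn
    rw [hdiff]
    obtain ⟨ξ, hξ, he⟩ := fwdDiff_iter_rpow (k + 1) α (M + n) (by positivity)
    have hn' : (n : ℝ) ≤ M := by exact_mod_cast hn.trans hNM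
    have hn0 : (0 : ℝ) ≤ n := n.cast_nonneg
    have hk0 : (0 : ℝ) ≤ k := k.cast_nonneg
    have hξ1 : M ≤ ξ := by linarith [hξ.1]
    have hξ2 : ξ ≤ (k + 3) * M := by
      have := hξ.2; push_cast at this; nlinarith
    have hξ0 : 0 < ξ := hM0.trans_le hξ1
    rw [he, show α - ((k + 1 : ℕ) : ℝ) = -θ by push_cast; ring]
    have b1 : ξ ^ (-θ) ≤ (M : ℝ) ^ (-θ) := Real.rpow_le_rpow_of_nonpos hM0 hξ1 (by linarith)
    have b2 : (M : ℝ) ^ (-θ) / A ≤ ξ ^ (-θ) := by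
      have := Real.rpow_le_rpow_of_nonpos hξ0 hξ2 (by linarith : -θ ≤ 0)
      rw [Real.mul_rpow (by positivity) hM0.le, Real.rpow_neg (by positivity : (0 : ℝ) ≤ k + 3),
        ← hA] at this
      rw [div_eq_inv_mul]; exact this
    constructor
    · calc l = t * (P * ((M : ℝ) ^ (-θ) / A)) := by rw [hl, hc]; ring
        _ ≤ _ := by gcongr
    · calc _ ≤ t * (P * (M : ℝ) ^ (-θ)) := by gcongr
        _ = A * l := by rw [hl, hc]; field_simp
  · intro n hn
    rw [hdiff]
    obtain ⟨ξ, hξ, he⟩ := fwdDiff_iter_rpow (k + 2) α (M + n) (by positivity)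
    rw [he, Finset.prod_range_succ]
    have hn0 : (0 : ℝ) ≤ n := n.cast_nonneg
    have hξ0 : 0 < ξ := by linarith [hξ.1]
    have h1 : α - ((k + 1 : ℕ) : ℝ) ≤ 0 := by push_cast; linarith
    have : 0 ≤ t * P * ξ ^ (α - ((k + 2 : ℕ) : ℝ)) := by positivity
    have h2 : t * (P * (α - ((k + 1 : ℕ) : ℝ)) * ξ ^ (α - ((k + 2 : ℕ) : ℝ))) =
      (t * P * ξ ^ (α - ((k + 2 : ℕ) : ℝ))) * (α - ((k + 1 : ℕ) : ℝ)) := by ring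
    rw [h2]
    exact mul_nonpos_of_nonneg_of_nonpos this h1

/-- A power saving for `∑ e (t m ^ α)`, with weak dependence on the frequency `t`: the range of
summation is halved repeatedly. -/
theorem exists_norm_sum_e_rpow_le {α : ℝ} (hα : 0 < α) (hint : ∀ n : ℕ, α ≠ n) :
    ∃ C a δ : ℝ, 0 < C ∧ 0 < a ∧ a ≤ 1 / 4 ∧ 0 < δ ∧ δ < 1 ∧
      ∀ (t : ℝ) (M : ℕ), 1 ≤ t →
        ‖∑ n ∈ Finset.range M, e (t * ((n : ℝ) + 1) ^ α)‖ ≤ C * t ^ a * (M : ℝ) ^ (1 - δ) := by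
  obtain ⟨C, a, δ, hC, ha, ha1, hδ, hδ1, hblock⟩ := exists_norm_block_sum_le hα hint
  set q : ℝ := (2 / 3 : ℝ) ^ (1 - δ) with hq
  have hq1 : q < 1 := Real.rpow_lt_one (by norm_num) (by norm_num) (by linarith)
  -- `C'` is chosen so that `C' q + C ≤ C'`, which closes the induction on halving
  set C' : ℝ := 1 + C / (1 - q) with hC'
  have hq0 : 0 < 1 - q := by linarith
  have hC'0 : 0 < C' := by positivity
  have hC'q : C' * q + C ≤ C' := by
    have : C' * (1 - q) = (1 - q) + C := by rw [hC']; field_simp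
    nlinarith
  refine ⟨C', a, δ, hC'0, ha, ha1, hδ, hδ1, fun t M ht => ?_⟩
  have ht0 : 0 < t := by linarith
  have hta : 1 ≤ t ^ a := Real.one_le_rpow ht ha.le
  induction M using Nat.strong_induction_on with
  | _ M ih =>
    rcases Nat.lt_or_ge M 2 with hM | hM
    · refine (norm_sum_e_le _ _).trans ?_
      interval_cases M
      · simp; positivity
      · simp only [Nat.cast_one, Real.one_rpow, mul_one]
        have : 1 ≤ C' := by rw [hC']; have : 0 < C / (1 - q) := by positivity
                            linarith
        nlinarith
    · set h := M / 2 with hh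
      have hsplit : M = (M - h) + h := by omega
      have hsum : ∑ n ∈ Finset.range M, e (t * ((n : ℝ) + 1) ^ α) =
          ∑ n ∈ Finset.range (M - h), e (t * ((n : ℝ) + 1) ^ α) +
            ∑ n ∈ Finset.range h, e (t * (((M - h + 1 : ℕ) : ℝ) + n) ^ α) := by
        conv_lhs => rw [hsplit, Finset.sum_range_add]
        congr 1
        refine Finset.sum_congr rfl fun n _ => ?_
        congr 3
        push_cast; ring
      have h1 := ih (M - h) (by omega)
      have h2 := hblock t (M - h + 1) h ht (by omega)
      have hM' : ((M - h : ℕ) : ℝ) ≤ 2 / 3 * M := by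
        have : 3 * (M - h) ≤ 2 * M := by omega
        have : (3 : ℝ) * ((M - h : ℕ) : ℝ) ≤ 2 * M := by exact_mod_cast this
        linarith
      have hM'' : ((M - h + 1 : ℕ) : ℝ) ≤ M := by
        have : M - h + 1 ≤ M := by omega
        exact_mod_cast this
      have hδ' : 0 ≤ 1 - δ := by linarith
      rw [hsum]
      calc _ ≤ C' * t ^ a * ((M - h : ℕ) : ℝ) ^ (1 - δ) +
            C * t ^ a * ((M - h + 1 : ℕ) : ℝ) ^ (1 - δ) := (norm_add_le _ _).trans (add_le_add h1 h2)
        _ ≤ C' * t ^ a * (2 / 3 * M) ^ (1 - δ) + C * t ^ a * (M : ℝ) ^ (1 - δ) := by gcongr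
        _ = (C' * q + C) * (t ^ a * (M : ℝ) ^ (1 - δ)) := by
          rw [Real.mul_rpow (by norm_num) (Nat.cast_nonneg _)]; ring
        _ ≤ C' * (t ^ a * (M : ℝ) ^ (1 - δ)) := by gcongr
        _ = _ := by ring

/-! ### Fractional parts of powers -/

/-- The `1`-periodic extension of the second Bernoulli polynomial `y² - y + 1/6`; up to the
factor `2` it is a continuous antiderivative of the sawtooth `{y} - 1/2`. -/
noncomputable def bernoulliTwo (y : ℝ) : ℝ := Int.fract y ^ 2 - Int.fract y + 1 / 6

lemma hasSum_bernoulliTwo (y : ℝ) :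
    HasSum (fun n : ℕ => 1 / (n : ℝ) ^ 2 * Real.cos (2 * Real.pi * (n * y)))
      (Real.pi ^ 2 * bernoulliTwo y) := by
  have h := hasSum_one_div_nat_pow_mul_cos (k := 1) one_ne_zero (x := Int.fract y)
    ⟨Int.fract_nonneg y, (Int.fract_lt_one y).le⟩
  convert h using 1
  · ext n
    congr 1
    have : 2 * Real.pi * n * Int.fract y =
        2 * Real.pi * (n * y) - ((n * ⌊y⌋ : ℤ) : ℝ) * (2 * Real.pi) := by
      rw [Int.fract]; push_cast; ring
    rw [this, Real.cos_sub_int_mul_two_pi]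
  · have : (Polynomial.map (algebraMap ℚ ℝ) (Polynomial.bernoulli (2 * 1))).eval (Int.fract y) =
        bernoulliTwo y := by
      rw [Polynomial.eval_map_algebraMap, Polynomial.bernoulli]
      simp [Finset.sum_range_succ, bernoulliTwo, bernoulli_two]
      ring
    rw [this]
    simp [Nat.factorial]
    left; ring

lemma bernoulliTwo_add_sub_le (y : ℝ) {d : ℝ} (h0 : 0 < d) (h1 : d ≤ 1) :
    bernoulliTwo (y + d) - bernoulliTwo y ≤ 2 * d * (Int.fract y - 1 / 2 + d) := by
  have a0 := Int.fract_nonneg y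
  have a1 := Int.fract_lt_one y
  rcases lt_or_ge (Int.fract y + d) 1 with h | h
  · have : Int.fract (y + d) = Int.fract y + d := by
      rw [Int.fract_eq_iff]
      exact ⟨by linarith, h, ⌊y⌋, by rw [Int.fract]; ring⟩
    rw [bernoulliTwo, bernoulliTwo, this]
    nlinarith
  · have : Int.fract (y + d) = Int.fract y + d - 1 := by
      rw [Int.fract_eq_iff]
      exact ⟨by linarith, by linarith, ⌊y⌋ + 1, by push_cast; rw [Int.fract]; ring⟩
    rw [bernoulliTwo, bernoulliTwo, this]
    nlinarith

lemma le_bernoulliTwo_sub_sub (y : ℝ) {d : ℝ} (h0 : 0 < d) (h1 : d ≤ 1) :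
    2 * d * (Int.fract y - 1 / 2 - d) ≤ bernoulliTwo y - bernoulliTwo (y - d) := by
  have a0 := Int.fract_nonneg y
  have a1 := Int.fract_lt_one y
  rcases lt_or_ge (Int.fract y) d with h | h
  · have : Int.fract (y - d) = Int.fract y - d + 1 := by
      rw [Int.fract_eq_iff]
      exact ⟨by linarith, by linarith, ⌊y⌋ - 1, by push_cast; rw [Int.fract]; ring⟩
    rw [bernoulliTwo, bernoulliTwo, this]
    nlinarith
  · have : Int.fract (y - d) = Int.fract y - d := by
      rw [Int.fract_eq_iff]
      exact ⟨by linarith, by linarith, ⌊y⌋, by rw [Int.fract]; ring⟩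
    rw [bernoulliTwo, bernoulliTwo, this]
    nlinarith

lemma re_e (x : ℝ) : (e x).re = Real.cos (2 * Real.pi * x) := by
  rw [e, mul_comm, Complex.exp_ofReal_mul_I_re]

/-- An **Erdős–Turán** type inequality: bounds `E h ^ (1 / 4)` for the exponential sums of all
frequencies `h` bound the sum of the sawtooth function. The sawtooth is compared with the difference
quotients of step `d` of `bernoulliTwo`, whose Fourier series converges absolutely. -/
lemma exists_abs_sum_fract_le : ∃ c : ℝ, 0 < c ∧ ∀ (y : ℕ → ℝ) (M : ℕ) (E d : ℝ), 0 < d → d ≤ 1 →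
    (∀ h : ℕ, 1 ≤ h → ‖∑ m ∈ Finset.range M, e (h * y m)‖ ≤ E * (h : ℝ) ^ (1 / 4 : ℝ)) →
    |∑ m ∈ Finset.range M, (Int.fract (y m) - 1 / 2)| ≤ d * M + c * E / d := by
  have hs : Summable fun n : ℕ => (n : ℝ) ^ (-(7 / 4) : ℝ) :=
    Real.summable_nat_rpow.2 (by norm_num)
  set S : ℝ := ∑' n : ℕ, (n : ℝ) ^ (-(7 / 4) : ℝ) with hS
  have hS0 : 0 ≤ S := tsum_nonneg fun n => by positivity
  refine ⟨(S + 1) / Real.pi ^ 2, by positivity, fun y M E d hd hd1 hE => ?_⟩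
  have hE0 : 0 ≤ E := by
    have := (norm_nonneg _).trans (hE 1 le_rfl)
    simpa using this
  have hB : ∀ τ : ℝ, |∑ m ∈ Finset.range M, bernoulliTwo (y m + τ)| ≤
      (S + 1) / Real.pi ^ 2 * E := by
    intro τ
    have h1 : HasSum (fun n : ℕ => ∑ m ∈ Finset.range M,
        1 / (n : ℝ) ^ 2 * Real.cos (2 * Real.pi * (n * (y m + τ))))
        (∑ m ∈ Finset.range M, Real.pi ^ 2 * bernoulliTwo (y m + τ)) :=
      hasSum_sum fun m _ => hasSum_bernoulliTwo _
    have h2 : ∀ n : ℕ, ‖∑ m ∈ Finset.range M,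
        1 / (n : ℝ) ^ 2 * Real.cos (2 * Real.pi * (n * (y m + τ)))‖ ≤
          E * (n : ℝ) ^ (-(7 / 4) : ℝ) := by
      intro n
      rcases Nat.eq_zero_or_pos n with rfl | hn
      · simp
      have hn0 : (0 : ℝ) < n := by exact_mod_cast hn
      rw [← Finset.mul_sum, norm_mul]
      have h3 : ∑ m ∈ Finset.range M, Real.cos (2 * Real.pi * (n * (y m + τ))) =
          (e (n * τ) * ∑ m ∈ Finset.range M, e (n * y m)).re := by
        rw [Finset.mul_sum, Complex.re_sum]
        refine Finset.sum_congr rfl fun m _ => ?_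
        rw [← e_add, re_e]; congr 2; ring
      have h4 : ‖∑ m ∈ Finset.range M, Real.cos (2 * Real.pi * (n * (y m + τ)))‖ ≤
          E * (n : ℝ) ^ (1 / 4 : ℝ) := by
        rw [h3, Real.norm_eq_abs]
        refine (Complex.abs_re_le_norm _).trans ?_
        rw [norm_mul, norm_e, one_mul]
        exact hE n hn
      calc _ ≤ ‖1 / (n : ℝ) ^ 2‖ * (E * (n : ℝ) ^ (1 / 4 : ℝ)) := by gcongr
        _ = E * ((n : ℝ) ^ (-2 : ℝ) * (n : ℝ) ^ (1 / 4 : ℝ)) := by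
          rw [Real.norm_of_nonneg (by positivity), Real.rpow_neg hn0.le, Real.rpow_two]; ring
        _ = _ := by rw [← Real.rpow_add hn0]; norm_num
    have h3 := tsum_of_norm_bounded (hs.hasSum.mul_left E) h2
    rw [h1.tsum_eq, ← Finset.mul_sum, norm_mul, Real.norm_of_nonneg (by positivity),
      Real.norm_eq_abs] at h3
    rw [div_mul_eq_mul_div, le_div_iff₀ (by positivity)]
    nlinarith
  have hB0 := hB 0
  simp only [add_zero] at hB0
  have hBp := hB d
  have hBm := hB (-d)
  have up := Finset.sum_le_sum fun m (_ : m ∈ Finset.range M) => bernoulliTwo_add_sub_le (y m) hd hd1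
  have lo := Finset.sum_le_sum fun m (_ : m ∈ Finset.range M) => le_bernoulliTwo_sub_sub (y m) hd hd1
  rw [Finset.sum_sub_distrib, ← Finset.mul_sum, Finset.sum_add_distrib] at up
  rw [Finset.sum_sub_distrib, ← Finset.mul_sum, Finset.sum_sub_distrib] at lo
  simp only [Finset.sum_const, Finset.card_range, nsmul_eq_mul] at up lo
  simp only [← sub_eq_add_neg] at hBm
  set T := ∑ m ∈ Finset.range M, (Int.fract (y m) - 1 / 2)
  set K := (S + 1) / Real.pi ^ 2 * E
  rw [abs_le] at hB0 hBp hBm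
  rw [abs_le]
  have hK : d * (K / d) = K := by field_simp
  constructor
  · have : d * (-(d * M + K / d)) ≤ d * T := by nlinarith
    exact le_of_mul_le_mul_left this hd
  · have : d * T ≤ d * (d * M + K / d) := by nlinarith
    exact le_of_mul_le_mul_left this hd

/-- For `α` not an integer the fractional parts `{-m ^ α}` average to `1 / 2`, with a power
saving. -/
theorem exists_abs_sum_fract_rpow_le {α : ℝ} (hα : 0 < α) (hint : ∀ n : ℕ, α ≠ n) :
    ∃ C δ : ℝ, 0 < C ∧ 0 < δ ∧ δ < 1 ∧ ∀ M : ℕ,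
      |∑ m ∈ Finset.range M, (Int.fract (-((m : ℝ) + 1) ^ α) - 1 / 2)| ≤
        C * (M : ℝ) ^ (1 - δ) := by
  obtain ⟨C, a, δ, hC, ha, ha1, hδ, hδ1, hsum⟩ := exists_norm_sum_e_rpow_le hα hint
  obtain ⟨c, hc, hfract⟩ := exists_abs_sum_fract_le
  refine ⟨1 + c * C, δ / 2, by positivity, by linarith, by linarith, fun M => ?_⟩
  rcases Nat.eq_zero_or_pos M with rfl | hM
  · simp; positivity
  have hM0 : (0 : ℝ) < M := by exact_mod_cast hM
  have hM1 : (1 : ℝ) ≤ M := by exact_mod_cast hM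
  have := hfract (fun m => -((m : ℝ) + 1) ^ α) M (C * (M : ℝ) ^ (1 - δ)) ((M : ℝ) ^ (-(δ / 2)))
    (by positivity) (Real.rpow_le_one_of_one_le_of_nonpos hM1 (by linarith)) ?_
  · refine this.trans (le_of_eq ?_)
    have e1 : (M : ℝ) ^ (-(δ / 2)) * M = (M : ℝ) ^ (1 - δ / 2) := by
      rw [← Real.rpow_add_one hM0.ne']; congr 1; ring
    have e2 : (M : ℝ) ^ (1 - δ) / (M : ℝ) ^ (-(δ / 2)) = (M : ℝ) ^ (1 - δ / 2) := by
      rw [← Real.rpow_sub hM0]; congr 1; ring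
    rw [e1, ← mul_assoc, mul_div_assoc, e2]; ring
  · intro h hh
    have hh1 : (1 : ℝ) ≤ h := by exact_mod_cast hh
    have e1 : ∑ m ∈ Finset.range M, e (h * -((m : ℝ) + 1) ^ α) =
        (starRingEnd ℂ) (∑ m ∈ Finset.range M, e (h * ((m : ℝ) + 1) ^ α)) := by
      rw [map_sum]
      refine Finset.sum_congr rfl fun m _ => ?_
      rw [conj_e, mul_neg]
    rw [e1, Complex.norm_conj]
    refine (hsum h M hh1).trans ?_
    calc C * (h : ℝ) ^ a * (M : ℝ) ^ (1 - δ) = C * (M : ℝ) ^ (1 - δ) * (h : ℝ) ^ a := by ring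
      _ ≤ _ := by gcongr

/-! ### Binomial series and the recursion for the Riemann zeta function -/

/-- The generalized binomial coefficient `β (β - 1) ⋯ (β - h + 1) / h!` with complex `β`. -/
noncomputable def gbinom (β : ℂ) (h : ℕ) : ℂ :=
  (∏ i ∈ Finset.range h, (β - i)) / (Nat.factorial h : ℂ)

lemma gbinom_zero (β : ℂ) : gbinom β 0 = 1 := by simp [gbinom]

lemma gbinom_succ_mul (β : ℂ) (h : ℕ) :
    gbinom β (h + 1) * (h + 1) = β * gbinom (β - 1) h := by
  have h1 : ∏ i ∈ Finset.range (h + 1), (β - i) = β * ∏ i ∈ Finset.range h, (β - 1 - i) := by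
    rw [Finset.prod_range_succ', mul_comm]
    congr 1
    · simp
    · exact Finset.prod_congr rfl fun i _ => by push_cast; ring
  have h2 : (Nat.factorial h : ℂ) ≠ 0 := by exact_mod_cast Nat.factorial_ne_zero h
  have h3 : (h : ℂ) + 1 ≠ 0 := by exact_mod_cast Nat.succ_ne_zero h
  rw [gbinom, gbinom, h1, Nat.factorial_succ]
  push_cast
  field_simp

lemma norm_gbinom_le (β : ℂ) (h : ℕ) : ‖gbinom β h‖ ≤ ∏ i ∈ Finset.range h, ‖β - i‖ := by
  rw [gbinom, norm_div, norm_prod]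
  refine div_le_self (Finset.prod_nonneg fun _ _ => norm_nonneg _) ?_
  simp only [Complex.norm_natCast]
  exact_mod_cast Nat.factorial_pos h

lemma differentiable_gbinom (h : ℕ) : Differentiable ℂ fun β => gbinom β h := by
  unfold gbinom
  fun_prop

/-- The error in truncating the binomial series of `(1 + y) ^ β` after `H` terms. -/
noncomputable def binomRem (H : ℕ) (β y : ℂ) : ℂ :=
  (1 + y) ^ β - ∑ h ∈ Finset.range H, gbinom β h * y ^ h

lemma hasDerivAt_binomRem (H : ℕ) (β : ℂ) {y : ℂ} (hy : 1 + y ∈ Complex.slitPlane) :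
    HasDerivAt (binomRem (H + 1) β) (β * binomRem H (β - 1) y) y := by
  have h1 : HasDerivAt (fun y : ℂ => (1 + y) ^ β) (β * (1 + y) ^ (β - 1) * 1) y :=
    ((hasDerivAt_id y).const_add 1).cpow_const hy
  have h2 : HasDerivAt (fun y : ℂ => ∑ h ∈ Finset.range (H + 1), gbinom β h * y ^ h)
      (∑ h ∈ Finset.range H, β * gbinom (β - 1) h * y ^ h) y := by
    have : HasDerivAt (fun y : ℂ => ∑ h ∈ Finset.range (H + 1), gbinom β h * y ^ h)
        (∑ h ∈ Finset.range (H + 1), gbinom β h * (h * y ^ (h - 1))) y :=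
      HasDerivAt.fun_sum fun h _ => (hasDerivAt_pow h y).const_mul _
    convert this using 1
    rw [Finset.sum_range_succ']
    simp only [Nat.cast_zero, zero_mul, mul_zero, add_zero, Nat.add_sub_cancel]
    refine Finset.sum_congr rfl fun h _ => ?_
    rw [← gbinom_succ_mul]; push_cast; ring
  refine (h1.sub h2).congr_deriv ?_
  rw [binomRem, mul_sub, Finset.mul_sum, mul_one]
  congr 1
  exact Finset.sum_congr rfl fun h _ => by ring

lemma binomRem_succ_zero (H : ℕ) (β : ℂ) : binomRem (H + 1) β 0 = 0 := by
  rw [binomRem, Finset.sum_range_succ']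
  simp [gbinom_zero]

/-- The derivative of a remainder is a remainder of one order less, which is integrated from `0`. -/
lemma norm_binomRem_le {b : ℝ} (hb : 0 ≤ b) (H : ℕ) : ∀ (β : ℂ), β.re ≤ b → ∀ y : ℝ, 0 ≤ y →
    y ≤ 1 → ‖binomRem H β y‖ ≤ (∏ i ∈ Finset.range H, ‖β - i‖) * 2 ^ b * y ^ H := by
  induction H with
  | zero =>
    intro β hβ y hy hy1
    have h0 : (0 : ℝ) < 1 + y := by linarith
    simp only [binomRem, Finset.range_zero, Finset.sum_empty, sub_zero, Finset.prod_empty, one_mul,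
      pow_zero, mul_one]
    have : (1 : ℂ) + y = ((1 + y : ℝ) : ℂ) := by push_cast; ring
    rw [this, Complex.norm_cpow_eq_rpow_re_of_pos h0]
    calc (1 + y) ^ β.re ≤ (1 + y) ^ b := Real.rpow_le_rpow_of_exponent_le (by linarith) hβ
      _ ≤ 2 ^ b := Real.rpow_le_rpow h0.le (by linarith) hb
  | succ H ih =>
    intro β hβ y hy hy1
    have key := norm_image_sub_le_of_norm_deriv_le_segment' (a := 0) (b := y)
      (f := fun u : ℝ => binomRem (H + 1) β u) (f' := fun u : ℝ => β * binomRem H (β - 1) u)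
      (C := (∏ i ∈ Finset.range (H + 1), ‖β - i‖) * 2 ^ b * y ^ H) ?_ ?_ y ⟨hy, le_rfl⟩
    · simp only [Complex.ofReal_zero, binomRem_succ_zero, sub_zero] at key
      rw [pow_succ, ← mul_assoc]
      exact key
    · intro u hu
      refine (HasDerivAt.comp_ofReal (hasDerivAt_binomRem H β ?_)).hasDerivWithinAt
      left
      have := hu.1
      simp; linarith
    · intro u hu
      have h1 := ih (β - 1) (by simp; linarith) u hu.1 (hu.2.le.trans hy1)
      rw [norm_mul, Finset.prod_range_succ']
      have e1 : ∏ i ∈ Finset.range H, ‖β - ((i + 1 : ℕ) : ℂ)‖ =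
          ∏ i ∈ Finset.range H, ‖β - 1 - (i : ℂ)‖ :=
        Finset.prod_congr rfl fun i _ => by push_cast; ring_nf
      rw [e1]
      have hu0 := hu.1
      have hu2 := hu.2.le
      calc _ ≤ ‖β‖ * ((∏ i ∈ Finset.range H, ‖β - 1 - (i : ℂ)‖) * 2 ^ b * u ^ H) := by gcongr
        _ ≤ ‖β‖ * ((∏ i ∈ Finset.range H, ‖β - 1 - (i : ℂ)‖) * 2 ^ b * y ^ H) := by
          gcongr
        _ = _ := by simp; ring

/-- The error in the expansion of `(x + 1) ^ β` in the powers `x ^ (β - h)`, `h < H`. -/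
noncomputable def powRem (H : ℕ) (β : ℂ) (x : ℝ) : ℂ :=
  ((x + 1 : ℝ) : ℂ) ^ β - ∑ h ∈ Finset.range H, gbinom β h * (x : ℂ) ^ (β - h)

lemma powRem_eq (H : ℕ) (β : ℂ) {x : ℝ} (hx : 0 < x) :
    powRem H β x = (x : ℂ) ^ β * binomRem H β ((x⁻¹ : ℝ) : ℂ) := by
  have hx' : (x : ℂ) ≠ 0 := by exact_mod_cast hx.ne'
  rw [powRem, binomRem, mul_sub, Finset.mul_sum]
  congr 1
  · have : (1 : ℂ) + ((x⁻¹ : ℝ) : ℂ) = ((1 + x⁻¹ : ℝ) : ℂ) := by push_cast; ring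
    rw [this, ← Complex.mul_cpow_ofReal_nonneg hx.le (by positivity), ← Complex.ofReal_mul]
    congr 2
    field_simp
  · refine Finset.sum_congr rfl fun h _ => ?_
    rw [Complex.cpow_sub _ _ hx', Complex.cpow_natCast]
    push_cast
    rw [inv_pow]
    ring

lemma norm_powRem_le {b : ℝ} (hb : 0 ≤ b) (H : ℕ) {β : ℂ} (hβ : β.re ≤ b) {x : ℝ} (hx : 1 ≤ x) :
    ‖powRem H β x‖ ≤ (∏ i ∈ Finset.range H, ‖β - i‖) * 2 ^ b * x ^ (β.re - H) := by
  have hx0 : 0 < x := by linarith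
  rw [powRem_eq H β hx0, norm_mul, Complex.norm_cpow_eq_rpow_re_of_pos hx0]
  have h1 := norm_binomRem_le hb H β hβ x⁻¹ (by positivity) (inv_le_one_of_one_le₀ hx)
  calc _ ≤ x ^ β.re * ((∏ i ∈ Finset.range H, ‖β - i‖) * 2 ^ b * x⁻¹ ^ H) := by gcongr
    _ = _ := by
      rw [Real.rpow_sub hx0, Real.rpow_natCast, inv_pow]; ring

lemma differentiable_powRem (H : ℕ) {x : ℝ} (hx : 0 < x) :
    Differentiable ℂ fun β => powRem H β x := by
  have hx' : (x : ℂ) ≠ 0 := by exact_mod_cast hx.ne'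
  have hx1 : ((x + 1 : ℝ) : ℂ) ≠ 0 := by exact_mod_cast (by linarith : x + 1 ≠ 0)
  unfold powRem
  refine Differentiable.sub (differentiable_id.const_cpow (Or.inl hx1)) ?_
  refine Differentiable.fun_sum fun h _ => (differentiable_gbinom h).mul ?_
  exact (differentiable_id.sub_const _).const_cpow (Or.inl hx')

lemma summable_succ_rpow {ε : ℝ} (hε : 0 < ε) :
    Summable fun n : ℕ => ((n : ℝ) + 1) ^ (-(1 + ε)) := by
  have h := (summable_nat_add_iff 1).2 (Real.summable_nat_rpow (p := -(1 + ε)) |>.2 (by linarith))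
  simpa using h

section PolynomiallyBounded

variable {f : ℕ → ℂ → ℂ} {Q : ℝ → ℝ} {σ : ℝ}

/-! #### Series of functions bounded by a function of `‖s‖` times `n ^ (-1 - Re s + σ)` -/

lemma norm_term_le_of_bound (hQ : ∀ r, 0 ≤ r → 0 ≤ Q r)
    (hf : ∀ n s, σ < s.re → ‖f n s‖ ≤ Q ‖s‖ * ((n : ℝ) + 1) ^ (-(1 + (s.re - σ))))
    {ε : ℝ} (hε : 0 < ε) {s : ℂ} (hs : σ + ε ≤ s.re) (n : ℕ) :
    ‖f n s‖ ≤ Q ‖s‖ * ((n : ℝ) + 1) ^ (-(1 + ε)) := by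
  refine (hf n s (by linarith)).trans ?_
  refine mul_le_mul_of_nonneg_left ?_ (hQ _ (norm_nonneg _))
  exact Real.rpow_le_rpow_of_exponent_le (by linarith [n.cast_nonneg (α := ℝ)]) (by linarith)

lemma summable_of_bound
    (hf : ∀ n s, σ < s.re → ‖f n s‖ ≤ Q ‖s‖ * ((n : ℝ) + 1) ^ (-(1 + (s.re - σ))))
    {s : ℂ} (hs : σ < s.re) : Summable fun n => f n s := by
  refine Summable.of_norm_bounded
    ((summable_succ_rpow (show 0 < s.re - σ by linarith)).mul_left (Q ‖s‖)) fun n => hf n s hs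

lemma norm_tsum_le_of_bound (hQ : ∀ r, 0 ≤ r → 0 ≤ Q r)
    (hf : ∀ n s, σ < s.re → ‖f n s‖ ≤ Q ‖s‖ * ((n : ℝ) + 1) ^ (-(1 + (s.re - σ))))
    {ε : ℝ} (hε : 0 < ε) {s : ℂ} (hs : σ + ε ≤ s.re) :
    ‖∑' n, f n s‖ ≤ Q ‖s‖ * ∑' n : ℕ, ((n : ℝ) + 1) ^ (-(1 + ε)) :=
  tsum_of_norm_bounded ((summable_succ_rpow hε).hasSum.mul_left (Q ‖s‖))
    (norm_term_le_of_bound hQ hf hε hs)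

lemma differentiableOn_tsum_of_bound (hQ : ∀ r, 0 ≤ r → 0 ≤ Q r) (hQm : MonotoneOn Q (Set.Ici 0))
    (hf : ∀ n s, σ < s.re → ‖f n s‖ ≤ Q ‖s‖ * ((n : ℝ) + 1) ^ (-(1 + (s.re - σ))))
    (hd : ∀ n, DifferentiableOn ℂ (f n) {s | σ < s.re}) :
    DifferentiableOn ℂ (fun s => ∑' n, f n s) {s | σ < s.re} := by
  intro s hs
  have hs' : σ < s.re := hs
  set ε := (s.re - σ) / 2 with hε
  have hε0 : 0 < ε := by rw [hε]; linarith
  set V : Set ℂ := {w | σ + ε < w.re} ∩ Metric.ball 0 (‖s‖ + 1) with hV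
  have hVo : IsOpen V := (isOpen_lt continuous_const Complex.continuous_re).inter Metric.isOpen_ball
  have hsV : s ∈ V := ⟨by change σ + ε < s.re; rw [hε]; linarith, by simp⟩
  have hVd : DifferentiableOn ℂ (fun s => ∑' n, f n s) V := by
    refine Complex.differentiableOn_tsum_of_summable_norm
      ((summable_succ_rpow hε0).mul_left (Q (‖s‖ + 1)))
      (fun n => (hd n).mono fun w hw => ?_) hVo fun n w hw => ?_
    · have : σ + ε < w.re := hw.1
      change σ < w.re; linarith
    · have h1 : σ + ε < w.re := hw.1
      have h2 : ‖w‖ < ‖s‖ + 1 := by simpa using hw.2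
      refine (norm_term_le_of_bound hQ hf hε0 h1.le n).trans ?_
      have := hQm (Set.mem_Ici.2 (norm_nonneg w)) (Set.mem_Ici.2 (by positivity)) h2.le
      gcongr
  exact (hVd.differentiableAt (hVo.mem_nhds hsV)).differentiableWithinAt

end PolynomiallyBounded

lemma hasSum_riemannZeta {s : ℂ} (hs : 1 < s.re) :
    HasSum (fun n : ℕ => (((n : ℝ) + 1 : ℝ) : ℂ) ^ (-s)) (riemannZeta s) := by
  have h1 : Summable fun n : ℕ => (((n : ℝ) + 1 : ℝ) : ℂ) ^ (-s) := by
    refine Summable.of_norm_bounded (summable_succ_rpow (show 0 < s.re - 1 by linarith)) fun n => ?_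
    rw [Complex.norm_cpow_eq_rpow_re_of_pos (by positivity)]
    simp
  have h2 : riemannZeta s = ∑' n : ℕ, (((n : ℝ) + 1 : ℝ) : ℂ) ^ (-s) := by
    rw [zeta_eq_tsum_one_div_nat_add_one_cpow hs]
    refine tsum_congr fun n => ?_
    rw [Complex.cpow_neg, one_div]; push_cast; rfl
  rw [h2]; exact h1.hasSum

lemma norm_riemannZeta_le {ε : ℝ} (hε : 0 < ε) {s : ℂ} (hs : 1 + ε ≤ s.re) :
    ‖riemannZeta s‖ ≤ ∑' n : ℕ, ((n : ℝ) + 1) ^ (-(1 + ε)) := by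
  rw [← (hasSum_riemannZeta (by linarith)).tsum_eq]
  refine tsum_of_norm_bounded (summable_succ_rpow hε).hasSum fun n => ?_
  rw [Complex.norm_cpow_eq_rpow_re_of_pos (by positivity)]
  refine Real.rpow_le_rpow_of_exponent_le (by linarith [n.cast_nonneg (α := ℝ)]) ?_
  simp; linarith

lemma hasSum_telescope {g : ℕ → ℂ} (hs : Summable fun n => g (n + 1) - g n)
    (h0 : Tendsto g atTop (𝓝 0)) : HasSum (fun n => g (n + 1) - g n) (-g 0) := by
  have h1 := hs.hasSum.tendsto_sum_nat
  simp_rw [Finset.sum_range_sub] at h1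
  have h2 : Tendsto (fun n => g n - g 0) atTop (𝓝 (0 - g 0)) := h0.sub_const _
  rw [zero_sub] at h2
  rw [← tendsto_nhds_unique h1 h2]
  exact hs.hasSum

lemma tendsto_succ_cpow_zero {s : ℂ} (hs : s.re < 0) :
    Tendsto (fun n : ℕ => (((n : ℝ) + 1 : ℝ) : ℂ) ^ s) atTop (𝓝 0) := by
  rw [tendsto_zero_iff_norm_tendsto_zero]
  have h1 : ∀ n : ℕ, ‖(((n : ℝ) + 1 : ℝ) : ℂ) ^ s‖ = ((n : ℝ) + 1) ^ (-(-s.re)) := fun n => by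
    rw [Complex.norm_cpow_eq_rpow_re_of_pos (by positivity), neg_neg]
  simp_rw [h1]
  have h2 := (tendsto_rpow_neg_atTop (y := -s.re) (by linarith)).comp
    (tendsto_atTop_add_const_right atTop (1 : ℝ) tendsto_natCast_atTop_atTop)
  exact h2

/-- The bound on the remainder terms in the recursion for `ζ`. -/
lemma norm_zeta_rem_le (K n : ℕ) {w : ℂ} (hw : -(K : ℝ) < w.re) :
    ‖powRem (K + 2) (1 - w) ((n : ℝ) + 1)‖ ≤
      (∏ i ∈ Finset.range (K + 2), ‖1 - w - i‖) * 2 ^ ((K : ℝ) + 1) *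
        ((n : ℝ) + 1) ^ (-(1 + (w.re - -(K : ℝ)))) := by
  have h := norm_powRem_le (b := (K : ℝ) + 1) (by positivity) (K + 2) (β := 1 - w)
    (by simp; linarith) (x := (n : ℝ) + 1) (by linarith [n.cast_nonneg (α := ℝ)])
  refine h.trans (le_of_eq ?_)
  congr 2
  simp; ring

lemma norm_one_sub_sub_le (w : ℂ) {K i : ℕ} (hi : i < K + 2) : ‖1 - w - i‖ ≤ ‖w‖ + (K + 2) := by
  have h1 : (1 - w - i : ℂ) = -w - ((i : ℂ) - 1) := by ring
  rw [h1]
  refine (norm_sub_le _ _).trans ?_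
  rw [norm_neg]
  gcongr
  have h2 : ((i : ℂ) - 1) = (((i : ℝ) - 1 : ℝ) : ℂ) := by push_cast; ring
  rw [h2, Complex.norm_real, Real.norm_eq_abs, abs_le]
  have : (i : ℝ) ≤ K + 1 := by exact_mod_cast Nat.lt_succ_iff.1 hi
  have : (0 : ℝ) ≤ i := i.cast_nonneg
  have : (0 : ℝ) ≤ K := K.cast_nonneg
  constructor <;> linarith

lemma norm_zeta_rem_le' (K n : ℕ) (w : ℂ) (hw : -(K : ℝ) < w.re) :
    ‖powRem (K + 2) (1 - w) ((n : ℝ) + 1)‖ ≤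
      ((‖w‖ + (K + 2)) ^ (K + 2) * 2 ^ ((K : ℝ) + 1)) *
        ((n : ℝ) + 1) ^ (-(1 + (w.re - -(K : ℝ)))) := by
  refine (norm_zeta_rem_le K n hw).trans ?_
  gcongr
  have := Finset.prod_le_prod (s := Finset.range (K + 2)) (f := fun i : ℕ => ‖1 - w - i‖)
    (g := fun _ => ‖w‖ + (K + 2)) (fun _ _ => norm_nonneg _)
    fun i hi => norm_one_sub_sub_le w (Finset.mem_range.1 hi)
  simpa using this

/-- The recursion for `ζ` obtained by summing the binomial expansions of
`(m + 1) ^ (1 - w) - m ^ (1 - w)` over `m`, in the half-plane of absolute convergence. -/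
lemma zeta_recursion_of_one_lt (K : ℕ) {w : ℂ} (hw : 1 < w.re) :
    ∑ h ∈ Finset.range (K + 1), gbinom (1 - w) (h + 1) * riemannZeta (w + h) +
      ∑' n : ℕ, powRem (K + 2) (1 - w) ((n : ℝ) + 1) + 1 = 0 := by
  have hK : (0 : ℝ) ≤ K := K.cast_nonneg
  have hrem : Summable fun n : ℕ => powRem (K + 2) (1 - w) ((n : ℝ) + 1) := by
    exact summable_of_bound (σ := -(K : ℝ)) (Q := fun r => (r + (K + 2)) ^ (K + 2) * 2 ^ ((K : ℝ) + 1))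
      (f := fun n w => powRem (K + 2) (1 - w) ((n : ℝ) + 1)) (fun n s hs => norm_zeta_rem_le' K n s hs) (by linarith)
  have h1 : HasSum (fun n : ℕ => ∑ h ∈ Finset.range (K + 1), gbinom (1 - w) (h + 1) *
      (((n : ℝ) + 1 : ℝ) : ℂ) ^ (-(w + h)))
      (∑ h ∈ Finset.range (K + 1), gbinom (1 - w) (h + 1) * riemannZeta (w + h)) := by
    refine hasSum_sum fun h _ => (hasSum_riemannZeta ?_).mul_left _
    simp; have : (0 : ℝ) ≤ h := h.cast_nonneg
    linarith
  have h2 := h1.add hrem.hasSum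
  set g : ℕ → ℂ := fun n => (((n : ℝ) + 1 : ℝ) : ℂ) ^ (1 - w) with hg
  have h3 : (fun n : ℕ => ∑ h ∈ Finset.range (K + 1), gbinom (1 - w) (h + 1) *
      (((n : ℝ) + 1 : ℝ) : ℂ) ^ (-(w + h)) + powRem (K + 2) (1 - w) ((n : ℝ) + 1)) =
      fun n => g (n + 1) - g n := by
    ext n
    rw [powRem, Finset.sum_range_succ' _ (K + 1)]
    have : ∀ h : ℕ, (1 - w - ((h + 1 : ℕ) : ℂ)) = -(w + h) := fun h => by push_cast; ring
    simp_rw [this]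
    simp only [gbinom_zero, Nat.cast_zero, sub_zero, one_mul, hg]
    push_cast
    ring
  rw [h3] at h2
  have h4 := hasSum_telescope h2.summable (tendsto_succ_cpow_zero (by simp; linarith))
  have h5 := h2.unique h4
  rw [h5]
  simp [hg]

/-- The recursion for `ζ` off the real line, by the identity theorem on a quadrant. -/
lemma zeta_recursion (K : ℕ) {w : ℂ} (hw : -(K : ℝ) < w.re) (hi : w.im ≠ 0) :
    ∑ h ∈ Finset.range (K + 1), gbinom (1 - w) (h + 1) * riemannZeta (w + h) +
      ∑' n : ℕ, powRem (K + 2) (1 - w) ((n : ℝ) + 1) + 1 = 0 := by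
  set F : ℂ → ℂ := fun w => ∑ h ∈ Finset.range (K + 1), gbinom (1 - w) (h + 1) * riemannZeta (w + h) +
      ∑' n : ℕ, powRem (K + 2) (1 - w) ((n : ℝ) + 1) + 1 with hF
  set c : ℝ := w.im with hc
  set V : Set ℂ := {z | -(K : ℝ) < z.re} ∩ {z | 0 < c * z.im} with hV
  have hVo : IsOpen V := (isOpen_lt continuous_const Complex.continuous_re).inter
    (isOpen_lt continuous_const (by fun_prop))
  have hVc : Convex ℝ V := by
    refine (convex_halfSpace_re_gt _).inter ?_
    have : {z : ℂ | 0 < c * z.im} = (fun z : ℂ => c * z.im) ⁻¹' Set.Ioi 0 := rfl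
    rw [this]
    exact (convex_Ioi (0 : ℝ)).is_linear_preimage
      ⟨fun x y => by simp; ring, fun a x => by simp; ring⟩
  have hFd : DifferentiableOn ℂ F V := by
    refine DifferentiableOn.add_const _ (DifferentiableOn.add ?_ ?_)
    · refine DifferentiableOn.fun_sum fun h _ z hz => ?_
      have hz2 : 0 < c * z.im := hz.2
      refine (DifferentiableAt.mul ?_ ?_).differentiableWithinAt
      · exact (differentiable_gbinom (h + 1)).differentiableAt.comp z (by fun_prop)
      · have : z + h ≠ 1 := by
          intro h1
          have := congrArg Complex.im h1
          simp at this
          simp [this] at hz2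
        exact (differentiableAt_riemannZeta this).comp z (by fun_prop)
    · refine (differentiableOn_tsum_of_bound (σ := -(K : ℝ))
        (Q := fun r => (r + (K + 2)) ^ (K + 2) * 2 ^ ((K : ℝ) + 1))
        (f := fun n w => powRem (K + 2) (1 - w) ((n : ℝ) + 1))
        (fun r hr => by positivity) ?_ (fun n s hs => norm_zeta_rem_le' K n s hs) ?_).mono
        fun z hz => hz.1
      · intro r hr r' _ hrr
        have hr0 : (0 : ℝ) ≤ r := hr
        dsimp only
        gcongr
      · intro n
        exact ((differentiable_powRem (K + 2) (x := (n : ℝ) + 1) (by positivity)).comp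
          (differentiable_id.const_sub 1)).differentiableOn
  have hFa : AnalyticOnNhd ℂ F V := hFd.analyticOnNhd hVo
  have hK : (0 : ℝ) ≤ K := K.cast_nonneg
  have hz0 : (2 + c * Complex.I : ℂ) ∈ V := by
    refine ⟨?_, ?_⟩
    · change -(K : ℝ) < (2 + c * Complex.I : ℂ).re
      simp; linarith
    · change 0 < c * (2 + c * Complex.I : ℂ).im
      simp; exact hi
  have hev : F =ᶠ[𝓝 (2 + c * Complex.I : ℂ)] 0 := by
    have : {z : ℂ | 1 < z.re} ∈ 𝓝 (2 + c * Complex.I : ℂ) :=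
      (isOpen_lt continuous_const Complex.continuous_re).mem_nhds (by
        change 1 < (2 + c * Complex.I : ℂ).re; simp)
    filter_upwards [this] with z hz
    exact zeta_recursion_of_one_lt K hz
  have := hFa.eqOn_of_preconnected_of_eventuallyEq analyticOnNhd_const hVc.isPreconnected hz0 hev
  exact this (show w ∈ V from ⟨hw, mul_self_pos.2 hi⟩)

/-! ### Growth of the Riemann zeta and Gamma functions on vertical strips -/

/-- Polynomial growth of `ζ` in the half-plane `Re w ≥ 1 - K + ε`, away from the real axis,
by induction on `K` from `zeta_recursion`. -/
theorem exists_norm_riemannZeta_le {ε : ℝ} (hε : 0 < ε) (K : ℕ) :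
    ∃ C : ℝ, 0 ≤ C ∧ ∀ w : ℂ, 1 - K + ε ≤ w.re → 1 ≤ |w.im| →
      ‖riemannZeta w‖ ≤ C * (‖w‖ + 1) ^ K := by
  set S : ℝ := ∑' n : ℕ, ((n : ℝ) + 1) ^ (-(1 + ε)) with hS
  have hS0 : 0 ≤ S := tsum_nonneg fun n => by positivity
  induction K using Nat.strong_induction_on with
  | _ K ih =>
  rcases K with _ | K
  · refine ⟨S, hS0, fun w hw _ => ?_⟩
    rw [pow_zero, mul_one]
    exact norm_riemannZeta_le hε (by simpa using hw)
  have ih' : ∀ j, ∃ C : ℝ, 0 ≤ C ∧ (j < K + 1 → ∀ w : ℂ, 1 - j + ε ≤ w.re → 1 ≤ |w.im| →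
      ‖riemannZeta w‖ ≤ C * (‖w‖ + 1) ^ j) := by
    intro j
    by_cases hj : j < K + 1
    · obtain ⟨C, hC, h⟩ := ih j hj
      exact ⟨C, hC, fun _ => h⟩
    · exact ⟨0, le_rfl, fun h => absurd h hj⟩
  choose C hC0 hC using ih'
  set D : ℝ := 1 + ∑ h ∈ Finset.range K, C (K - h) + 2 ^ ((K : ℝ) + 1) * S with hD
  have hsum0 : 0 ≤ ∑ h ∈ Finset.range K, C (K - h) := Finset.sum_nonneg fun h _ => hC0 _
  have hD0 : 0 ≤ D := by positivity
  refine ⟨S + D * (K + 2) ^ (K + 1), by positivity, fun w hw him => ?_⟩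
  rcases le_total (1 + ε) w.re with hre | hre
  · refine (norm_riemannZeta_le hε hre).trans ?_
    have h1 : 1 ≤ (‖w‖ + 1) ^ (K + 1) := one_le_pow₀ (by linarith [norm_nonneg w])
    have h2 : 0 ≤ D * ((K : ℝ) + 2) ^ (K + 1) := by positivity
    nlinarith
  have hK0 : (0 : ℝ) ≤ K := K.cast_nonneg
  push_cast at hw
  have hi : w.im ≠ 0 := by intro h; rw [h, abs_zero] at him; linarith
  have hrec := zeta_recursion K (w := w) (by linarith) hi
  rw [Finset.sum_range_succ'] at hrec
  set β : ℂ := 1 - w with hβ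
  set T : ℝ := ‖w‖ + (K + 2) with hT
  have hT1 : 1 ≤ T := by linarith [norm_nonneg w]
  have hβ1 : 1 ≤ ‖β‖ := by
    refine him.trans ?_
    have := Complex.abs_im_le_norm β
    simpa [hβ] using this
  have hβ0 : 0 < ‖β‖ := by linarith
  have hprod : ∀ j ≤ K + 1, ∏ i ∈ Finset.range (j + 1), ‖β - i‖ ≤ ‖β‖ * T ^ j := by
    intro j hj
    rw [Finset.prod_range_succ', mul_comm]
    simp only [Nat.cast_zero, sub_zero]
    refine mul_le_mul_of_nonneg_left ?_ hβ0.le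
    have := Finset.prod_le_prod (s := Finset.range j) (f := fun i : ℕ => ‖β - ((i + 1 : ℕ) : ℂ)‖)
      (g := fun _ => T) (fun _ _ => norm_nonneg _)
      fun i hi => norm_one_sub_sub_le w (K := K) (by have := Finset.mem_range.1 hi; omega)
    simpa using this
  have hg1 : gbinom β (0 + 1) = β := by simp [gbinom]
  have hterm : ∀ h ∈ Finset.range K,
      ‖gbinom β (h + 1 + 1) * riemannZeta (w + (h + 1 : ℕ))‖ ≤ ‖β‖ * T ^ (K + 1) * C (K - h) := by
    intro h hh
    rw [Finset.mem_range] at hh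
    have hc : ((K - h : ℕ) : ℝ) = K - h := by rw [Nat.cast_sub hh.le]
    have h1 := hC (K - h) (by omega) (w + (h + 1 : ℕ)) (by rw [hc]; simp; linarith) (by simpa using him)
    have h2 : ‖w + (h + 1 : ℕ)‖ + 1 ≤ T := by
      have : ‖w + (h + 1 : ℕ)‖ ≤ ‖w‖ + (h + 1) := by
        refine (norm_add_le _ _).trans (le_of_eq ?_)
        rw [Complex.norm_natCast]; push_cast; ring
      have : (h : ℝ) + 1 ≤ K := by exact_mod_cast hh
      linarith
    have h3 := (norm_gbinom_le β (h + 1 + 1)).trans (hprod (h + 1) (by omega))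
    have hC' := hC0 (K - h)
    rw [norm_mul]
    calc _ ≤ (‖β‖ * T ^ (h + 1)) * (C (K - h) * T ^ (K - h)) := by
          refine mul_le_mul h3 (h1.trans ?_) (norm_nonneg _) (by positivity)
          gcongr
      _ = ‖β‖ * (T ^ (h + 1) * T ^ (K - h)) * C (K - h) := by ring
      _ = _ := by rw [← pow_add]; congr 3; omega
  have hremn : ∀ n : ℕ, ‖powRem (K + 2) β ((n : ℝ) + 1)‖ ≤
      ‖β‖ * T ^ (K + 1) * 2 ^ ((K : ℝ) + 1) * ((n : ℝ) + 1) ^ (-(1 + ε)) := by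
    intro n
    refine (norm_zeta_rem_le K n (w := w) (by linarith)).trans ?_
    have h1 := hprod (K + 1) le_rfl
    have hn : (1 : ℝ) ≤ n + 1 := by linarith [n.cast_nonneg (α := ℝ)]
    gcongr
    linarith
  have hrem : ‖∑' n : ℕ, powRem (K + 2) β ((n : ℝ) + 1)‖ ≤
      ‖β‖ * T ^ (K + 1) * 2 ^ ((K : ℝ) + 1) * S :=
    tsum_of_norm_bounded ((summable_succ_rpow hε).hasSum.mul_left _) hremn
  have hmain : ‖β‖ * ‖riemannZeta w‖ ≤ ‖β‖ * (T ^ (K + 1) * D) := by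
    have e1 : β * riemannZeta w = -(∑ h ∈ Finset.range K,
        gbinom β (h + 1 + 1) * riemannZeta (w + (h + 1 : ℕ)) +
        ∑' n : ℕ, powRem (K + 2) β ((n : ℝ) + 1) + 1) := by
      rw [hg1] at hrec
      simp only [Nat.cast_zero, add_zero] at hrec
      linear_combination hrec
    rw [← norm_mul, e1, norm_neg]
    have e2 : (1 : ℝ) ≤ ‖β‖ * T ^ (K + 1) := one_le_mul_of_one_le_of_one_le hβ1 (one_le_pow₀ hT1)
    calc _ ≤ ∑ h ∈ Finset.range K, ‖β‖ * T ^ (K + 1) * C (K - h) +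
          ‖β‖ * T ^ (K + 1) * 2 ^ ((K : ℝ) + 1) * S + 1 := by
          refine (norm_add_le _ _).trans ?_
          rw [norm_one]
          gcongr
          refine (norm_add_le _ _).trans (add_le_add ?_ hrem)
          exact (norm_sum_le _ _).trans (Finset.sum_le_sum hterm)
      _ ≤ ∑ h ∈ Finset.range K, ‖β‖ * T ^ (K + 1) * C (K - h) +
          ‖β‖ * T ^ (K + 1) * 2 ^ ((K : ℝ) + 1) * S + ‖β‖ * T ^ (K + 1) := by gcongr
      _ = _ := by rw [← Finset.mul_sum, hD]; ring
  have hz := le_of_mul_le_mul_left hmain hβ0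
  refine hz.trans ?_
  have hTw : T ≤ (K + 2) * (‖w‖ + 1) := by
    rw [hT]; nlinarith [norm_nonneg w]
  calc T ^ (K + 1) * D ≤ ((K + 2) * (‖w‖ + 1)) ^ (K + 1) * D := by gcongr
    _ = D * (K + 2) ^ (K + 1) * (‖w‖ + 1) ^ (K + 1) := by rw [mul_pow]; ring
    _ ≤ _ := by gcongr; linarith

lemma Gamma_add_nat (N : ℕ) (s : ℂ) (h : ∀ i < N, s + i ≠ 0) :
    Complex.Gamma (s + N) = (∏ i ∈ Finset.range N, (s + i)) * Complex.Gamma s := by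
  induction N with
  | zero => simp
  | succ N ih =>
    rw [Finset.prod_range_succ, mul_right_comm, ← ih fun i hi => h i (by omega), mul_comm,
      ← Complex.Gamma_add_one _ (h N (by omega))]
    congr 1; push_cast; ring

lemma norm_Gamma_le {s : ℂ} (hs : 0 < s.re) : ‖Complex.Gamma s‖ ≤ Real.Gamma s.re := by
  rw [Complex.Gamma_eq_integral hs, Complex.GammaIntegral, Real.Gamma_eq_integral hs]
  refine (MeasureTheory.norm_integral_le_integral_norm _).trans (le_of_eq ?_)
  refine MeasureTheory.setIntegral_congr_fun measurableSet_Ioi fun x hx => ?_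
  have hx0 : (0 : ℝ) < x := hx
  simp only [norm_mul, Complex.norm_cpow_eq_rpow_re_of_pos hx0, Complex.norm_real,
    Real.norm_of_nonneg (Real.exp_pos _).le]
  simp

/-- `Γ` decays faster than any power on vertical strips. -/
lemma exists_norm_Gamma_le (a b : ℝ) (N : ℕ) : ∃ C : ℝ, ∀ s : ℂ, a ≤ s.re → s.re ≤ b →
    1 ≤ |s.im| → ‖Complex.Gamma s‖ * |s.im| ^ N ≤ C := by
  -- shift by `M ≥ N` steps to reach the half-plane of the integral representation
  set M : ℕ := N + ⌈-a⌉₊ + 1 with hM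
  have hMa : 1 ≤ a + M := by
    have h1 := Nat.le_ceil (-a)
    rw [hM]; push_cast
    have : (0 : ℝ) ≤ N := N.cast_nonneg
    linarith
  obtain ⟨C, hC⟩ := (isCompact_Icc (a := a + M) (b := b + M)).exists_bound_of_continuousOn
    (f := Real.Gamma) fun x hx => (Real.differentiableAt_Gamma (s := x) fun m => by
      have := hx.1; have : (0 : ℝ) ≤ m := m.cast_nonneg; linarith).continuousAt.continuousWithinAt
  refine ⟨C, fun s ha hb hi => ?_⟩
  have hi0 : s.im ≠ 0 := by intro h; rw [h, abs_zero] at hi; linarith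
  have hne : ∀ i < M, s + i ≠ 0 := fun i _ h => hi0 (by have := congrArg Complex.im h; simpa using this)
  have h1 := congrArg norm (Gamma_add_nat M s hne)
  have h2 : |s.im| ^ N ≤ ‖∏ i ∈ Finset.range M, (s + i)‖ := by
    have : |s.im| ^ M ≤ ‖∏ i ∈ Finset.range M, (s + i)‖ := by
      rw [norm_prod]
      have := Finset.prod_le_prod (s := Finset.range M) (f := fun _ => |s.im|)
        (g := fun i : ℕ => ‖s + i‖) (fun _ _ => abs_nonneg _) fun i _ => by
          have := Complex.abs_im_le_norm (s + i)
          simpa using this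
      simpa using this
    exact (pow_le_pow_right₀ hi (by omega)).trans this
  have h3 : ‖Complex.Gamma (s + M)‖ ≤ C := by
    refine (norm_Gamma_le (by simp; linarith)).trans ?_
    have h4 := hC (s + M).re (by simp; exact ⟨ha, hb⟩)
    exact (le_abs_self _).trans h4
  rw [norm_mul] at h1
  calc _ ≤ ‖Complex.Gamma s‖ * ‖∏ i ∈ Finset.range M, (s + i)‖ := by gcongr
    _ = ‖Complex.Gamma (s + M)‖ := by rw [h1, mul_comm]
    _ ≤ C := h3

/-! ### The counting function of the Piatetski-Shapiro sequence -/

/-- The decrement `x ^ (-s) - (x + 1) ^ (-s)`. -/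
noncomputable def powDiff (s : ℂ) (x : ℝ) : ℂ := (x : ℂ) ^ (-s) - ((x + 1 : ℝ) : ℂ) ^ (-s)

lemma hasDerivAt_ofReal_cpow_neg (s : ℂ) {x : ℝ} (hx : 0 < x) :
    HasDerivAt (fun u : ℝ => (u : ℂ) ^ (-s)) (-s * (x : ℂ) ^ (-(s + 1))) x := by
  have h : HasDerivAt (fun u : ℂ => u ^ (-s)) (-s * (x : ℂ) ^ (-s - 1) * 1) (x : ℂ) :=
    (hasDerivAt_id _).cpow_const (Or.inl (by simpa using hx))
  refine h.comp_ofReal.congr_deriv ?_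
  rw [mul_one, neg_add']

lemma norm_powDiff_le {s : ℂ} (hs : -1 ≤ s.re) {x : ℝ} (hx : 0 < x) :
    ‖powDiff s x‖ ≤ ‖s‖ * x ^ (-(s.re + 1)) := by
  have key := norm_image_sub_le_of_norm_deriv_le_segment' (a := x) (b := x + 1)
    (f := fun u : ℝ => (u : ℂ) ^ (-s)) (f' := fun u : ℝ => -s * (u : ℂ) ^ (-(s + 1)))
    (C := ‖s‖ * x ^ (-(s.re + 1))) (fun u hu => (hasDerivAt_ofReal_cpow_neg s
      (hx.trans_le hu.1)).hasDerivWithinAt) (fun u hu => ?_) (x + 1) ⟨by linarith, le_rfl⟩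
  · rw [powDiff, norm_sub_rev]
    simpa using key
  · rw [norm_mul, norm_neg, Complex.norm_cpow_eq_rpow_re_of_pos (hx.trans_le hu.1)]
    refine mul_le_mul_of_nonneg_left ?_ (norm_nonneg _)
    have : (-(s + 1)).re = -(s.re + 1) := by simp
    rw [this]
    exact Real.rpow_le_rpow_of_nonpos hx hu.1 (by linarith)

lemma norm_powDiff_sub_le {s : ℂ} (hs : -2 ≤ s.re) {x : ℝ} (hx : 0 < x) :
    ‖powDiff s x - powDiff s (x + 1)‖ ≤ ‖s‖ * ‖s + 1‖ * x ^ (-(s.re + 2)) := by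
  have key := norm_image_sub_le_of_norm_deriv_le_segment' (a := x) (b := x + 1)
    (f := powDiff s) (f' := fun u : ℝ => -s * powDiff (s + 1) u)
    (C := ‖s‖ * ‖s + 1‖ * x ^ (-(s.re + 2))) (fun u hu => ?_) (fun u hu => ?_) (x + 1)
    ⟨by linarith, le_rfl⟩
  · rw [norm_sub_rev]
    simpa using key
  · have hu0 : 0 < u := hx.trans_le hu.1
    have h2 := (hasDerivAt_ofReal_cpow_neg s (x := u + 1) (by linarith)).comp_add_const u 1
    refine (((hasDerivAt_ofReal_cpow_neg s hu0).sub h2).congr_deriv ?_).hasDerivWithinAt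
    rw [powDiff]; ring
  · have hu0 : 0 < u := hx.trans_le hu.1
    rw [norm_mul, norm_neg, mul_assoc]
    refine mul_le_mul_of_nonneg_left ?_ (norm_nonneg _)
    refine (norm_powDiff_le (s := s + 1) (by simp; linarith) hu0).trans ?_
    refine mul_le_mul_of_nonneg_left ?_ (norm_nonneg _)
    have : (s + 1).re + 1 = s.re + 2 := by simp; ring
    rw [this]
    exact Real.rpow_le_rpow_of_nonpos hx hu.1 (by linarith)

lemma psTerm_pos {κ : ℝ} (hκ : 0 < κ) (n : ℕ) : 1 ≤ psTerm κ n := by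
  rw [psTerm, Nat.one_le_floor_iff]
  exact Real.one_le_rpow (by linarith [n.cast_nonneg (α := ℝ)]) hκ.le

/-- The counting function of the Piatetski-Shapiro sequence. -/
lemma psTerm_le_iff {κ : ℝ} (hκ : 0 < κ) (n i : ℕ) :
    psTerm κ n ≤ i + 1 ↔ n < ⌈((i : ℝ) + 2) ^ (1 / κ)⌉₊ - 1 := by
  have h0 : (0 : ℝ) ≤ (n : ℝ) + 1 := by positivity
  rw [psTerm, ← Nat.lt_succ_iff, Nat.floor_lt (by positivity), Nat.lt_sub_iff_add_lt, Nat.lt_ceil,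
    one_div, Real.lt_rpow_inv_iff_of_pos (by positivity) (by positivity) hκ]
  push_cast
  rw [show (i : ℝ) + 1 + 1 = i + 2 by ring]

lemma natCeil_sub_one_eq {y : ℝ} (hy : 0 < y) :
    ((⌈y⌉₊ - 1 : ℕ) : ℝ) = y + Int.fract (-y) - 1 := by
  have h1 : 1 ≤ ⌈y⌉₊ := Nat.ceil_pos.2 hy
  rw [Nat.cast_sub h1, Int.fract, Int.floor_neg, natCast_ceil_eq_intCast_ceil hy.le]
  push_cast; ring

lemma hasSum_powDiff {s : ℂ} (hs : 0 < s.re) (a : ℕ) :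
    HasSum (fun i : ℕ => powDiff s (((i + a : ℕ) : ℝ) + 1)) ((((a : ℝ) + 1 : ℝ) : ℂ) ^ (-s)) := by
  set g : ℕ → ℂ := fun n => (((n : ℝ) + 1 : ℝ) : ℂ) ^ (-s) with hg
  have h0 : Tendsto g atTop (𝓝 0) := tendsto_succ_cpow_zero (by simpa using hs)
  have e : ∀ n : ℕ, powDiff s ((n : ℝ) + 1) = -(g (n + 1) - g n) := fun n => by
    rw [powDiff, hg]; push_cast; ring
  have hsum : Summable fun n : ℕ => powDiff s ((n : ℝ) + 1) := by
    refine Summable.of_norm_bounded ((summable_succ_rpow hs).mul_left ‖s‖) fun n => ?_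
    refine (norm_powDiff_le (by linarith) (by positivity)).trans (le_of_eq ?_)
    rw [add_comm s.re 1]
  have hsum' := (summable_nat_add_iff a).2 hsum
  have h1 := hasSum_telescope (g := fun n => g (n + a)) (by
      have := hsum'.neg
      refine this.congr fun n => ?_
      rw [e, neg_neg]; congr 2; omega) ((tendsto_add_atTop_iff_nat a).2 h0)
  have h2 := h1.neg
  simp only [neg_neg, zero_add] at h2
  refine h2.congr_fun fun n => ?_
  rw [e]; congr 3; omega

/-- Summation by parts in the form `ζ_κ(s) = ∑_m #{n : ⌊n ^ κ⌋ ≤ m} (m ^ (-s) - (m + 1) ^ (-s))`,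
with the counting function made explicit. -/
lemma exists_hasSum_psTerm_cpow {κ : ℝ} (hκ : 0 < κ) {s : ℂ} (hs : 1 / κ < s.re) :
    ∃ S : ℂ, HasSum (fun n : ℕ => 1 / (psTerm κ n : ℂ) ^ s) S ∧
      HasSum (fun i : ℕ => (((((i : ℝ) + 2) ^ (1 / κ) + Int.fract (-((i : ℝ) + 2) ^ (1 / κ)) - 1 : ℝ)) : ℂ)
        * powDiff s ((i : ℝ) + 1)) S := by
  have hα : 0 < 1 / κ := by positivity
  set α := 1 / κ with hαdef
  have hs0 : 0 < s.re := hα.trans hs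
  set c : ℕ → ℕ := fun i => ⌈((i : ℝ) + 2) ^ α⌉₊ - 1 with hc
  have hcast : ∀ i : ℕ, (c i : ℝ) = ((i : ℝ) + 2) ^ α + Int.fract (-((i : ℝ) + 2) ^ α) - 1 :=
    fun i => natCeil_sub_one_eq (by positivity)
  set G : ℕ × ℕ → ℂ := fun p => if psTerm κ p.2 ≤ p.1 + 1 then powDiff s ((p.1 : ℝ) + 1) else 0 with hG
  have hGi : ∀ i n : ℕ, G (i, n) = if n ∈ Finset.range (c i) then powDiff s ((i : ℝ) + 1) else 0 := by
    intro i n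
    simp only [hG, psTerm_le_iff hκ, Finset.mem_range, hc]
    rfl
  have hrow : ∀ i : ℕ, HasSum (fun n => G (i, n)) (c i * powDiff s ((i : ℝ) + 1)) := by
    intro i
    have : HasSum (fun n => G (i, n)) (∑ n ∈ Finset.range (c i), G (i, n)) :=
      hasSum_sum_of_ne_finset_zero fun n hn => by rw [hGi, if_neg hn]
    convert this using 1
    rw [Finset.sum_congr rfl fun n hn => by rw [hGi, if_pos hn]]
    simp
  have hrown : ∀ i : ℕ, HasSum (fun n => ‖G (i, n)‖) (c i * ‖powDiff s ((i : ℝ) + 1)‖) := by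
    intro i
    have : HasSum (fun n => ‖G (i, n)‖) (∑ n ∈ Finset.range (c i), ‖G (i, n)‖) :=
      hasSum_sum_of_ne_finset_zero fun n hn => by rw [hGi, if_neg hn, norm_zero]
    convert this using 1
    rw [Finset.sum_congr rfl fun n hn => by rw [hGi, if_pos hn]]
    simp
  have hsum : Summable G := by
    refine Summable.of_norm ?_
    rw [summable_prod_of_nonneg fun p => norm_nonneg _]
    refine ⟨fun i => (hrown i).summable, ?_⟩
    simp_rw [fun i => (hrown i).tsum_eq]
    refine Summable.of_nonneg_of_le (fun i => by positivity) (fun i => ?_)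
      ((summable_succ_rpow (show 0 < s.re - α by linarith)).mul_left (2 ^ α * ‖s‖))
    have hi0 : (0 : ℝ) < (i : ℝ) + 1 := by positivity
    have h1 : (c i : ℝ) ≤ 2 ^ α * ((i : ℝ) + 1) ^ α := by
      rw [hcast, ← Real.mul_rpow (by norm_num) hi0.le]
      have h2 := (Int.fract_lt_one (-((i : ℝ) + 2) ^ α)).le
      have h3 : ((i : ℝ) + 2) ^ α ≤ (2 * ((i : ℝ) + 1)) ^ α :=
        Real.rpow_le_rpow (by positivity) (by linarith [i.cast_nonneg (α := ℝ)]) hα.le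
      linarith
    calc _ ≤ (2 ^ α * ((i : ℝ) + 1) ^ α) * (‖s‖ * ((i : ℝ) + 1) ^ (-(s.re + 1))) := by
          gcongr
          exact norm_powDiff_le (by linarith) hi0
      _ = 2 ^ α * ‖s‖ * (((i : ℝ) + 1) ^ α * ((i : ℝ) + 1) ^ (-(s.re + 1))) := by ring
      _ = _ := by rw [← Real.rpow_add hi0]; congr 2; ring
  refine ⟨∑' p, G p, ?_, ?_⟩
  · have hcol : ∀ n : ℕ, HasSum (fun i => G (i, n)) (1 / (psTerm κ n : ℂ) ^ s) := by
      intro n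
      obtain ⟨a, ha⟩ := Nat.exists_eq_add_of_le' (psTerm_pos hκ n)
      have h1 := hasSum_powDiff hs0 a
      have h2 : ∀ i : ℕ, powDiff s (((i + a : ℕ) : ℝ) + 1) = G (i + a, n) := by
        intro i
        simp only [hG]
        rw [if_pos (by omega)]
      simp_rw [h2] at h1
      have h3 := (hasSum_nat_add_iff (f := fun i => G (i, n)) a).1 h1
      have h4 : ∑ i ∈ Finset.range a, G (i, n) = 0 := Finset.sum_eq_zero fun i hi => by
        have := Finset.mem_range.1 hi
        simp only [hG]
        rw [if_neg (by omega)]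
      rw [h4, add_zero] at h3
      have h5 : 1 / (psTerm κ n : ℂ) ^ s = (((a : ℝ) + 1 : ℝ) : ℂ) ^ (-s) := by
        rw [ha, Complex.cpow_neg, one_div]; push_cast; rfl
      rw [h5]; exact h3
    exact ((Equiv.prodComm ℕ ℕ).hasSum_iff.2 hsum.hasSum).prod_fiberwise hcol
  · have := hsum.hasSum.prod_fiberwise hrow
    refine this.congr_fun fun i => ?_
    rw [← hcast]; simp

/-- The error in expanding `(x + 1) ^ α` up to the power `x ^ (α - ⌈α⌉)` is `O(x ^ (-1 - δ))`, also
for an integer `α`, when the expansion terminates. -/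
lemma exists_norm_powRem_ceil_le {α : ℝ} (hα : 0 < α) :
    ∃ C δ : ℝ, 0 ≤ C ∧ 0 < δ ∧ δ ≤ 1 ∧ ∀ x : ℝ, 1 ≤ x →
      ‖powRem (⌈α⌉₊ + 1) α x‖ ≤ C * x ^ (-(1 + δ)) := by
  set k := ⌈α⌉₊ with hk
  have hkα : α ≤ k := Nat.le_ceil α
  have hkα' : (k : ℝ) < α + 1 := Nat.ceil_lt_add_one hα.le
  -- one more term than needed: its coefficient vanishes when `α` is an integer
  have hsucc : ∀ x : ℝ, powRem (k + 1) α x =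
      gbinom α (k + 1) * (x : ℂ) ^ ((α : ℂ) - (k + 1 : ℕ)) + powRem (k + 2) α x := by
    intro x
    rw [powRem, powRem, Finset.sum_range_succ _ (k + 1)]; ring
  have hb : ∀ x : ℝ, 1 ≤ x → ‖powRem (k + 2) α x‖ ≤
      (∏ i ∈ Finset.range (k + 2), ‖(α : ℂ) - i‖) * 2 ^ α * x ^ (α - (k + 2)) := by
    intro x hx
    have := norm_powRem_le hα.le (k + 2) (β := α) (by simp) hx
    simpa using this
  set B := (∏ i ∈ Finset.range (k + 2), ‖(α : ℂ) - i‖) * 2 ^ α with hB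
  have hB0 : 0 ≤ B := by positivity
  rcases hkα.eq_or_lt with h | h
  · refine ⟨B, 1, hB0, one_pos, le_rfl, fun x hx => ?_⟩
    have hz : gbinom α (k + 1) = 0 := by
      rw [gbinom, Finset.prod_eq_zero (Finset.self_mem_range_succ k), zero_div]
      rw [h]; simp
    rw [hsucc, hz, zero_mul, zero_add]
    refine (hb x hx).trans ?_
    gcongr
    linarith
  · refine ⟨‖gbinom α (k + 1)‖ + B, k - α, by positivity, by linarith, by linarith, fun x hx => ?_⟩
    have hx0 : 0 < x := by linarith
    rw [hsucc, add_mul]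
    refine (norm_add_le _ _).trans (add_le_add ?_ ?_)
    · rw [norm_mul, Complex.norm_cpow_eq_rpow_re_of_pos hx0]
      refine mul_le_mul_of_nonneg_left (le_of_eq ?_) (norm_nonneg _)
      congr 1; simp; ring
    · refine (hb x hx).trans ?_
      gcongr
      linarith

/-- The fractional parts `{-m ^ α}` oscillate, with a power saving, around a mean value `c`
(which is `1 / 2` or, for an integer `α`, `0`). -/
lemma exists_abs_sum_fract_sub_le {α : ℝ} (hα : 0 < α) :
    ∃ c C δ : ℝ, |c| ≤ 1 ∧ 0 ≤ C ∧ 0 < δ ∧ δ ≤ 1 ∧ ∀ M : ℕ,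
      |∑ i ∈ Finset.range M, (Int.fract (-((i : ℝ) + 2) ^ α) - c)| ≤ C * (M : ℝ) ^ (1 - δ) := by
  by_cases hint : ∃ n : ℕ, α = n
  · obtain ⟨n, hn⟩ := hint
    refine ⟨0, 0, 1, by simp, le_rfl, one_pos, le_rfl, fun M => ?_⟩
    rw [Finset.sum_eq_zero, abs_zero, zero_mul]
    intro i _
    have : -((i : ℝ) + 2) ^ α = ((-((i : ℤ) + 2) ^ n : ℤ) : ℝ) := by
      rw [hn, Real.rpow_natCast]; push_cast; rfl
    rw [this, Int.fract_intCast, sub_zero]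
  · push Not at hint
    obtain ⟨C, δ, hC, hδ, hδ1, h⟩ := exists_abs_sum_fract_rpow_le hα hint
    refine ⟨1 / 2, 2 * C + 1, δ, by norm_num [abs_le], by positivity, hδ, hδ1.le, fun M => ?_⟩
    rcases Nat.eq_zero_or_pos M with rfl | hM
    · simp; positivity
    have hM1 : (1 : ℝ) ≤ M := by exact_mod_cast hM
    have h1 := h (M + 1)
    rw [Finset.sum_range_succ'] at h1
    have h2 : ∀ i : ℕ, ((i + 1 : ℕ) : ℝ) + 1 = i + 2 := fun i => by push_cast; ring
    simp_rw [h2] at h1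
    have h3 : Int.fract (-((((0 : ℕ) : ℝ)) + 1) ^ α) = 0 := by
      have : -((((0 : ℕ) : ℝ)) + 1) ^ α = ((-1 : ℤ) : ℝ) := by simp
      rw [this, Int.fract_intCast]
    rw [h3] at h1
    have h4 : ((M + 1 : ℕ) : ℝ) ^ (1 - δ) ≤ 2 * (M : ℝ) ^ (1 - δ) := by
      calc ((M + 1 : ℕ) : ℝ) ^ (1 - δ) ≤ (2 * (M : ℝ)) ^ (1 - δ) :=
            Real.rpow_le_rpow (by positivity) (by push_cast; linarith) (by linarith)
        _ = 2 ^ (1 - δ) * (M : ℝ) ^ (1 - δ) := Real.mul_rpow (by norm_num) (by positivity)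
        _ ≤ 2 ^ (1 : ℝ) * (M : ℝ) ^ (1 - δ) := by gcongr <;> linarith
        _ = _ := by rw [Real.rpow_one]
    have h5 : 1 ≤ (M : ℝ) ^ (1 - δ) := Real.one_le_rpow hM1 (by linarith)
    have h6 : C * ((M + 1 : ℕ) : ℝ) ^ (1 - δ) ≤ C * (2 * (M : ℝ) ^ (1 - δ)) := by gcongr
    rw [abs_le] at h1 ⊢
    constructor <;> linarith [h1.1, h1.2]

/-- `Γ(α + 1) = α (α - 1) ⋯ (α - h) Γ(α - h)`. -/
lemma Gamma_add_one_eq_prod {α : ℝ} (h : ℕ) (hh : (h : ℝ) < α) :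
    Real.Gamma (α + 1) = (∏ i ∈ Finset.range (h + 1), (α - i)) * Real.Gamma (α - h) := by
  induction h with
  | zero =>
    have : α ≠ 0 := by push_cast at hh; exact hh.ne'
    simp [Real.Gamma_add_one this]
  | succ h ih =>
    push_cast at hh
    have hne : α - (h + 1) ≠ 0 := by linarith
    rw [ih (by linarith), Finset.prod_range_succ _ (h + 1), mul_assoc]
    have : α - h = α - (h + 1) + 1 := by ring
    rw [this, Real.Gamma_add_one hne]
    push_cast; rfl

lemma gbinom_eq_Gamma {α : ℝ} (h : ℕ) (hh : (h : ℝ) < α) :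
    gbinom α (h + 1) = ((Real.Gamma (α + 1) /
      ((Nat.factorial (h + 1) : ℝ) * Real.Gamma (α - h)) : ℝ) : ℂ) := by
  have h1 : Real.Gamma (α - h) ≠ 0 := (Real.Gamma_pos_of_pos (by linarith)).ne'
  have h2 : (Nat.factorial (h + 1) : ℝ) ≠ 0 := by exact_mod_cast Nat.factorial_ne_zero _
  have : (gbinom α (h + 1)) = (((∏ i ∈ Finset.range (h + 1), (α - i)) /
      (Nat.factorial (h + 1) : ℝ) : ℝ) : ℂ) := by
    rw [gbinom]; push_cast; rfl
  rw [this, Gamma_add_one_eq_prod h hh]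
  congr 1
  field_simp

/-! ### The continuation of the zeta function of the sequence -/

lemma tendsto_sub_mul_riemannZeta (a : ℂ) :
    Tendsto (fun s : ℂ => (s - a) * riemannZeta (s - a + 1)) (𝓝[≠] a) (𝓝 1) := by
  have h1 : Tendsto (fun s : ℂ => s - a + 1) (𝓝[≠] a) (𝓝[≠] 1) := by
    refine tendsto_nhdsWithin_of_tendsto_nhds_of_eventually_within _ ?_ ?_
    · have : Tendsto (fun s : ℂ => s - a + 1) (𝓝 a) (𝓝 (a - a + 1)) :=
        (by fun_prop : Continuous fun s : ℂ => s - a + 1).tendsto a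
      rw [sub_self, zero_add] at this
      exact this.mono_left nhdsWithin_le_nhds
    · filter_upwards [self_mem_nhdsWithin] with s hs
      intro h
      have h' : s - a + 1 = 1 := h
      exact hs (by simpa [sub_eq_zero] using h')
  refine (riemannZeta_residue_one.comp h1).congr fun s => ?_
  simp

/-- Existence of the continuation of `ζ_κ`. By `exists_hasSum_psTerm_cpow`, `ζ_κ(s)` is the sum over
`m ≥ 1` of `((m + 1) ^ α + {-(m + 1) ^ α} - 1) (m ^ (-s) - (m + 1) ^ (-s))`. Here `(m + 1) ^ α` is
expanded in powers of `m` after a telescoping sum is split off, giving shifted Riemann zeta functions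
with the required poles; the fractional parts, with their mean value `c` removed, are summed by parts
and their cancellation extends the domain of convergence to the left of `Re s = 0`. -/
theorem exists_isZetaContinuation {κ : ℝ} (hκ : 0 < κ) :
    ∃ σ ∈ Set.Ioc (0 : ℝ) 1, ∃ Z : ℂ → ℂ, IsZetaContinuation κ σ Z := by
  have hα : 0 < 1 / κ := by positivity
  obtain ⟨c, C₁, δ₁, hc, hC₁, hδ₁, hδ₁', hU⟩ := exists_abs_sum_fract_sub_le hα
  obtain ⟨C₂, δ₂, hC₂, hδ₂, hδ₂', hR⟩ := exists_norm_powRem_ceil_le hα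
  set α := 1 / κ with hαdef
  set k := ⌈α⌉₊ with hk
  set u : ℕ → ℝ := fun i => Int.fract (-((i : ℝ) + 2) ^ α) - c with hu
  set σ := min δ₁ δ₂ with hσ
  have hσ0 : 0 < σ := lt_min hδ₁ hδ₂
  have hσ1 : σ ≤ 1 := (min_le_left _ _).trans hδ₁'
  -- the remainders of the binomial expansions, and the fractional parts after summation by parts
  set f₁ : ℕ → ℂ → ℂ := fun i s => (((i : ℝ) + 1 : ℝ) : ℂ) ^ (-s) * powRem (k + 1) α ((i : ℝ) + 1)
    with hf₁
  set f₂ : ℕ → ℂ → ℂ := fun i s => ((∑ j ∈ Finset.range (i + 1), u j : ℝ) : ℂ) *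
    (powDiff s ((i : ℝ) + 1) - powDiff s ((i : ℝ) + 1 + 1)) with hf₂
  have hx1 : ∀ i : ℕ, (1 : ℝ) ≤ (i : ℝ) + 1 := fun i => by linarith [i.cast_nonneg (α := ℝ)]
  have hx0 : ∀ i : ℕ, (0 : ℝ) < (i : ℝ) + 1 := fun i => by positivity
  have hb₁ : ∀ n s, -σ < s.re → ‖f₁ n s‖ ≤
      (fun _ : ℝ => C₂) ‖s‖ * ((n : ℝ) + 1) ^ (-(1 + (s.re - -σ))) := by
    intro n s _
    rw [hf₁]
    dsimp only
    rw [norm_mul, Complex.norm_cpow_eq_rpow_re_of_pos (hx0 n)]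
    calc _ ≤ ((n : ℝ) + 1) ^ (-s).re * (C₂ * ((n : ℝ) + 1) ^ (-(1 + δ₂))) := by
          gcongr; exact hR _ (hx1 n)
      _ = C₂ * ((n : ℝ) + 1) ^ ((-s).re + -(1 + δ₂)) := by rw [Real.rpow_add (hx0 n)]; ring
      _ ≤ _ := by
          refine mul_le_mul_of_nonneg_left ?_ hC₂
          refine Real.rpow_le_rpow_of_exponent_le (hx1 n) ?_
          have : σ ≤ δ₂ := min_le_right _ _
          simp; linarith
  have hb₂ : ∀ n s, -σ < s.re → ‖f₂ n s‖ ≤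
      (fun r : ℝ => C₁ * (r * (r + 1))) ‖s‖ * ((n : ℝ) + 1) ^ (-(1 + (s.re - -σ))) := by
    intro n s hs
    rw [hf₂]
    dsimp only
    rw [norm_mul, Complex.norm_real, Real.norm_eq_abs]
    have h1 := hU (n + 1)
    push_cast at h1
    have h2 := norm_powDiff_sub_le (s := s) (by linarith) (hx0 n)
    have h3 : ‖s + 1‖ ≤ ‖s‖ + 1 := (norm_add_le _ _).trans (by simp)
    calc _ ≤ (C₁ * ((n : ℝ) + 1) ^ (1 - δ₁)) * (‖s‖ * ‖s + 1‖ * ((n : ℝ) + 1) ^ (-(s.re + 2))) := by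
          gcongr
      _ ≤ (C₁ * ((n : ℝ) + 1) ^ (1 - δ₁)) * (‖s‖ * (‖s‖ + 1) * ((n : ℝ) + 1) ^ (-(s.re + 2))) := by
          gcongr
      _ = C₁ * (‖s‖ * (‖s‖ + 1)) * ((n : ℝ) + 1) ^ ((1 - δ₁) + -(s.re + 2)) := by
          rw [Real.rpow_add (hx0 n)]; ring
      _ ≤ _ := by
          refine mul_le_mul_of_nonneg_left ?_ (by positivity)
          refine Real.rpow_le_rpow_of_exponent_le (hx1 n) ?_
          have : σ ≤ δ₁ := min_le_left _ _
          linarith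
  have hQ₁ : ∀ r : ℝ, 0 ≤ r → 0 ≤ (fun _ : ℝ => C₂) r := fun _ _ => hC₂
  have hQ₂ : ∀ r : ℝ, 0 ≤ r → 0 ≤ (fun r : ℝ => C₁ * (r * (r + 1))) r := fun r hr => by
    dsimp only; positivity
  have hpow : ∀ (x : ℝ), 0 < x → Differentiable ℂ fun s : ℂ => (x : ℂ) ^ (-s) := fun x hx =>
    differentiable_neg.const_cpow (Or.inl (by exact_mod_cast hx.ne'))
  have hpd : ∀ (x : ℝ), 0 < x → Differentiable ℂ fun s : ℂ => powDiff s x := fun x hx =>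
    (hpow x hx).sub (hpow (x + 1) (by linarith))
  have hA : DifferentiableOn ℂ (fun s => ∑' n, f₁ n s + ∑' n, f₂ n s + (c : ℂ)) {s | -σ < s.re} := by
    refine DifferentiableOn.add_const _ (DifferentiableOn.add ?_ ?_)
    · exact differentiableOn_tsum_of_bound hQ₁ (fun _ _ _ _ _ => le_rfl) hb₁ fun n =>
        ((hpow _ (hx0 n)).mul_const _).differentiableOn
    · refine differentiableOn_tsum_of_bound hQ₂ ?_ hb₂ fun n =>
        (((hpd _ (hx0 n)).sub (hpd _ (by linarith [hx0 n]))).const_mul _).differentiableOn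
      intro r hr r' _ hrr
      have hr0 : (0 : ℝ) ≤ r := hr
      dsimp only
      gcongr
  have hUo : IsOpen {s : ℂ | -σ < s.re} := isOpen_lt continuous_const Complex.continuous_re
  refine ⟨σ, ⟨hσ0, hσ1⟩, fun s => ∑ h ∈ Finset.range k, gbinom α (h + 1) *
    riemannZeta (s - ((α - h : ℝ) : ℂ) + 1) + (∑' n, f₁ n s + ∑' n, f₂ n s + (c : ℂ)), ?_, ?_, ?_, ?_⟩
  · intro s hs
    have hs0 : 0 < s.re := hα.trans hs
    obtain ⟨S, hS1, hS2⟩ := exists_hasSum_psTerm_cpow hκ hs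
    simp only [← hαdef] at hS2
    have hz : HasSum (fun i : ℕ => ∑ h ∈ Finset.range k, gbinom α (h + 1) *
        (((i : ℝ) + 1 : ℝ) : ℂ) ^ (-(s - ((α - h : ℝ) : ℂ) + 1)))
        (∑ h ∈ Finset.range k, gbinom α (h + 1) * riemannZeta (s - ((α - h : ℝ) : ℂ) + 1)) := by
      refine hasSum_sum fun h _ => (hasSum_riemannZeta ?_).mul_left _
      have : (0 : ℝ) ≤ h := h.cast_nonneg
      rw [Complex.add_re, Complex.sub_re, Complex.ofReal_re, Complex.one_re]
      linarith
    have hs₁ : HasSum (fun n => f₁ n s) (∑' n, f₁ n s) :=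
      (summable_of_bound (f := f₁) (Q := fun _ => C₂) (σ := -σ) hb₁ (by linarith)).hasSum
    have hs₂ : HasSum (fun n => f₂ n s) (∑' n, f₂ n s) :=
      (summable_of_bound (f := f₂) (Q := fun r => C₁ * (r * (r + 1))) (σ := -σ) hb₂ (by linarith)).hasSum
    have hd : HasSum (fun i : ℕ => powDiff s ((i : ℝ) + 1)) 1 := by
      have := hasSum_powDiff hs0 0
      simpa using this
    have hdn : ∀ i : ℕ, ‖powDiff s ((i : ℝ) + 1)‖ ≤ ‖s‖ * ((i : ℝ) + 1) ^ (-(1 + s.re)) := fun i => by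
      have := norm_powDiff_le (s := s) (by linarith) (hx0 i)
      rwa [add_comm s.re 1] at this
    -- two telescoping pieces: the leading term `m ^ (α - s)`, and the boundary term of the
    -- summation by parts
    set g : ℕ → ℂ := fun i => (((i : ℝ) + 1 : ℝ) : ℂ) ^ ((α : ℂ) - s) with hg
    set V : ℕ → ℂ := fun i => ((∑ j ∈ Finset.range i, u j : ℝ) : ℂ) * powDiff s ((i : ℝ) + 1) with hV
    have hVi : ∀ i, V (i + 1) - V i = (u i : ℂ) * powDiff s ((i : ℝ) + 1) - f₂ i s := by
      intro i
      simp only [hV, hf₂]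
      rw [Finset.sum_range_succ]
      push_cast
      ring
    have hus : Summable fun i : ℕ => (u i : ℂ) * powDiff s ((i : ℝ) + 1) := by
      refine Summable.of_norm_bounded ((summable_succ_rpow hs0).mul_left (2 * ‖s‖)) fun i => ?_
      have hui : |u i| ≤ 2 := by
        have h1 := Int.fract_nonneg (-((i : ℝ) + 2) ^ α)
        have h2 := Int.fract_lt_one (-((i : ℝ) + 2) ^ α)
        rw [abs_le] at hc ⊢
        simp only [hu]
        constructor <;> linarith
      rw [norm_mul, Complex.norm_real, Real.norm_eq_abs, mul_assoc]
      gcongr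
      exact hdn i
    have hVt : Tendsto V atTop (𝓝 0) := by
      have h1 : ∀ i, ‖V i‖ ≤ C₁ * ‖s‖ * ((i : ℝ) + 1) ^ (-s.re) := by
        intro i
        simp only [hV]
        rw [norm_mul, Complex.norm_real, Real.norm_eq_abs]
        have h2 : (i : ℝ) ^ (1 - δ₁) ≤ ((i : ℝ) + 1) ^ (1 : ℝ) := by
          calc (i : ℝ) ^ (1 - δ₁) ≤ ((i : ℝ) + 1) ^ (1 - δ₁) :=
                Real.rpow_le_rpow i.cast_nonneg (by linarith) (by linarith)
            _ ≤ _ := Real.rpow_le_rpow_of_exponent_le (hx1 i) (by linarith)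
        calc _ ≤ (C₁ * (i : ℝ) ^ (1 - δ₁)) * (‖s‖ * ((i : ℝ) + 1) ^ (-(1 + s.re))) := by
              gcongr
              · exact hU i
              · exact hdn i
          _ ≤ (C₁ * ((i : ℝ) + 1) ^ (1 : ℝ)) * (‖s‖ * ((i : ℝ) + 1) ^ (-(1 + s.re))) := by gcongr
          _ = C₁ * ‖s‖ * (((i : ℝ) + 1) ^ (1 : ℝ) * ((i : ℝ) + 1) ^ (-(1 + s.re))) := by ring
          _ = _ := by rw [← Real.rpow_add (hx0 i)]; congr 2; ring
      refine squeeze_zero_norm h1 ?_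
      have h2 := ((tendsto_rpow_neg_atTop hs0).comp
        (tendsto_atTop_add_const_right atTop (1 : ℝ) tendsto_natCast_atTop_atTop)).const_mul
          (C₁ * ‖s‖)
      rw [mul_zero] at h2
      exact h2
    have hVs : HasSum (fun i => V (i + 1) - V i) (-V 0) :=
      hasSum_telescope ((hus.sub hs₂.summable).congr fun i => (hVi i).symm) hVt
    have hV0 : V 0 = 0 := by simp [hV]
    have hterm : ∀ i : ℕ, (((((i : ℝ) + 2) ^ α + Int.fract (-((i : ℝ) + 2) ^ α) - 1 : ℝ)) : ℂ)
        * powDiff s ((i : ℝ) + 1) - (∑ h ∈ Finset.range k, gbinom α (h + 1) *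
          (((i : ℝ) + 1 : ℝ) : ℂ) ^ (-(s - ((α - h : ℝ) : ℂ) + 1)) + f₁ i s + f₂ i s +
          (V (i + 1) - V i) + ((c : ℂ) - 1) * powDiff s ((i : ℝ) + 1)) = -(g (i + 1) - g i) := by
      intro i
      rw [hVi]
      have hxne : (((i : ℝ) + 1 : ℝ) : ℂ) ≠ 0 := by exact_mod_cast (hx0 i).ne'
      have hx2 : (i : ℝ) + 1 + 1 = i + 2 := by ring
      have hyne : (((i : ℝ) + 2 : ℝ) : ℂ) ≠ 0 := by
        exact_mod_cast (by positivity : (i : ℝ) + 2 ≠ 0)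
      have e1 : ((((i : ℝ) + 2) ^ α : ℝ) : ℂ) = (((i : ℝ) + 2 : ℝ) : ℂ) ^ (α : ℂ) :=
        Complex.ofReal_cpow (by positivity) _
      have e2 : Int.fract (-((i : ℝ) + 2) ^ α) = u i + c := by simp [hu]
      have e3 : g (i + 1) = (((i : ℝ) + 2 : ℝ) : ℂ) ^ (α : ℂ) * (((i : ℝ) + 2 : ℝ) : ℂ) ^ (-s) := by
        rw [← Complex.cpow_add _ _ hyne, hg, ← sub_eq_add_neg]
        push_cast
        rw [show (i : ℂ) + 1 + 1 = i + 2 by ring]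
      have e4 : g i = (((i : ℝ) + 1 : ℝ) : ℂ) ^ (α : ℂ) * (((i : ℝ) + 1 : ℝ) : ℂ) ^ (-s) := by
        rw [← Complex.cpow_add _ _ hxne, hg, ← sub_eq_add_neg]
      have e5 : powDiff s ((i : ℝ) + 1) =
          (((i : ℝ) + 1 : ℝ) : ℂ) ^ (-s) - (((i : ℝ) + 2 : ℝ) : ℂ) ^ (-s) := by rw [powDiff, hx2]
      have e6 : f₁ i s = (((i : ℝ) + 1 : ℝ) : ℂ) ^ (-s) * ((((i : ℝ) + 2 : ℝ) : ℂ) ^ (α : ℂ) -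
          (((i : ℝ) + 1 : ℝ) : ℂ) ^ (α : ℂ)) - ∑ h ∈ Finset.range k, gbinom α (h + 1) *
          (((i : ℝ) + 1 : ℝ) : ℂ) ^ (-(s - ((α - h : ℝ) : ℂ) + 1)) := by
        simp only [hf₁]
        rw [powRem, hx2, Finset.sum_range_succ', gbinom_zero]
        have : ∀ h ∈ Finset.range k, gbinom α (h + 1) *
            (((i : ℝ) + 1 : ℝ) : ℂ) ^ (-(s - ((α - h : ℝ) : ℂ) + 1)) =
            (((i : ℝ) + 1 : ℝ) : ℂ) ^ (-s) *
              (gbinom α (h + 1) * (((i : ℝ) + 1 : ℝ) : ℂ) ^ ((α : ℂ) - (h + 1 : ℕ))) := by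
          intro h _
          rw [mul_left_comm, ← Complex.cpow_add _ _ hxne]
          congr 2; push_cast; ring
        rw [Finset.sum_congr rfl this, ← Finset.mul_sum]
        simp only [Nat.cast_zero, sub_zero, one_mul]
        ring
      rw [e3, e4, e6, e5, e2]
      push_cast at e1 ⊢
      rw [e1]
      ring
    have hgs : HasSum (fun i => g (i + 1) - g i) (-g 0) := by
      refine hasSum_telescope ?_ (tendsto_succ_cpow_zero (by simp; exact hs))
      have := (hS2.sub ((((hz.add hs₁).add hs₂).add hVs).add (hd.mul_left ((c : ℂ) - 1)))).neg
      refine this.summable.congr fun i => ?_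
      rw [hterm, neg_neg]
    have hfin := (hS2.sub ((((hz.add hs₁).add hs₂).add hVs).add (hd.mul_left ((c : ℂ) - 1))))
    simp_rw [hterm] at hfin
    have huniq := hfin.unique hgs.neg
    have hg0 : g 0 = 1 := by simp [hg]
    rw [hg0, hV0] at huniq
    convert hS1 using 1
    linear_combination -huniq
  · refine DifferentiableOn.add (DifferentiableOn.fun_sum fun h hh s hs => ?_)
      (hA.mono fun s hs => hs.1)
    refine (DifferentiableAt.const_mul ?_ _).differentiableWithinAt
    have hne : s - ((α - h : ℝ) : ℂ) + 1 ≠ 1 := by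
      intro h1
      apply hs.2
      refine ⟨h, Nat.lt_ceil.1 (Finset.mem_range.1 hh), ?_⟩
      linear_combination h1
    exact (differentiableAt_riemannZeta hne).comp s (by fun_prop)
  -- residues: at `α - h₀` only the zeta function with `h = h₀` is singular
  · intro h₀ hh₀
    have hmem : h₀ ∈ Finset.range k := Finset.mem_range.2 (Nat.lt_ceil.2 hh₀)
    set p : ℂ := ((α - h₀ : ℝ) : ℂ) with hp
    have hid : Tendsto (fun s : ℂ => s - p) (𝓝[≠] p) (𝓝 0) := by
      have : Tendsto (fun s : ℂ => s - p) (𝓝 p) (𝓝 (p - p)) :=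
        (by fun_prop : Continuous fun s : ℂ => s - p).tendsto p
      rw [sub_self] at this
      exact this.mono_left nhdsWithin_le_nhds
    have hAc : Tendsto (fun s : ℂ => (s - p) * (∑' n, f₁ n s + ∑' n, f₂ n s + (c : ℂ))) (𝓝[≠] p)
        (𝓝 (0 * (∑' n, f₁ n p + ∑' n, f₂ n p + (c : ℂ)))) := by
      refine hid.mul ?_
      have hpU : p ∈ {s : ℂ | -σ < s.re} := by
        change -σ < p.re
        rw [hp, Complex.ofReal_re]; linarith
      have := (hA.differentiableAt (hUo.mem_nhds hpU)).continuousAt.tendsto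
      exact this.mono_left nhdsWithin_le_nhds
    have hz : Tendsto (fun s : ℂ => ∑ h ∈ Finset.range k, gbinom α (h + 1) *
        ((s - p) * riemannZeta (s - ((α - h : ℝ) : ℂ) + 1))) (𝓝[≠] p)
        (𝓝 (∑ h ∈ Finset.range k, gbinom α (h + 1) * (if h = h₀ then 1 else 0))) := by
      refine tendsto_finsetSum _ fun h _ => Tendsto.const_mul _ ?_
      split_ifs with hhh
      · rw [hhh]; exact tendsto_sub_mul_riemannZeta p
      · have hne : p - ((α - h : ℝ) : ℂ) + 1 ≠ 1 := by
          intro h1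
          apply hhh
          have : (h : ℂ) = h₀ := by
            rw [hp] at h1; push_cast at h1; linear_combination h1
          exact_mod_cast this
        have hcont : Tendsto (fun s : ℂ => riemannZeta (s - ((α - h : ℝ) : ℂ) + 1)) (𝓝[≠] p)
            (𝓝 (riemannZeta (p - ((α - h : ℝ) : ℂ) + 1))) := by
          have : ContinuousAt (fun s : ℂ => riemannZeta (s - ((α - h : ℝ) : ℂ) + 1)) p :=
            ((differentiableAt_riemannZeta hne).comp p (by fun_prop)).continuousAt
          exact this.tendsto.mono_left nhdsWithin_le_nhds
        have := hid.mul hcont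
        rwa [zero_mul] at this
    have hall := hz.add hAc
    rw [zero_mul, add_zero] at hall
    simp only [mul_ite, mul_one, mul_zero] at hall
    rw [Finset.sum_ite_eq' (Finset.range k) h₀ fun h => gbinom (α : ℂ) (h + 1), if_pos hmem,
      gbinom_eq_Gamma h₀ hh₀] at hall
    refine hall.congr fun s => ?_
    refine Eq.trans ?_ (mul_add _ _ _).symm
    rw [Finset.mul_sum]
    congr 1
    exact Finset.sum_congr rfl fun h _ => by ring
  -- growth: the argument of each zeta function has real part above `-(⌊α⌋ + 1) + ε`
  · intro ε hε
    set n₀ := ⌊α⌋₊ with hn₀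
    obtain ⟨C₃, hC₃, hζ⟩ := exists_norm_riemannZeta_le hε (n₀ + 2)
    have hn₀' : α < n₀ + 1 := Nat.lt_floor_add_one α
    set Sε : ℝ := ∑' n : ℕ, ((n : ℝ) + 1) ^ (-(1 + ε)) with hSε
    have hSε0 : 0 ≤ Sε := tsum_nonneg fun n => by positivity
    set B : ℝ := α + k + 2 with hB
    have hk0 : (0 : ℝ) ≤ k := k.cast_nonneg
    have hB1 : 1 ≤ B := by linarith
    set D : ℝ := ∑ h ∈ Finset.range k, ‖gbinom α (h + 1)‖ * (C₃ * B ^ (n₀ + 2) * 2) with hD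
    refine ⟨D + (C₂ * Sε + C₁ * Sε + |c|), fun s hs him => ?_⟩
    set r := ‖s‖ with hr
    have hr1 : 1 ≤ r := him.trans (Complex.abs_im_le_norm s)
    have hr0 : 0 ≤ r := by linarith
    set W : ℝ := r * (r + 1) ^ (n₀ + 1) with hW
    have hW1 : 1 ≤ (r + 1) ^ (n₀ + 1) := one_le_pow₀ (by linarith)
    have hWr : r ≤ W := le_mul_of_one_le_right hr0 hW1
    have hW2 : r * (r + 1) ≤ W := by
      refine mul_le_mul_of_nonneg_left ?_ hr0
      exact le_self_pow₀ (by linarith) (by omega)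
    have hzt : ∀ h ∈ Finset.range k, ‖gbinom α (h + 1) * riemannZeta (s - ((α - h : ℝ) : ℂ) + 1)‖ ≤
        ‖gbinom α (h + 1)‖ * (C₃ * B ^ (n₀ + 2) * 2) * W := by
      intro h hh
      have hhk : (h : ℝ) ≤ k := by exact_mod_cast (Finset.mem_range.1 hh).le
      have hh0 : (0 : ℝ) ≤ h := h.cast_nonneg
      have h1 := hζ (s - ((α - h : ℝ) : ℂ) + 1) (by
        rw [Complex.add_re, Complex.sub_re, Complex.ofReal_re, Complex.one_re]
        push_cast; linarith) (by simpa using him)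
      have h2 : ‖s - ((α - h : ℝ) : ℂ) + 1‖ + 1 ≤ B * (r + 1) := by
        have h3 : ‖s - ((α - h : ℝ) : ℂ) + 1‖ ≤ r + |α - h| + 1 := by
          refine (norm_add_le _ _).trans ?_
          rw [norm_one]
          gcongr
          refine (norm_sub_le _ _).trans ?_
          rw [Complex.norm_real, Real.norm_eq_abs]
        have h4 : |α - h| ≤ α + k := by rw [abs_le]; constructor <;> linarith
        nlinarith
      rw [norm_mul, mul_assoc]
      gcongr
      calc _ ≤ C₃ * (B * (r + 1)) ^ (n₀ + 2) := h1.trans (by gcongr)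
        _ = C₃ * B ^ (n₀ + 2) * ((r + 1) * (r + 1) ^ (n₀ + 1)) := by rw [mul_pow]; ring
        _ ≤ C₃ * B ^ (n₀ + 2) * ((2 * r) * (r + 1) ^ (n₀ + 1)) := by gcongr; linarith
        _ = _ := by rw [hW]; ring
    have h₁ := norm_tsum_le_of_bound hQ₁ hb₁ hε (s := s) (by linarith)
    have h₂ := norm_tsum_le_of_bound hQ₂ hb₂ hε (s := s) (by linarith)
    rw [← hSε] at h₁ h₂
    calc _ ≤ ∑ h ∈ Finset.range k, ‖gbinom α (h + 1)‖ * (C₃ * B ^ (n₀ + 2) * 2) * W +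
          (C₂ * Sε + C₁ * (r * (r + 1)) * Sε + |c|) := by
          refine (norm_add_le _ _).trans (add_le_add ((norm_sum_le _ _).trans
            (Finset.sum_le_sum hzt)) ((norm_add_le _ _).trans (add_le_add ?_ ?_)))
          · exact (norm_add_le _ _).trans (add_le_add h₁ h₂)
          · rw [Complex.norm_real, Real.norm_eq_abs]
      _ ≤ D * W + (C₂ * Sε * W + C₁ * W * Sε + |c| * W) := by
          rw [← Finset.sum_mul, ← hD]
          have hW1' : 1 ≤ W := hr1.trans hWr
          have g1 : C₂ * Sε ≤ C₂ * Sε * W := le_mul_of_one_le_right (by positivity) hW1'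
          have g2 : |c| ≤ |c| * W := le_mul_of_one_le_right (abs_nonneg _) hW1'
          have g3 : C₁ * (r * (r + 1)) * Sε ≤ C₁ * W * Sε := by gcongr
          linarith
      _ = _ := by ring

/-! ### Shifting vertical lines of integration -/

/-- Riemann's removable singularity theorem for finitely many points. -/
lemma exists_differentiableOn_eqOn {U : Set ℂ} (hU : IsOpen U) {S : Set ℂ} (hS : S.Finite)
    {f : ℂ → ℂ} (hd : DifferentiableOn ℂ f (U \ S))
    (hp : ∀ p ∈ S, Tendsto (fun s => (s - p) * f s) (𝓝[≠] p) (𝓝 0)) :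
    ∃ g : ℂ → ℂ, DifferentiableOn ℂ g U ∧ Set.EqOn g f (U \ S) := by
  have hUS : IsOpen (U \ S) := hU.sdiff hS.isClosed
  have heq : Set.EqOn (fun s => limUnder (𝓝[≠] s) f) f (U \ S) := by
    intro s hs
    have hc : ContinuousAt f s := (hd.differentiableAt (hUS.mem_nhds hs)).continuousAt
    exact (hc.tendsto.mono_left nhdsWithin_le_nhds).limUnder_eq
  refine ⟨fun s => limUnder (𝓝[≠] s) f, fun s hs => ?_, heq⟩
  by_cases hsS : s ∈ S
  · have hVo : IsOpen (U \ (S \ {s})) := hU.sdiff (hS.subset Set.sdiff_subset).isClosed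
    have hsV : s ∈ U \ (S \ {s}) := ⟨hs, fun h => h.2 rfl⟩
    have hsub : (U \ (S \ {s})) \ {s} ⊆ U \ S := fun z hz =>
      ⟨hz.1.1, fun hzS => hz.1.2 ⟨hzS, hz.2⟩⟩
    have ho : (fun z => f z - f s) =o[𝓝[≠] s] fun z => (z - s)⁻¹ := by
      rw [isLittleO_iff_tendsto']
      · have h1 : Tendsto (fun z => (z - s) * f s) (𝓝[≠] s) (𝓝 0) := by
          have : Tendsto (fun z => (z - s) * f s) (𝓝 s) (𝓝 ((s - s) * f s)) :=
            (by fun_prop : Continuous fun z : ℂ => (z - s) * f s).tendsto s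
          rw [sub_self, zero_mul] at this
          exact this.mono_left nhdsWithin_le_nhds
        have h2 := (hp s hsS).sub h1
        rw [sub_zero] at h2
        refine h2.congr fun z => ?_
        rw [div_inv_eq_mul]; ring
      · filter_upwards [self_mem_nhdsWithin] with z hz h0
        exact absurd (sub_eq_zero.1 (inv_eq_zero.1 h0)) hz
    have hup := Complex.differentiableOn_update_limUnder_of_isLittleO (hVo.mem_nhds hsV)
      (hd.mono hsub) ho
    refine ((hup.differentiableAt (hVo.mem_nhds hsV)).congr_of_eventuallyEq ?_).differentiableWithinAt
    filter_upwards [hVo.mem_nhds hsV] with z hz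
    by_cases hzs : z = s
    · subst hzs; simp
    · rw [Function.update_of_ne hzs]
      exact heq (hsub ⟨hz, hzs⟩)
  · have hs' : s ∈ U \ S := ⟨hs, hsS⟩
    refine ((hd.differentiableAt (hUS.mem_nhds hs')).congr_of_eventuallyEq ?_).differentiableWithinAt
    filter_upwards [hUS.mem_nhds hs'] with z hz using heq hz

lemma add_mul_I_ne_zero {u : ℝ} (hu : u ≠ 0) (t : ℝ) : (u : ℂ) + t * Complex.I ≠ 0 := by
  intro h
  have := congrArg Complex.re h
  simp at this
  exact hu this

lemma continuous_inv_add_mul_I {u : ℝ} (hu : u ≠ 0) :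
    Continuous fun t : ℝ => ((u : ℂ) + t * Complex.I)⁻¹ :=
  Continuous.inv₀ (by fun_prop) (add_mul_I_ne_zero hu)

lemma integral_inv_add_mul_I {u : ℝ} (hu : u ≠ 0) (T : ℝ) :
    ∫ t in (-T)..T, ((u : ℂ) + t * Complex.I)⁻¹ = ((2 * Real.arctan (T / u) : ℝ) : ℂ) := by
  have hpos : ∀ t : ℝ, 0 < u ^ 2 + t ^ 2 := fun t => by positivity
  have hderiv : ∀ t ∈ Set.uIcc (-T) T, HasDerivAt (fun t : ℝ => ((Real.arctan (t / u) : ℝ) : ℂ) -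
      ((1 / 2 * Real.log (u ^ 2 + t ^ 2) : ℝ) : ℂ) * Complex.I) (((u : ℂ) + t * Complex.I)⁻¹) t := by
    intro t _
    have h1 : HasDerivAt (fun t : ℝ => Real.arctan (t / u)) (u / (u ^ 2 + t ^ 2)) t := by
      refine ((hasDerivAt_id t).div_const u).arctan.congr_deriv ?_
      have := hpos t
      simp only [id]
      field_simp
    have h2 : HasDerivAt (fun t : ℝ => 1 / 2 * Real.log (u ^ 2 + t ^ 2)) (t / (u ^ 2 + t ^ 2)) t := by
      have h3 : HasDerivAt (fun t : ℝ => u ^ 2 + t ^ 2) (2 * t) t := by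
        have := (hasDerivAt_pow 2 t).const_add (u ^ 2)
        simpa using this
      refine ((h3.log (hpos t).ne').const_mul (1 / 2)).congr_deriv ?_
      ring
    refine (h1.ofReal_comp.sub (h2.ofReal_comp.mul_const Complex.I)).congr_deriv ?_
    have h4 : ((u : ℂ) ^ 2 + (t : ℂ) ^ 2) ≠ 0 := by exact_mod_cast (hpos t).ne'
    have h5 := add_mul_I_ne_zero hu t
    push_cast
    rw [div_mul_eq_mul_div, ← sub_div, eq_comm, inv_eq_one_div, div_eq_div_iff h5 h4]
    ring_nf
    rw [Complex.I_sq]; ring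
  rw [intervalIntegral.integral_eq_sub_of_hasDerivAt hderiv
    ((continuous_inv_add_mul_I hu).intervalIntegrable _ _)]
  rw [neg_div, Real.arctan_neg]
  push_cast
  ring_nf

lemma integral_inv_sq_add_mul_I {u : ℝ} (hu : u ≠ 0) (T : ℝ) :
    ∫ t in (-T)..T, (((u : ℂ) + t * Complex.I) ^ 2)⁻¹ =
      Complex.I * ((u : ℂ) + T * Complex.I)⁻¹ - Complex.I * ((u : ℂ) - T * Complex.I)⁻¹ := by
  have hderiv : ∀ t ∈ Set.uIcc (-T) T, HasDerivAt
      (fun t : ℝ => Complex.I * ((u : ℂ) + t * Complex.I)⁻¹) ((((u : ℂ) + t * Complex.I) ^ 2)⁻¹) t := by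
    intro t _
    have h1 : HasDerivAt (fun t : ℝ => (u : ℂ) + t * Complex.I) (1 * Complex.I) t :=
      ((hasDerivAt_id t).ofReal_comp.mul_const Complex.I).const_add _
    refine ((h1.fun_inv (add_mul_I_ne_zero hu t)).const_mul Complex.I).congr_deriv ?_
    rw [one_mul, mul_div_assoc', mul_neg, Complex.I_mul_I, neg_neg, one_div]
  have hc : Continuous fun t : ℝ => (((u : ℂ) + t * Complex.I) ^ 2)⁻¹ :=
    Continuous.inv₀ (by fun_prop) fun t => pow_ne_zero 2 (add_mul_I_ne_zero hu t)
  rw [intervalIntegral.integral_eq_sub_of_hasDerivAt hderiv (hc.intervalIntegrable _ _)]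
  push_cast
  rw [neg_mul, ← sub_eq_add_neg]

lemma tendsto_integral_inv_pos {u : ℝ} (hu : 0 < u) :
    Tendsto (fun T : ℝ => ∫ t in (-T)..T, ((u : ℂ) + t * Complex.I)⁻¹) atTop (𝓝 (Real.pi : ℂ)) := by
  simp_rw [integral_inv_add_mul_I hu.ne']
  refine (Complex.continuous_ofReal.tendsto Real.pi).comp ?_
  have h1 : Tendsto (fun T : ℝ => Real.arctan (T / u)) atTop (𝓝 (Real.pi / 2)) :=
    (tendsto_nhds_of_tendsto_nhdsWithin Real.tendsto_arctan_atTop).comp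
      (tendsto_id.atTop_div_const hu)
  have h2 := h1.const_mul 2
  rwa [mul_div_cancel₀ _ two_ne_zero] at h2

lemma tendsto_integral_inv_neg {u : ℝ} (hu : u < 0) :
    Tendsto (fun T : ℝ => ∫ t in (-T)..T, ((u : ℂ) + t * Complex.I)⁻¹) atTop
      (𝓝 (-(Real.pi : ℂ))) := by
  have h := (tendsto_integral_inv_pos (neg_pos.2 hu)).neg
  refine h.congr fun T => ?_
  rw [integral_inv_add_mul_I hu.ne, integral_inv_add_mul_I (neg_ne_zero.2 hu.ne), div_neg,
    Real.arctan_neg]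
  push_cast; ring

lemma norm_inv_add_mul_I_le (u : ℝ) {T : ℝ} (hT : T ≠ 0) :
    ‖((u : ℂ) + T * Complex.I)⁻¹‖ ≤ |T|⁻¹ := by
  rw [norm_inv]
  refine inv_anti₀ (abs_pos.2 hT) ?_
  have := Complex.abs_im_le_norm ((u : ℂ) + T * Complex.I)
  simpa using this

lemma tendsto_integral_inv_sq {u : ℝ} (hu : u ≠ 0) :
    Tendsto (fun T : ℝ => ∫ t in (-T)..T, (((u : ℂ) + t * Complex.I) ^ 2)⁻¹) atTop (𝓝 0) := by
  simp_rw [integral_inv_sq_add_mul_I hu]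
  have h1 : Tendsto (fun T : ℝ => |T|⁻¹) atTop (𝓝 0) :=
    tendsto_inv_atTop_zero.comp tendsto_abs_atTop_atTop
  have key : Tendsto (fun T : ℝ => ((u : ℂ) + T * Complex.I)⁻¹) atTop (𝓝 0) := by
    refine squeeze_zero_norm' ?_ h1
    filter_upwards [eventually_gt_atTop 0] with T hT using norm_inv_add_mul_I_le u hT.ne'
  have key' : Tendsto (fun T : ℝ => ((u : ℂ) - T * Complex.I)⁻¹) atTop (𝓝 0) := by
    refine squeeze_zero_norm' ?_ h1
    filter_upwards [eventually_gt_atTop 0] with T hT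
    have := norm_inv_add_mul_I_le u (neg_ne_zero.2 hT.ne')
    rw [abs_neg] at this
    push_cast at this
    rwa [neg_mul, ← sub_eq_add_neg] at this
  have := (key.const_mul Complex.I).sub (key'.const_mul Complex.I)
  simpa using this

lemma integrable_of_continuous_of_decay {g : ℝ → ℂ} (hc : Continuous g) {C : ℝ}
    (h : ∀ t : ℝ, 1 ≤ |t| → ‖g t‖ * |t| ^ 2 ≤ C) : MeasureTheory.Integrable g := by
  obtain ⟨B, hB⟩ := (isCompact_Icc (a := (-1 : ℝ)) (b := 1)).exists_bound_of_continuousOn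
    hc.continuousOn
  have hB0 : 0 ≤ B := (norm_nonneg _).trans (hB 0 (by simp))
  have hC0 : 0 ≤ C := (mul_nonneg (norm_nonneg _) (by positivity)).trans (h 1 (by simp))
  refine (integrable_inv_one_add_sq.const_mul (2 * (B + C))).mono' hc.aestronglyMeasurable
    (Eventually.of_forall fun t => ?_)
  rw [← div_eq_mul_inv, le_div_iff₀ (by positivity)]
  rcases le_total 1 |t| with ht | ht
  · have h1 := h t ht
    rw [sq_abs] at h1
    have h2 : 1 ≤ t ^ 2 := by rw [← sq_abs]; exact one_le_pow₀ ht
    nlinarith [norm_nonneg (g t)]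
  · have h1 := hB t (abs_le.1 ht)
    have h2 : t ^ 2 ≤ 1 := by rw [← sq_abs]; exact pow_le_one₀ (abs_nonneg _) ht
    nlinarith [norm_nonneg (g t), sq_nonneg t]

lemma continuous_vertical {G : ℂ → ℂ} {U : Set ℂ} (hG : ContinuousOn G U) {c : ℝ}
    (h : ∀ t : ℝ, (c : ℂ) + t * Complex.I ∈ U) : Continuous fun t : ℝ => G (c + t * Complex.I) :=
  hG.comp_continuous (by fun_prop) h

/-- The singular part `a / (s - p) + b / (s - p) ^ 2` of a pole of order at most two. -/
noncomputable def polarPart (a b : ℝ → ℂ) (S : Finset ℝ) (s : ℂ) : ℂ :=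
  ∑ p ∈ S, (a p * (s - p)⁻¹ + b p * ((s - p) ^ 2)⁻¹)

lemma differentiableAt_polarPart (a b : ℝ → ℂ) (S : Finset ℝ) {s : ℂ}
    (hs : ∀ p ∈ S, s ≠ (p : ℂ)) : DifferentiableAt ℂ (polarPart a b S) s := by
  unfold polarPart
  refine DifferentiableAt.fun_sum fun p hp => ?_
  have h := sub_ne_zero.2 (hs p hp)
  refine DifferentiableAt.add (DifferentiableAt.const_mul ?_ _) (DifferentiableAt.const_mul ?_ _)
  · exact DifferentiableAt.inv (by fun_prop) h
  · exact DifferentiableAt.inv (by fun_prop) (pow_ne_zero 2 h)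

lemma norm_polarPart_le (a b : ℝ → ℂ) (S : Finset ℝ) {s : ℂ} (hs : 1 ≤ |s.im|) :
    ‖polarPart a b S s‖ ≤ (∑ p ∈ S, (‖a p‖ + ‖b p‖)) * |s.im|⁻¹ := by
  rw [polarPart, Finset.sum_mul]
  refine (norm_sum_le _ _).trans (Finset.sum_le_sum fun p _ => ?_)
  have h0 : 0 < |s.im| := by linarith
  have h1 : |s.im| ≤ ‖s - p‖ := by
    have := Complex.abs_im_le_norm (s - p)
    simpa using this
  have h2 : ‖(s - p)⁻¹‖ ≤ |s.im|⁻¹ := by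
    rw [norm_inv]; exact inv_anti₀ h0 h1
  have h3 : ‖((s - p) ^ 2)⁻¹‖ ≤ |s.im|⁻¹ := by
    rw [norm_inv, norm_pow]
    refine inv_anti₀ h0 ?_
    nlinarith
  refine (norm_add_le _ _).trans ?_
  rw [norm_mul, norm_mul, add_mul]
  gcongr

lemma vertical_sub_ne (c t : ℝ) {p : ℝ} (hp : c ≠ p) : (c : ℂ) + t * Complex.I - p ≠ 0 := by
  have := add_mul_I_ne_zero (sub_ne_zero.2 hp) t
  push_cast at this
  intro h
  exact this (by linear_combination h)

lemma continuous_polarPart_term (a b : ℂ) {c p : ℝ} (hp : c ≠ p) :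
    Continuous fun t : ℝ => a * ((c : ℂ) + t * Complex.I - p)⁻¹ +
      b * (((c : ℂ) + t * Complex.I - p) ^ 2)⁻¹ := by
  refine (Continuous.const_mul ?_ _).add (Continuous.const_mul ?_ _)
  · exact Continuous.inv₀ (by fun_prop) fun t => vertical_sub_ne c t hp
  · exact Continuous.inv₀ (by fun_prop) fun t => pow_ne_zero 2 (vertical_sub_ne c t hp)

lemma tendsto_integral_polarPart_term (a b : ℂ) {c p : ℝ} (hp : c ≠ p) :
    Tendsto (fun T : ℝ => ∫ t in (-T)..T, (a * ((c : ℂ) + t * Complex.I - p)⁻¹ +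
      b * (((c : ℂ) + t * Complex.I - p) ^ 2)⁻¹)) atTop
      (𝓝 (a * (if p < c then (Real.pi : ℂ) else -(Real.pi : ℂ)))) := by
  have hu : c - p ≠ 0 := sub_ne_zero.2 hp
  have e : ∀ t : ℝ, (c : ℂ) + t * Complex.I - p = ((c - p : ℝ) : ℂ) + t * Complex.I := fun t => by
    push_cast; ring
  simp_rw [e]
  have hi1 : ∀ T : ℝ, IntervalIntegrable (fun t : ℝ => a * (((c - p : ℝ) : ℂ) + t * Complex.I)⁻¹)
      MeasureTheory.volume (-T) T := fun T =>
    ((continuous_inv_add_mul_I hu).const_mul a).intervalIntegrable _ _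
  have hi2 : ∀ T : ℝ, IntervalIntegrable
      (fun t : ℝ => b * ((((c - p : ℝ) : ℂ) + t * Complex.I) ^ 2)⁻¹) MeasureTheory.volume (-T) T :=
    fun T => (Continuous.const_mul (Continuous.inv₀ (by fun_prop)
      fun t => pow_ne_zero 2 (add_mul_I_ne_zero hu t)) b).intervalIntegrable _ _
  simp_rw [fun T => intervalIntegral.integral_add (hi1 T) (hi2 T),
    intervalIntegral.integral_const_mul]
  have h2 := (tendsto_integral_inv_sq hu).const_mul b
  rw [mul_zero] at h2
  have h1 : Tendsto (fun T : ℝ => a * ∫ t in (-T)..T, (((c - p : ℝ) : ℂ) + t * Complex.I)⁻¹) atTop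
      (𝓝 (a * (if p < c then (Real.pi : ℂ) else -(Real.pi : ℂ)))) := by
    refine Tendsto.const_mul a ?_
    split_ifs with h
    · exact tendsto_integral_inv_pos (by linarith)
    · exact tendsto_integral_inv_neg (lt_of_le_of_ne (by linarith) hu)
  simpa using h1.add h2

lemma tendsto_integral_polarPart (a b : ℝ → ℂ) (S : Finset ℝ) {c : ℝ} (hc : ∀ p ∈ S, c ≠ p) :
    Tendsto (fun T : ℝ => ∫ t in (-T)..T, polarPart a b S (c + t * Complex.I)) atTop
      (𝓝 (∑ p ∈ S, a p * (if p < c then (Real.pi : ℂ) else -(Real.pi : ℂ)))) := by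
  unfold polarPart
  simp_rw [fun T : ℝ => intervalIntegral.integral_finsetSum
    (μ := MeasureTheory.volume) (a := -T) (b := T) (s := S)
    (f := fun p (t : ℝ) => a p * ((c : ℂ) + t * Complex.I - p)⁻¹ +
      b p * (((c : ℂ) + t * Complex.I - p) ^ 2)⁻¹)
    fun p hp => (continuous_polarPart_term (a p) (b p) (hc p hp)).intervalIntegrable _ _]
  exact tendsto_finsetSum _ fun p hp => tendsto_integral_polarPart_term (a p) (b p) (hc p hp)

/-- **Residue theorem for a vertical strip**: shifting the line of integration of a function that
decays like `1 / t ^ 2` past finitely many real poles of order at most two collects the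
residues. -/
theorem integral_vertical_sub {G : ℂ → ℂ} {U : Set ℂ} (hU : IsOpen U) {c₁ c₂ : ℝ} (hcc : c₁ ≤ c₂)
    (hUc : ∀ s : ℂ, c₁ ≤ s.re → s.re ≤ c₂ → s ∈ U) {S : Finset ℝ} {a b : ℝ → ℂ}
    (hS : ∀ p ∈ S, c₁ < p ∧ p < c₂)
    (hd : DifferentiableOn ℂ G (U \ (fun p : ℝ => (p : ℂ)) '' S))
    (hp : ∀ p ∈ S, Tendsto (fun s : ℂ => (s - p) * (G s - (a p * (s - p)⁻¹ +
      b p * ((s - p) ^ 2)⁻¹))) (𝓝[≠] (p : ℂ)) (𝓝 0))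
    {C : ℝ} (hC : ∀ s : ℂ, c₁ ≤ s.re → s.re ≤ c₂ → 1 ≤ |s.im| → ‖G s‖ * |s.im| ^ 2 ≤ C) :
    ((∫ t : ℝ, G (c₂ + t * Complex.I)) - ∫ t : ℝ, G (c₁ + t * Complex.I)) =
      2 * Real.pi * ∑ p ∈ S, a p := by
  set P : Set ℂ := (fun p : ℝ => (p : ℂ)) '' S with hP
  have hPfin : P.Finite := S.finite_toSet.image _
  have hPne : ∀ s ∉ P, ∀ p ∈ S, s ≠ (p : ℂ) := fun s hs p hp h => hs ⟨p, hp, h.symm⟩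
  set F : ℂ → ℂ := fun s => G s - polarPart a b S s with hF
  have hFd : DifferentiableOn ℂ F (U \ P) := hd.sub fun s hs =>
    (differentiableAt_polarPart a b S (hPne s hs.2)).differentiableWithinAt
  have hFp : ∀ q ∈ P, Tendsto (fun s => (s - q) * F s) (𝓝[≠] q) (𝓝 0) := by
    rintro _ ⟨p, hpS, rfl⟩
    -- the other polar parts are regular at `p`
    have hreg : DifferentiableAt ℂ (polarPart a b (S.erase p)) (p : ℂ) :=
      differentiableAt_polarPart a b _ fun q hq h =>
        (Finset.mem_erase.1 hq).1 (by exact_mod_cast h.symm)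
    have hid : Tendsto (fun s : ℂ => s - (p : ℂ)) (𝓝[≠] (p : ℂ)) (𝓝 0) := by
      have : Tendsto (fun s : ℂ => s - (p : ℂ)) (𝓝 (p : ℂ)) (𝓝 ((p : ℂ) - p)) :=
        (by fun_prop : Continuous fun s : ℂ => s - (p : ℂ)).tendsto _
      rw [sub_self] at this
      exact this.mono_left nhdsWithin_le_nhds
    have h1 := hid.mul (hreg.continuousAt.tendsto.mono_left nhdsWithin_le_nhds)
    rw [zero_mul] at h1
    have h2 := (hp p hpS).sub h1
    rw [sub_zero] at h2
    refine h2.congr fun s => ?_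
    simp only [hF]
    have : polarPart a b S s = (a p * (s - p)⁻¹ + b p * ((s - p) ^ 2)⁻¹) +
        polarPart a b (S.erase p) s := by
      exact (Finset.add_sum_erase S
        (fun p : ℝ => a p * (s - p)⁻¹ + b p * ((s - p) ^ 2)⁻¹) hpS).symm
    rw [this]; ring
  obtain ⟨g, hgd, hgF⟩ := exists_differentiableOn_eqOn hU hPfin hFd hFp
  have hline : ∀ c : ℝ, c₁ ≤ c → c ≤ c₂ → (∀ p ∈ S, c ≠ p) → ∀ t : ℝ,
      (c : ℂ) + t * Complex.I ∈ U \ P := by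
    intro c h1 h2 hc t
    refine ⟨hUc _ (by simpa using h1) (by simpa using h2), ?_⟩
    rintro ⟨p, hpS, h⟩
    exact vertical_sub_ne c t (hc p hpS) (sub_eq_zero.2 h.symm)
  -- the limit of the truncated integrals of `g` over a vertical line
  have hlim : ∀ c : ℝ, c₁ ≤ c → c ≤ c₂ → (∀ p ∈ S, c ≠ p) →
      Tendsto (fun T : ℝ => ∫ t in (-T)..T, g (c + t * Complex.I)) atTop
        (𝓝 ((∫ t : ℝ, G (c + t * Complex.I)) -
          ∑ p ∈ S, a p * (if p < c then (Real.pi : ℂ) else -(Real.pi : ℂ)))) := by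
    intro c h1 h2 hc
    have hGc : Continuous fun t : ℝ => G (c + t * Complex.I) :=
      continuous_vertical hd.continuousOn (hline c h1 h2 hc)
    have hGi : MeasureTheory.Integrable fun t : ℝ => G (c + t * Complex.I) := by
      refine integrable_of_continuous_of_decay hGc (C := C) fun t ht => ?_
      have := hC (c + t * Complex.I) (by simpa using h1) (by simpa using h2) (by simpa using ht)
      simpa using this
    have hpc : Continuous fun t : ℝ => polarPart a b S (c + t * Complex.I) := by
      unfold polarPart
      exact continuous_finsetSum _ fun p hp => continuous_polarPart_term _ _ (hc p hp)
    have h3 := (MeasureTheory.intervalIntegral_tendsto_integral hGi tendsto_neg_atTop_atBot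
      tendsto_id).sub (tendsto_integral_polarPart a b S hc)
    refine h3.congr fun T => ?_
    rw [id, ← intervalIntegral.integral_sub (hGc.intervalIntegrable _ _)
      (hpc.intervalIntegrable _ _)]
    refine intervalIntegral.integral_congr fun t _ => ?_
    exact (hgF (hline c h1 h2 hc t)).symm
  set D : ℝ := C + ∑ p ∈ S, (‖a p‖ + ‖b p‖) with hD
  have hhor : ∀ s : ℂ, c₁ ≤ s.re → s.re ≤ c₂ → 1 ≤ |s.im| → ‖g s‖ ≤ D * |s.im|⁻¹ := by
    intro s h1 h2 h3
    have hsP : s ∉ P := by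
      rintro ⟨p, _, rfl⟩
      simp at h3
      linarith
    have h0 : 0 < |s.im| := by linarith
    rw [hgF ⟨hUc s h1 h2, hsP⟩, hD, add_mul]
    refine (norm_sub_le _ _).trans (add_le_add ?_ (norm_polarPart_le a b S h3))
    rw [← div_eq_mul_inv, le_div_iff₀ h0]
    refine le_trans ?_ (hC s h1 h2 h3)
    gcongr
    nlinarith
  have hzero : Tendsto (fun T : ℝ => (∫ t in (-T)..T, g (c₂ + t * Complex.I)) -
      ∫ t in (-T)..T, g (c₁ + t * Complex.I)) atTop (𝓝 0) := by
    have hb : ∀ᶠ T : ℝ in atTop, ‖(∫ t in (-T)..T, g (c₂ + t * Complex.I)) -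
        ∫ t in (-T)..T, g (c₁ + t * Complex.I)‖ ≤ 2 * D * |c₂ - c₁| * T⁻¹ := by
      filter_upwards [eventually_ge_atTop 1] with T hT
      have hT0 : 0 < T := by linarith
      have hrect := Complex.integral_boundary_rect_eq_zero_of_differentiableOn g
        ((c₁ : ℂ) + (-T : ℝ) * Complex.I) ((c₂ : ℂ) + T * Complex.I) (hgd.mono fun s hs => by
          have := hs.1
          simp only [Set.mem_preimage] at this
          rw [Set.uIcc_of_le (by simpa using hcc)] at this
          exact hUc s (by simpa using this.1) (by simpa using this.2))
      simp only [Complex.add_re, Complex.ofReal_re, Complex.mul_re, Complex.I_re, mul_zero,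
        Complex.ofReal_im, Complex.I_im, mul_one, sub_self, add_zero, Complex.add_im,
        Complex.mul_im, zero_add, smul_eq_mul] at hrect
      have hbd : ∀ τ : ℝ, |τ| = T → ‖∫ x in c₁..c₂, g (x + τ * Complex.I)‖ ≤ D * T⁻¹ * |c₂ - c₁| := by
        intro τ hτ
        refine intervalIntegral.norm_integral_le_of_norm_le_const fun x hx => ?_
        rw [Set.uIoc_of_le hcc] at hx
        have := hhor (x + τ * Complex.I) (by simpa using hx.1.le) (by simpa using hx.2)
          (by simp [hτ, hT])
        simpa [hτ] using this
      have h1 := hbd T (abs_of_pos hT0)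
      have h2 := hbd (-T) (by rw [abs_neg, abs_of_pos hT0])
      have h3 : Complex.I * ((∫ t in (-T)..T, g (c₂ + t * Complex.I)) -
          ∫ t in (-T)..T, g (c₁ + t * Complex.I)) =
          (∫ x in c₁..c₂, g (x + T * Complex.I)) - ∫ x in c₁..c₂, g (x + (-T : ℝ) * Complex.I) := by
        linear_combination hrect
      have h4 := congrArg norm h3
      rw [norm_mul, Complex.norm_I, one_mul] at h4
      rw [h4]
      refine (norm_sub_le _ _).trans ?_
      linarith
    refine squeeze_zero_norm' hb ?_
    have := (tendsto_inv_atTop_zero (𝕜 := ℝ)).const_mul (2 * D * |c₂ - c₁|)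
    rwa [mul_zero] at this
  have h2 := hlim c₂ hcc le_rfl fun p hp => (hS p hp).2.ne'
  have h1 := hlim c₁ le_rfl hcc fun p hp => (hS p hp).1.ne
  have huniq := tendsto_nhds_unique (h2.sub h1) hzero
  have e2 : ∑ p ∈ S, a p * (if p < c₂ then (Real.pi : ℂ) else -(Real.pi : ℂ)) =
      Real.pi * ∑ p ∈ S, a p := by
    rw [Finset.mul_sum]
    exact Finset.sum_congr rfl fun p hp => by rw [if_pos (hS p hp).2, mul_comm]
  have e1 : ∑ p ∈ S, a p * (if p < c₁ then (Real.pi : ℂ) else -(Real.pi : ℂ)) =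
      -Real.pi * ∑ p ∈ S, a p := by
    rw [Finset.mul_sum]
    exact Finset.sum_congr rfl fun p hp => by rw [if_neg (hS p hp).1.le.not_gt, mul_comm]
  rw [e1, e2] at huniq
  linear_combination huniq

/-! ### The inverse Mellin transform -/

lemma rpow_le_two_mul_psTerm {κ : ℝ} (hκ : 0 < κ) (n : ℕ) :
    ((n : ℝ) + 1) ^ κ ≤ 2 * psTerm κ n := by
  have h1 : ((n : ℝ) + 1) ^ κ < psTerm κ n + 1 := Nat.lt_floor_add_one _
  have h2 : (1 : ℝ) ≤ psTerm κ n := by exact_mod_cast psTerm_pos hκ n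
  linarith

lemma summable_exp_neg_mul_psTerm {κ : ℝ} (hκ : 0 < κ) {x : ℝ} (hx : 0 < x) :
    Summable fun n : ℕ => Real.exp (-(x * psTerm κ n)) := by
  obtain ⟨N, hN⟩ := exists_nat_gt (2 / κ)
  have hN' : 2 ≤ κ * N := by
    rw [div_lt_iff₀ hκ] at hN; linarith
  refine Summable.of_nonneg_of_le (fun n => (Real.exp_pos _).le) (fun n => ?_)
    ((summable_succ_rpow one_pos).mul_left (N.factorial * (2 / x) ^ N))
  have hn : (1 : ℝ) ≤ (n : ℝ) + 1 := by linarith [n.cast_nonneg (α := ℝ)]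
  have hn0 : (0 : ℝ) < (n : ℝ) + 1 := by linarith
  have ha : (0 : ℝ) < psTerm κ n := by exact_mod_cast psTerm_pos hκ n
  have h1 := Real.pow_div_factorial_le_exp (x * psTerm κ n) (by positivity) N
  have h2 : (((n : ℝ) + 1) ^ κ) ^ N ≤ (2 / x) ^ N * (x * psTerm κ n) ^ N := by
    rw [← mul_pow]
    refine pow_le_pow_left₀ (by positivity) ?_ N
    have := rpow_le_two_mul_psTerm hκ n
    have e : 2 / x * (x * psTerm κ n) = 2 * psTerm κ n := by field_simp
    rwa [e]
  have h3 : ((n : ℝ) + 1) ^ (2 : ℝ) ≤ (((n : ℝ) + 1) ^ κ) ^ N := by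
    rw [← Real.rpow_natCast, ← Real.rpow_mul hn0.le]
    exact Real.rpow_le_rpow_of_exponent_le hn hN'
  have hf : (0 : ℝ) < N.factorial := by exact_mod_cast N.factorial_pos
  rw [div_le_iff₀ hf] at h1
  have h4 : ((n : ℝ) + 1) ^ (2 : ℝ) ≤ N.factorial * (2 / x) ^ N * Real.exp (x * psTerm κ n) := by
    refine (h3.trans h2).trans ?_
    have : 0 < (2 / x) ^ N := by positivity
    nlinarith
  have e2 : -(1 + 1 : ℝ) = -2 := by norm_num
  rw [Real.exp_neg, e2, Real.rpow_neg hn0.le, ← div_eq_mul_inv, inv_eq_one_div,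
    div_le_div_iff₀ (Real.exp_pos _) (by positivity), one_mul]
  exact h4

lemma norm_exp_neg_mul_psTerm (κ : ℝ) (z : ℂ) (n : ℕ) :
    ‖Complex.exp (-(z * (psTerm κ n : ℂ)))‖ = Real.exp (-(z.re * psTerm κ n)) := by
  rw [Complex.norm_exp]; simp

lemma norm_exp_neg_mul_psTerm_lt_one {κ : ℝ} (hκ : 0 < κ) {z : ℂ} (hz : 0 < z.re) (n : ℕ) :
    ‖Complex.exp (-(z * (psTerm κ n : ℂ)))‖ < 1 := by
  have ha : (0 : ℝ) < psTerm κ n := by exact_mod_cast psTerm_pos hκ n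
  rw [norm_exp_neg_mul_psTerm, Real.exp_lt_one_iff]
  have : 0 < z.re * psTerm κ n := by positivity
  linarith

lemma norm_log_term_le {κ : ℝ} (hκ : 0 < κ) {x : ℝ} (hx : 0 < x) {z : ℂ} (hz : x ≤ z.re) (n : ℕ) :
    ‖Complex.log (1 - Complex.exp (-(z * (psTerm κ n : ℂ))))‖ ≤
      ((1 - Real.exp (-x))⁻¹ / 2 + 1) * Real.exp (-(x * psTerm κ n)) := by
  have ha : (1 : ℝ) ≤ psTerm κ n := by exact_mod_cast psTerm_pos hκ n
  set w := Complex.exp (-(z * (psTerm κ n : ℂ))) with hw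
  have hw1 : ‖w‖ < 1 := norm_exp_neg_mul_psTerm_lt_one hκ (hx.trans_le hz) n
  have hwx : ‖w‖ ≤ Real.exp (-(x * psTerm κ n)) := by
    rw [hw, norm_exp_neg_mul_psTerm, Real.exp_le_exp]
    have : x * psTerm κ n ≤ z.re * psTerm κ n := by gcongr
    linarith
  have hwx' : ‖w‖ ≤ Real.exp (-x) := hwx.trans (Real.exp_le_exp.2 (by nlinarith))
  have hex : Real.exp (-x) < 1 := by rw [Real.exp_lt_one_iff]; linarith
  have h := Complex.norm_log_one_add_le (z := -w) (by rwa [norm_neg])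
  rw [norm_neg, ← sub_eq_add_neg] at h
  refine h.trans ?_
  have h1 : (1 - ‖w‖)⁻¹ ≤ (1 - Real.exp (-x))⁻¹ := inv_anti₀ (by linarith) (by linarith)
  have h2 : ‖w‖ ^ 2 ≤ ‖w‖ := by nlinarith [norm_nonneg w]
  have h3 : 0 < (1 - ‖w‖)⁻¹ := inv_pos.2 (by linarith)
  calc ‖w‖ ^ 2 * (1 - ‖w‖)⁻¹ / 2 + ‖w‖ ≤ ‖w‖ * (1 - Real.exp (-x))⁻¹ / 2 + ‖w‖ := by gcongr
    _ = ((1 - Real.exp (-x))⁻¹ / 2 + 1) * ‖w‖ := by ring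
    _ ≤ _ := by
      have : 0 < (1 - Real.exp (-x))⁻¹ := inv_pos.2 (by linarith)
      gcongr

lemma summable_log_term {κ : ℝ} (hκ : 0 < κ) {z : ℂ} (hz : 0 < z.re) :
    Summable fun n : ℕ => Complex.log (1 - Complex.exp (-(z * (psTerm κ n : ℂ)))) :=
  Summable.of_norm_bounded ((summable_exp_neg_mul_psTerm hκ hz).mul_left _)
    (norm_log_term_le hκ hz le_rfl)

lemma differentiableOn_L {κ : ℝ} (hκ : 0 < κ) : DifferentiableOn ℂ (L κ) {z : ℂ | 0 < z.re} := by
  intro z hz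
  have hz' : 0 < z.re := hz
  set V : Set ℂ := {w | z.re / 2 < w.re} with hV
  have hVo : IsOpen V := isOpen_lt continuous_const Complex.continuous_re
  have hzV : z ∈ V := by change z.re / 2 < z.re; linarith
  have hd : DifferentiableOn ℂ (L κ) V := by
    refine DifferentiableOn.neg (Complex.differentiableOn_tsum_of_summable_norm
      ((summable_exp_neg_mul_psTerm hκ (half_pos hz')).mul_left _) (fun n w hw => ?_) hVo
      fun n w hw => norm_log_term_le hκ (half_pos hz') (le_of_lt hw) n)
    have hw' : z.re / 2 < w.re := hw
    have h1 := norm_exp_neg_mul_psTerm_lt_one hκ (z := w) (by linarith) n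
    have h2 : 1 - Complex.exp (-(w * (psTerm κ n : ℂ))) ∈ Complex.slitPlane := by
      rw [sub_eq_add_neg]
      exact Complex.mem_slitPlane_of_norm_lt_one (by rwa [norm_neg])
    have h3 : DifferentiableAt ℂ (fun w : ℂ => 1 - Complex.exp (-(w * (psTerm κ n : ℂ)))) w := by
      fun_prop
    exact (h3.clog h2).differentiableWithinAt
  exact (hd.differentiableAt (hVo.mem_nhds hzV)).differentiableWithinAt

lemma continuous_Gamma_vertical {c : ℝ} (hc : 0 < c) :
    Continuous fun t : ℝ => Complex.Gamma (c + t * Complex.I) := by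
  refine continuous_vertical (U := {s | 0 < s.re}) (fun s hs => ?_) fun t => by simpa using hc
  refine (Complex.differentiableAt_Gamma s fun m h => ?_).continuousAt.continuousWithinAt
  have hs' : 0 < s.re := hs
  rw [h] at hs'
  simp at hs'
  have : (0 : ℝ) ≤ m := m.cast_nonneg
  linarith

lemma integrable_Gamma_vertical {c : ℝ} (hc : 0 < c) :
    MeasureTheory.Integrable fun t : ℝ => Complex.Gamma (c + t * Complex.I) := by
  obtain ⟨C, hC⟩ := exists_norm_Gamma_le c c 2
  refine integrable_of_continuous_of_decay (continuous_Gamma_vertical hc) (C := C) fun t ht => ?_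
  have := hC (c + t * Complex.I) (by simp) (by simp) (by simpa using ht)
  simpa using this

lemma mellin_exp_neg {s : ℂ} (hs : 0 < s.re) :
    mellin (fun t : ℝ => (Real.exp (-t) : ℂ)) s = Complex.Gamma s := by
  rw [Complex.Gamma_eq_integral hs, Complex.GammaIntegral_eq_mellin]

/-- The Cahen–Mellin integral. -/
lemma integral_Gamma_mul_cpow {c y : ℝ} (hc : 0 < c) (hy : 0 < y) :
    ∫ t : ℝ, Complex.Gamma (c + t * Complex.I) * (y : ℂ) ^ (-(c + t * Complex.I) : ℂ) =
      2 * Real.pi * (Real.exp (-y) : ℂ) := by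
  have hm : ∀ t : ℝ, mellin (fun t : ℝ => (Real.exp (-t) : ℂ)) (c + t * Complex.I) =
      Complex.Gamma (c + t * Complex.I) := fun t => mellin_exp_neg (by simpa using hc)
  have h := mellinInv_mellin_eq c (fun t : ℝ => (Real.exp (-t) : ℂ)) hy ?_ ?_ (by fun_prop)
  · rw [mellinInv] at h
    simp_rw [hm] at h
    rw [← h, Complex.real_smul]
    have : (Real.pi : ℂ) ≠ 0 := by exact_mod_cast Real.pi_ne_zero
    push_cast
    rw [← mul_assoc]
    have e : (2 : ℂ) * Real.pi * (1 / (2 * Real.pi)) = 1 := by field_simp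
    rw [e, one_mul]
    refine MeasureTheory.integral_congr_ae (Eventually.of_forall fun t => ?_)
    simp only [smul_eq_mul]
    rw [mul_comm]
  · have := Complex.GammaIntegral_convergent (s := c) (by simpa using hc)
    rw [MellinConvergent]
    refine this.congr_fun (fun t _ => ?_) measurableSet_Ioi
    simp only [smul_eq_mul]
    rw [mul_comm]
  · rw [Complex.VerticalIntegrable]
    simp_rw [hm]
    exact integrable_Gamma_vertical hc

/-- `L_κ` as an inverse Mellin transform. -/
theorem integral_eq_L {κ : ℝ} (hκ : 0 < κ) {Z : ℂ → ℂ}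
    (hZ : ∀ s : ℂ, 1 / κ < s.re → HasSum (fun n : ℕ => 1 / (psTerm κ n : ℂ) ^ s) (Z s))
    {c : ℝ} (hc : 1 / κ < c) {x : ℝ} (hx : 0 < x) :
    ∫ t : ℝ, Complex.Gamma (c + t * Complex.I) * riemannZeta (c + t * Complex.I + 1) *
      Z (c + t * Complex.I) * (x : ℂ) ^ (-(c + t * Complex.I) : ℂ) = 2 * Real.pi * L κ x := by
  have hα : 0 < 1 / κ := by positivity
  have hc0 : 0 < c := hα.trans hc
  have ha : ∀ n, (0 : ℝ) < psTerm κ n := fun n => by exact_mod_cast psTerm_pos hκ n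
  have hk : ∀ k : ℕ, (0 : ℝ) < (k : ℝ) + 1 := fun k => by positivity
  set A : ℕ → ℂ → ℂ := fun n s => ((psTerm κ n : ℝ) : ℂ) ^ (-s) with hA
  set B : ℕ → ℂ → ℂ := fun k s => (((k : ℝ) + 1 : ℝ) : ℂ) ^ (-(s + 1)) with hB
  have hAn : ∀ n s, ‖A n s‖ = (psTerm κ n : ℝ) ^ (-s.re) := fun n s => by
    rw [hA]; dsimp only
    rw [Complex.norm_cpow_eq_rpow_re_of_pos (ha n)]; simp
  have hBn : ∀ k s, ‖B k s‖ = ((k : ℝ) + 1) ^ (-(1 + s.re)) := fun k s => by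
    rw [hB]; dsimp only
    rw [Complex.norm_cpow_eq_rpow_re_of_pos (hk k)]
    congr 1; simp; ring
  have hAsum : ∀ s : ℂ, 1 / κ < s.re → HasSum (fun n => A n s) (Z s) := fun s hs =>
    (hZ s hs).congr_fun fun n => by
      rw [hA]; dsimp only; rw [Complex.cpow_neg, one_div]; simp
  have hBsum : ∀ s : ℂ, 0 < s.re → HasSum (fun k => B k s) (riemannZeta (s + 1)) := fun s hs =>
    hasSum_riemannZeta (by simpa using hs)
  set F : ℕ × ℕ → ℝ → ℂ := fun p t => Complex.Gamma (c + t * Complex.I) *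
    (x : ℂ) ^ (-(c + t * Complex.I) : ℂ) * (A p.1 (c + t * Complex.I) * B p.2 (c + t * Complex.I))
    with hF
  have hre : ∀ t : ℝ, ((c : ℂ) + t * Complex.I).re = c := fun t => by simp
  -- each term is a rescaled Cahen–Mellin integrand
  have hFeq : ∀ p t, F p t = ((((p.2 : ℝ) + 1 : ℝ) : ℂ))⁻¹ * (Complex.Gamma (c + t * Complex.I) *
      ((x * psTerm κ p.1 * ((p.2 : ℝ) + 1) : ℝ) : ℂ) ^ (-(c + t * Complex.I) : ℂ)) := by
    intro p t
    have h1 : ((x * psTerm κ p.1 * ((p.2 : ℝ) + 1) : ℝ) : ℂ) ^ (-(c + t * Complex.I) : ℂ) =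
        (x : ℂ) ^ (-(c + t * Complex.I) : ℂ) * ((psTerm κ p.1 : ℝ) : ℂ) ^ (-(c + t * Complex.I) : ℂ) *
          (((p.2 : ℝ) + 1 : ℝ) : ℂ) ^ (-(c + t * Complex.I) : ℂ) := by
      rw [Complex.ofReal_mul, Complex.mul_cpow_ofReal_nonneg (by have := ha p.1; positivity)
        (hk _).le, Complex.ofReal_mul, Complex.mul_cpow_ofReal_nonneg hx.le (ha _).le]
    have h2 : B p.2 (c + t * Complex.I) =
        ((((p.2 : ℝ) + 1 : ℝ) : ℂ))⁻¹ * (((p.2 : ℝ) + 1 : ℝ) : ℂ) ^ (-(c + t * Complex.I) : ℂ) := by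
      have hne : (((p.2 : ℝ) + 1 : ℝ) : ℂ) ≠ 0 := by exact_mod_cast (hk p.2).ne'
      rw [hB]; dsimp only
      rw [neg_add, Complex.cpow_add _ _ hne, Complex.cpow_neg_one, mul_comm]
    simp only [hF]
    rw [h1, h2, hA]
    ring
  have hFnorm : ∀ p t, ‖F p t‖ = x ^ (-c) * ((psTerm κ p.1 : ℝ) ^ (-c) *
      ((p.2 : ℝ) + 1) ^ (-(1 + c))) * ‖Complex.Gamma (c + t * Complex.I)‖ := by
    intro p t
    simp only [hF]
    rw [norm_mul, norm_mul, norm_mul, hAn, hBn, hre, Complex.norm_cpow_eq_rpow_re_of_pos hx,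
      Complex.neg_re, hre]
    ring
  have hFint : ∀ p, MeasureTheory.Integrable (F p) := by
    intro p
    have hcont : Continuous (F p) := by
      have hxp : (0 : ℝ) < x * psTerm κ p.1 * ((p.2 : ℝ) + 1) := by
        have := ha p.1; positivity
      have hne : ((x * psTerm κ p.1 * ((p.2 : ℝ) + 1) : ℝ) : ℂ) ≠ 0 := by exact_mod_cast hxp.ne'
      rw [show F p = _ from funext (hFeq p)]
      refine Continuous.const_mul ((continuous_Gamma_vertical hc0).mul ?_) _
      exact Continuous.const_cpow (by fun_prop) (Or.inl hne)
    refine (((integrable_Gamma_vertical hc0).norm).const_mul (x ^ (-c) *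
      ((psTerm κ p.1 : ℝ) ^ (-c) * ((p.2 : ℝ) + 1) ^ (-(1 + c))))).mono' hcont.aestronglyMeasurable
      (Eventually.of_forall fun t => (hFnorm p t).le)
  have hFsum : Summable fun p => ∫ t, ‖F p t‖ := by
    simp_rw [hFnorm, MeasureTheory.integral_const_mul]
    refine Summable.mul_right _ (Summable.mul_left _ ?_)
    have h1 : Summable fun n => (psTerm κ n : ℝ) ^ (-c) := by
      have := (hAsum c (by simpa using hc)).summable.norm
      simpa [hAn] using this
    exact h1.mul_of_nonneg (summable_succ_rpow hc0) (fun n => by positivity)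
      fun k => by positivity
  have hmain := MeasureTheory.hasSum_integral_of_summable_integral_norm hFint hFsum
  have htsum : ∀ t : ℝ, ∑' p, F p t = Complex.Gamma (c + t * Complex.I) *
      riemannZeta (c + t * Complex.I + 1) * Z (c + t * Complex.I) *
      (x : ℂ) ^ (-(c + t * Complex.I) : ℂ) := by
    intro t
    have h1 := hAsum (c + t * Complex.I) (by rwa [hre])
    have h2 := hBsum (c + t * Complex.I) (by rwa [hre])
    simp only [hF]
    rw [tsum_mul_left, ← tsum_mul_tsum_of_summable_norm h1.summable.norm h2.summable.norm,
      h1.tsum_eq, h2.tsum_eq]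
    ring
  simp_rw [htsum] at hmain
  have hval : ∀ p : ℕ × ℕ, ∫ t, F p t = 2 * Real.pi *
      (Complex.exp (-((x : ℂ) * (psTerm κ p.1 : ℂ))) ^ (p.2 + 1) / ((p.2 + 1 : ℕ) : ℂ)) := by
    intro p
    have hxp : (0 : ℝ) < x * psTerm κ p.1 * ((p.2 : ℝ) + 1) := by
      have := ha p.1; positivity
    simp_rw [hFeq]
    rw [MeasureTheory.integral_const_mul, integral_Gamma_mul_cpow hc0 hxp, ← Complex.exp_nat_mul,
      Complex.ofReal_exp]
    have : (((-(x * psTerm κ p.1 * ((p.2 : ℝ) + 1)) : ℝ)) : ℂ) =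
        ((p.2 + 1 : ℕ) : ℂ) * -((x : ℂ) * (psTerm κ p.1 : ℂ)) := by push_cast; ring
    rw [this]
    push_cast
    ring
  simp_rw [hval] at hmain
  have hrow : ∀ n : ℕ, HasSum (fun k : ℕ => 2 * Real.pi *
      (Complex.exp (-((x : ℂ) * (psTerm κ n : ℂ))) ^ (k + 1) / ((k + 1 : ℕ) : ℂ)))
      (2 * Real.pi * -Complex.log (1 - Complex.exp (-((x : ℂ) * (psTerm κ n : ℂ))))) := by
    intro n
    refine HasSum.mul_left _ ?_
    have h1 := Complex.hasSum_taylorSeries_neg_log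
      (norm_exp_neg_mul_psTerm_lt_one hκ (z := (x : ℂ)) (by simpa using hx) n)
    have h2 := (hasSum_nat_add_iff' 1).2 h1
    simpa using h2
  have hfin := hmain.prod_fiberwise hrow
  rw [← hfin.tsum_eq, tsum_mul_left, tsum_neg, L]

/-! ### Derivatives of vertical integrals -/

/-- A continuous function on `ℝ` decaying faster than any power. -/
def RapidDecay (g : ℝ → ℂ) : Prop :=
  Continuous g ∧ ∀ N : ℕ, ∃ C : ℝ, ∀ t : ℝ, 1 ≤ |t| → ‖g t‖ * |t| ^ N ≤ C

lemma RapidDecay.integrable {g : ℝ → ℂ} (hg : RapidDecay g) : MeasureTheory.Integrable g := by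
  obtain ⟨C, hC⟩ := hg.2 2
  exact integrable_of_continuous_of_decay hg.1 hC

lemma RapidDecay.vertical_mul {g : ℝ → ℂ} (hg : RapidDecay g) (c : ℝ) :
    RapidDecay fun t => -(c + t * Complex.I) * g t := by
  refine ⟨Continuous.mul (by fun_prop) hg.1, fun N => ?_⟩
  obtain ⟨C, hC⟩ := hg.2 (N + 1)
  refine ⟨(|c| + 1) * C, fun t ht => ?_⟩
  have h1 : ‖(c : ℂ) + t * Complex.I‖ ≤ (|c| + 1) * |t| := by
    refine (norm_add_le _ _).trans ?_
    rw [norm_mul, Complex.norm_I, mul_one, Complex.norm_real, Complex.norm_real, Real.norm_eq_abs,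
      Real.norm_eq_abs]
    nlinarith [abs_nonneg c]
  rw [norm_mul, norm_neg]
  calc _ ≤ ((|c| + 1) * |t|) * ‖g t‖ * |t| ^ N := by gcongr
    _ = (|c| + 1) * (‖g t‖ * |t| ^ (N + 1)) := by ring
    _ ≤ _ := by
      have := hC t ht
      gcongr

/-- The integral `∫ g(t) x ^ (-(c + i t)) dt` over the line `Re s = c`. -/
noncomputable def verticalIntegral (c : ℝ) (g : ℝ → ℂ) (x : ℝ) : ℂ :=
  ∫ t : ℝ, g t * (x : ℂ) ^ (-(c + t * Complex.I) : ℂ)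

lemma norm_cpow_vertical {x : ℝ} (hx : 0 < x) (c t : ℝ) :
    ‖(x : ℂ) ^ (-(c + t * Complex.I) : ℂ)‖ = x ^ (-c) := by
  rw [Complex.norm_cpow_eq_rpow_re_of_pos hx]
  simp

lemma continuous_mul_cpow_vertical {g : ℝ → ℂ} (hg : Continuous g) (c : ℝ) {x : ℝ} (hx : 0 < x) :
    Continuous fun t : ℝ => g t * (x : ℂ) ^ (-(c + t * Complex.I) : ℂ) := by
  refine hg.mul (Continuous.const_cpow (by fun_prop) (Or.inl ?_))
  exact_mod_cast hx.ne'

lemma norm_verticalIntegral_le (c : ℝ) (g : ℝ → ℂ) {x : ℝ} (hx : 0 < x) :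
    ‖verticalIntegral c g x‖ ≤ (∫ t, ‖g t‖) * x ^ (-c) := by
  refine (MeasureTheory.norm_integral_le_integral_norm _).trans (le_of_eq ?_)
  simp_rw [norm_mul, norm_cpow_vertical hx]
  rw [MeasureTheory.integral_mul_const]

lemma hasDerivAt_verticalIntegral {g : ℝ → ℂ} (hg : RapidDecay g) (c : ℝ) {x : ℝ} (hx : 0 < x) :
    HasDerivAt (verticalIntegral c g)
      (verticalIntegral (c + 1) (fun t => -(c + t * Complex.I) * g t) x) x := by
  have hg' := hg.vertical_mul c
  have hs : Set.Icc (x / 2) (2 * x) ∈ 𝓝 x := Icc_mem_nhds (by linarith) (by linarith)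
  have hpos : ∀ y ∈ Set.Icc (x / 2) (2 * x), 0 < y := fun y hy => by linarith [hy.1]
  obtain ⟨K, hK⟩ := (isCompact_Icc (a := x / 2) (b := 2 * x)).exists_bound_of_continuousOn
    (f := fun y : ℝ => y ^ (-(c + 1))) fun y hy =>
      (Real.continuousAt_rpow_const y _ (Or.inl (hpos y hy).ne')).continuousWithinAt
  refine (hasDerivAt_integral_of_dominated_loc_of_deriv_le (μ := MeasureTheory.volume)
    (F := fun (y : ℝ) (t : ℝ) => g t * (y : ℂ) ^ (-(c + t * Complex.I) : ℂ))
    (F' := fun (y : ℝ) (t : ℝ) => -(c + t * Complex.I) * g t *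
      (y : ℂ) ^ (-(((c + 1 : ℝ) : ℂ) + t * Complex.I) : ℂ))
    (bound := fun t => ‖-(c + t * Complex.I) * g t‖ * K) hs ?_ ?_ ?_ ?_ ?_ ?_).2
  · filter_upwards [hs] with y hy
    exact (continuous_mul_cpow_vertical hg.1 c (hpos y hy)).aestronglyMeasurable
  · refine (hg.integrable.norm.mul_const (x ^ (-c))).mono'
      (continuous_mul_cpow_vertical hg.1 c hx).aestronglyMeasurable (Eventually.of_forall fun t => ?_)
    rw [norm_mul, norm_cpow_vertical hx]
  · exact (continuous_mul_cpow_vertical hg'.1 (c + 1) hx).aestronglyMeasurable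
  · refine Eventually.of_forall fun t y hy => ?_
    rw [norm_mul, norm_cpow_vertical (hpos y hy)]
    exact mul_le_mul_of_nonneg_left ((le_abs_self _).trans (hK y hy)) (norm_nonneg _)
  · exact hg'.integrable.norm.mul_const K
  · refine Eventually.of_forall fun t y hy => ?_
    refine ((hasDerivAt_ofReal_cpow_neg (c + t * Complex.I) (hpos y hy)).const_mul
      (g t)).congr_deriv ?_
    have : (((c + 1 : ℝ) : ℂ) + t * Complex.I) = c + t * Complex.I + 1 := by push_cast; ring
    rw [this]; ring

/-- Each differentiation in `x` costs one power of `x`: the polynomial factor it produces is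
absorbed by the rapid decay. -/
lemma exists_norm_iteratedDeriv_verticalIntegral_le (j : ℕ) :
    ∀ (c : ℝ) (g : ℝ → ℂ), RapidDecay g → ∃ K : ℝ, ∀ x : ℝ, 0 < x →
      ‖iteratedDeriv j (verticalIntegral c g) x‖ ≤ K * x ^ (-c - j) := by
  induction j with
  | zero =>
    intro c g _
    refine ⟨∫ t, ‖g t‖, fun x hx => ?_⟩
    rw [iteratedDeriv_zero]
    simpa using norm_verticalIntegral_le c g hx
  | succ j ih =>
    intro c g hg
    obtain ⟨K, hK⟩ := ih (c + 1) _ (hg.vertical_mul c)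
    refine ⟨K, fun x hx => ?_⟩
    have hev : deriv (verticalIntegral c g) =ᶠ[𝓝 x]
        verticalIntegral (c + 1) (fun t => -(c + t * Complex.I) * g t) := by
      filter_upwards [lt_mem_nhds hx] with y hy
      exact (hasDerivAt_verticalIntegral hg c hy).deriv
    rw [iteratedDeriv_succ', hev.iteratedDeriv_eq j]
    have := hK x hx
    have e : -(c + 1) - (j : ℝ) = -c - ((j + 1 : ℕ) : ℝ) := by push_cast; ring
    rwa [e] at this

/-! ### Poles and residues of the Mellin transform -/

/-- The poles `α - h`, `0 ≤ h < α`, of `ζ_κ`, where `α = 1 / κ`. -/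
noncomputable def zetaPoles (α : ℝ) : Finset ℝ :=
  (Finset.range ⌈α⌉₊).image fun h : ℕ => α - h

lemma mem_zetaPoles {α p : ℝ} : p ∈ zetaPoles α ↔ ∃ h : ℕ, (h : ℝ) < α ∧ p = α - h := by
  simp only [zetaPoles, Finset.mem_image, Finset.mem_range, Nat.lt_ceil, eq_comm]

lemma pos_of_mem_zetaPoles {α p : ℝ} (hp : p ∈ zetaPoles α) : 0 < p := by
  obtain ⟨h, hh, rfl⟩ := mem_zetaPoles.1 hp
  linarith

lemma coe_zetaPoles (α : ℝ) : {s : ℂ | ∃ h : ℕ, (h : ℝ) < α ∧ s = ((α - h : ℝ) : ℂ)} =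
    (fun p : ℝ => (p : ℂ)) '' (zetaPoles α : Set ℝ) := by
  ext s
  simp only [Set.mem_ofPred_eq, Set.mem_image, Finset.mem_coe, mem_zetaPoles]
  constructor
  · rintro ⟨h, hh, rfl⟩
    exact ⟨α - h, ⟨h, hh, rfl⟩, rfl⟩
  · rintro ⟨_, ⟨h, hh, rfl⟩, rfl⟩
    exact ⟨h, hh, rfl⟩

/-- The Mellin transform `Γ(s) ζ(s + 1) Z(s)` of `L_κ`. -/
noncomputable def mellinKernel (Z : ℂ → ℂ) (s : ℂ) : ℂ :=
  Complex.Gamma s * riemannZeta (s + 1) * Z s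

variable {κ σ : ℝ} {Z : ℂ → ℂ}

lemma IsZetaContinuation.differentiableAt (h : IsZetaContinuation κ σ Z) {s : ℂ} (hs : -σ < s.re)
    (hp : ∀ p ∈ zetaPoles (1 / κ), s ≠ (p : ℂ)) : DifferentiableAt ℂ Z s := by
  have h1 := h.holomorphic
  rw [coe_zetaPoles] at h1
  have ho : IsOpen ({s : ℂ | -σ < s.re} \ (fun p : ℝ => (p : ℂ)) '' (zetaPoles (1 / κ) : Set ℝ)) :=
    (isOpen_lt continuous_const Complex.continuous_re).sdiff
      ((zetaPoles (1 / κ)).finite_toSet.image _).isClosed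
  refine h1.differentiableAt (ho.mem_nhds ⟨hs, ?_⟩)
  rintro ⟨p, hpS, rfl⟩
  exact hp p hpS rfl

lemma IsZetaContinuation.differentiableAt_zero (h : IsZetaContinuation κ σ Z) (hσ : 0 < σ) :
    DifferentiableAt ℂ Z 0 :=
  h.differentiableAt (by simpa using hσ) fun p hp h0 =>
    (pos_of_mem_zetaPoles hp).ne (by exact_mod_cast h0)

lemma differentiableAt_Gamma_of_neg_one_lt {s : ℂ} (hs : -1 < s.re) (h0 : s ≠ 0) :
    DifferentiableAt ℂ Complex.Gamma s := by
  refine Complex.differentiableAt_Gamma s fun m hm => ?_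
  rcases Nat.eq_zero_or_pos m with rfl | hm0
  · exact h0 (by simpa using hm)
  · rw [hm] at hs
    have : (1 : ℝ) ≤ m := by exact_mod_cast hm0
    simp at hs
    linarith

lemma differentiableAt_riemannZeta_add_one {s : ℂ} (h0 : s ≠ 0) :
    DifferentiableAt ℂ (fun s => riemannZeta (s + 1)) s :=
  (differentiableAt_riemannZeta (s := s + 1) (by simpa using h0)).comp s (by fun_prop)

lemma IsZetaContinuation.differentiableAt_mellinKernel (h : IsZetaContinuation κ σ Z) (hσ : σ ≤ 1)
    {s : ℂ} (hs : -σ < s.re) (hp : ∀ p ∈ insert 0 (zetaPoles (1 / κ)), s ≠ ((p : ℝ) : ℂ)) :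
    DifferentiableAt ℂ (mellinKernel Z) s := by
  have h0 : s ≠ 0 := by simpa using hp 0 (Finset.mem_insert_self _ _)
  exact ((differentiableAt_Gamma_of_neg_one_lt (by linarith) h0).mul
    (differentiableAt_riemannZeta_add_one h0)).mul
      (h.differentiableAt hs fun p hp' => hp p (Finset.mem_insert_of_mem hp'))

/-- `Γ` beats the polynomial growth of the two zeta functions. -/
lemma IsZetaContinuation.exists_norm_mellinKernel_le (h : IsZetaContinuation κ σ Z) (hσ : σ ≤ 1)
    {ε : ℝ} (hε : 0 < ε) (c₂ : ℝ) (N : ℕ) :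
    ∃ C : ℝ, ∀ s : ℂ, ε - σ ≤ s.re → s.re ≤ c₂ → 1 ≤ |s.im| →
      ‖mellinKernel Z s‖ * |s.im| ^ N ≤ C := by
  obtain ⟨C₁, hC₁0, hC₁⟩ := exists_norm_riemannZeta_le hε 1
  obtain ⟨C₂, hC₂⟩ := h.growth ε hε
  set n := ⌊1 / κ⌋₊ + 1 with hn
  obtain ⟨C₃, hC₃⟩ := exists_norm_Gamma_le (ε - σ) c₂ (N + 1 + (n + 1))
  set M : ℝ := |ε - σ| + |c₂| + 3 with hM
  have hM0 : 0 ≤ M := by positivity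
  refine ⟨C₁ * M * (|C₂| * M ^ (n + 1)) * C₃, fun s h1 h2 h3 => ?_⟩
  set t := |s.im| with ht
  have ht0 : 0 < t := by linarith
  have hs : ‖s‖ + 2 ≤ M * t := by
    have h4 : ‖s‖ ≤ |s.re| + |s.im| := Complex.norm_le_abs_re_add_abs_im s
    have h5 : |s.re| ≤ |ε - σ| + |c₂| := by
      rw [abs_le]
      constructor
      · linarith [neg_abs_le (ε - σ), abs_nonneg c₂]
      · linarith [le_abs_self c₂, abs_nonneg (ε - σ)]
    nlinarith [abs_nonneg (ε - σ), abs_nonneg c₂]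
  have hz : ‖riemannZeta (s + 1)‖ ≤ C₁ * (M * t) := by
    have h4 := hC₁ (s + 1) (by simp; linarith) (by simpa using h3)
    rw [pow_one] at h4
    refine h4.trans (mul_le_mul_of_nonneg_left ?_ hC₁0)
    have : ‖s + 1‖ ≤ ‖s‖ + 1 := (norm_add_le _ _).trans (by simp)
    linarith
  have hZ : ‖Z s‖ ≤ |C₂| * (M * t) ^ (n + 1) := by
    refine (hC₂ s h1 h3).trans ?_
    rw [pow_succ' _ n]
    have : ‖s‖ * (‖s‖ + 1) ^ n ≤ (M * t) * (M * t) ^ n := by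
      have h5 := norm_nonneg s
      gcongr <;> linarith
    exact mul_le_mul (le_abs_self _) this (by positivity) (abs_nonneg _)
  have hG := hC₃ s h1 h2 h3
  rw [mellinKernel, norm_mul, norm_mul]
  calc ‖Complex.Gamma s‖ * ‖riemannZeta (s + 1)‖ * ‖Z s‖ * t ^ N
      ≤ ‖Complex.Gamma s‖ * (C₁ * (M * t)) * (|C₂| * (M * t) ^ (n + 1)) * t ^ N := by gcongr
    _ = C₁ * M * (|C₂| * M ^ (n + 1)) * (‖Complex.Gamma s‖ * t ^ (N + 1 + (n + 1))) := by
      rw [mul_pow]; ring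
    _ ≤ _ := mul_le_mul_of_nonneg_left hG (by positivity)

/-- `s ζ(s + 1)`, with its limit `1` at `s = 0` filled in. -/
noncomputable def zetaReg : ℂ → ℂ := Function.update (fun s => s * riemannZeta (s + 1)) 0 1

lemma hasDerivAt_zetaReg : HasDerivAt zetaReg (Real.eulerMascheroniConstant : ℂ) 0 := by
  rw [hasDerivAt_iff_tendsto_slope]
  have h1 : Tendsto (fun s : ℂ => s + 1) (𝓝[≠] 0) (𝓝[≠] 1) := by
    refine tendsto_nhdsWithin_of_tendsto_nhds_of_eventually_within _ ?_ ?_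
    · have : Tendsto (fun s : ℂ => s + 1) (𝓝 0) (𝓝 (0 + 1)) :=
        (by fun_prop : Continuous fun s : ℂ => s + 1).tendsto 0
      rw [zero_add] at this
      exact this.mono_left nhdsWithin_le_nhds
    · filter_upwards [self_mem_nhdsWithin] with s hs h
      exact hs (by simpa using h)
  refine (tendsto_riemannZeta_sub_one_div.comp h1).congr' ?_
  filter_upwards [self_mem_nhdsWithin] with s hs
  have hs0 : s ≠ 0 := hs
  simp only [Function.comp, slope, zetaReg, Function.update_of_ne hs0, Function.update_self,
    vsub_eq_sub, smul_eq_mul, sub_zero, add_sub_cancel_right]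
  field_simp

/-- At `s = 0` the Euler constants of `Γ(s + 1)` and `s ζ(s + 1)` cancel, so that the double pole
of `Γ(s) ζ(s + 1) Z(s) x ^ (-s)` has residue `Z'(0) - Z(0) log x`. -/
lemma IsZetaContinuation.tendsto_residue_zero (h : IsZetaContinuation κ σ Z) (hσ : 0 < σ)
    {x : ℝ} (hx : 0 < x) :
    Tendsto (fun s : ℂ => s * (mellinKernel Z s * (x : ℂ) ^ (-s) -
      ((deriv Z 0 - Z 0 * Real.log x) * s⁻¹ + Z 0 * (s ^ 2)⁻¹))) (𝓝[≠] 0) (𝓝 0) := by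
  have hxne : (x : ℂ) ≠ 0 := by exact_mod_cast hx.ne'
  set K : ℂ → ℂ := fun s => Complex.Gamma (s + 1) * zetaReg s * Z s * (x : ℂ) ^ (-s) with hK
  have hGd : HasDerivAt (fun s : ℂ => Complex.Gamma (s + 1)) (-(Real.eulerMascheroniConstant : ℂ)) 0 := by
    have h1 : HasDerivAt Complex.Gamma (-(Real.eulerMascheroniConstant : ℂ)) (0 + 1) := by
      rw [zero_add]; exact Complex.hasDerivAt_Gamma_one
    exact h1.comp_add_const 0 1
  have hxd : HasDerivAt (fun s : ℂ => (x : ℂ) ^ (-s)) (-(Real.log x : ℂ)) 0 := by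
    have h1 := (hasDerivAt_neg (0 : ℂ)).const_cpow (c := (x : ℂ)) (Or.inl hxne)
    refine h1.congr_deriv ?_
    rw [neg_zero, Complex.cpow_zero, ← Complex.ofReal_log hx.le]; ring
  have hz0 : zetaReg 0 = 1 := by simp [zetaReg]
  have hK0 : K 0 = Z 0 := by simp [hK, hz0]
  have hKd : HasDerivAt K (deriv Z 0 - Z 0 * Real.log x) 0 := by
    refine (((hGd.mul hasDerivAt_zetaReg).mul (h.differentiableAt_zero hσ).hasDerivAt).mul
      hxd).congr_deriv ?_
    simp [hz0]
    ring
  rw [hasDerivAt_iff_tendsto_slope] at hKd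
  have h2 := hKd.sub_const (deriv Z 0 - Z 0 * Real.log x)
  rw [sub_self] at h2
  refine h2.congr' ?_
  filter_upwards [self_mem_nhdsWithin] with s hs
  have hs0 : s ≠ 0 := hs
  have e1 : K s = s ^ 2 * (mellinKernel Z s * (x : ℂ) ^ (-s)) := by
    simp only [hK, mellinKernel]
    rw [Complex.Gamma_add_one s hs0, zetaReg, Function.update_of_ne hs0]
    ring
  rw [slope, vsub_eq_sub, smul_eq_mul, hK0, e1, sub_zero]
  field_simp
  ring

lemma tendsto_residue_pole {p : ℝ} (hp : 0 < p) {r : ℂ}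
    (hr : Tendsto (fun s : ℂ => (s - (p : ℂ)) * Z s) (𝓝[≠] (p : ℂ)) (𝓝 r)) {x : ℝ} (hx : 0 < x) :
    Tendsto (fun s : ℂ => (s - p) * (mellinKernel Z s * (x : ℂ) ^ (-s) -
      (Complex.Gamma p * riemannZeta (p + 1) * r * (x : ℂ) ^ (-(p : ℂ)) * (s - p)⁻¹ +
        0 * ((s - p) ^ 2)⁻¹))) (𝓝[≠] (p : ℂ)) (𝓝 0) := by
  have hxne : (x : ℂ) ≠ 0 := by exact_mod_cast hx.ne'
  have hp0 : (p : ℂ) ≠ 0 := by exact_mod_cast hp.ne'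
  have h1 : ContinuousAt (fun s : ℂ => Complex.Gamma s * riemannZeta (s + 1)) (p : ℂ) :=
    ((differentiableAt_Gamma_of_neg_one_lt (by simp; linarith) hp0).mul
      (differentiableAt_riemannZeta_add_one hp0)).continuousAt
  have h2 : ContinuousAt (fun s : ℂ => (x : ℂ) ^ (-s)) (p : ℂ) :=
    (differentiable_neg.const_cpow (Or.inl hxne)).continuous.continuousAt
  have h3 := (((h1.tendsto.mono_left nhdsWithin_le_nhds).mul hr).mul
    (h2.tendsto.mono_left nhdsWithin_le_nhds)).sub_const
      (Complex.Gamma p * riemannZeta (p + 1) * r * (x : ℂ) ^ (-(p : ℂ)))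
  rw [sub_self] at h3
  refine h3.congr' ?_
  filter_upwards [self_mem_nhdsWithin] with s hs
  have hs0 : s - p ≠ 0 := sub_ne_zero.2 hs
  rw [mellinKernel]
  field_simp
  ring

/-! ### The asymptotic expansion -/

/-- The coefficient of `(s - p)⁻¹` of `Γ(s) ζ(s + 1) Z(s) x ^ (-s)` at each of its poles `p = 0` and
`p = α - h`. -/
noncomputable def residueAt (κ : ℝ) (Z : ℂ → ℂ) (x p : ℝ) : ℂ :=
  if p = 0 then deriv Z 0 - Z 0 * Real.log x
  else Complex.Gamma p * riemannZeta (p + 1) *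
    ((Real.Gamma (1 / κ + 1) / ((Nat.factorial (⌊1 / κ - p⌋₊ + 1) : ℝ) * Real.Gamma p) : ℝ) : ℂ) *
      (x : ℂ) ^ (-(p : ℂ))

lemma sum_residueAt (κ : ℝ) (Z : ℂ → ℂ) {x : ℝ} (hx : 0 < x) :
    ∑ p ∈ insert 0 (zetaPoles (1 / κ)), residueAt κ Z x p = mainTerm κ (Z 0) (deriv Z 0) x := by
  rw [Finset.sum_insert fun h => (pos_of_mem_zetaPoles h).false, zetaPoles,
    Finset.sum_image fun a _ b _ hab => by
      have : (a : ℝ) = b := by linarith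
      exact_mod_cast this, mainTerm, residueAt, if_pos rfl]
  have : ∀ h ∈ Finset.range ⌈1 / κ⌉₊, residueAt κ Z x (1 / κ - h) =
      (Real.Gamma (1 / κ + 1) : ℂ) * riemannZeta ((1 / κ - h + 1 : ℝ) : ℂ) /
      ((Nat.factorial (h + 1) : ℂ) * ((x ^ (1 / κ - h) : ℝ) : ℂ)) := by
    intro h hh
    have hp : 0 < 1 / κ - h := by
      have := Nat.lt_ceil.1 (Finset.mem_range.1 hh)
      linarith
    have hG : (Real.Gamma (1 / κ - h) : ℂ) ≠ 0 := by exact_mod_cast (Real.Gamma_pos_of_pos hp).ne'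
    have hX : ((x ^ (1 / κ - h) : ℝ) : ℂ) ≠ 0 := by exact_mod_cast (Real.rpow_pos_of_pos hx _).ne'
    have hf : (Nat.factorial (h + 1) : ℂ) ≠ 0 := by exact_mod_cast Nat.factorial_ne_zero _
    rw [residueAt, if_neg hp.ne', sub_sub_cancel, Nat.floor_natCast, Complex.cpow_neg,
      ← Complex.ofReal_cpow hx.le, Complex.Gamma_ofReal]
    rw [Complex.ofReal_div, Complex.ofReal_mul, Complex.ofReal_natCast, Complex.ofReal_add,
      Complex.ofReal_one]
    field_simp
  rw [Finset.sum_congr rfl this]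
  ring

lemma IsZetaContinuation.tendsto_residueAt (h : IsZetaContinuation κ σ Z) (hσ : 0 < σ)
    {x : ℝ} (hx : 0 < x) {p : ℝ} (hp : p ∈ insert 0 (zetaPoles (1 / κ))) :
    Tendsto (fun s : ℂ => (s - p) * (mellinKernel Z s * (x : ℂ) ^ (-s) -
      (residueAt κ Z x p * (s - p)⁻¹ + (if p = 0 then Z 0 else 0) * ((s - p) ^ 2)⁻¹)))
      (𝓝[≠] (p : ℂ)) (𝓝 0) := by
  rcases Finset.mem_insert.1 hp with rfl | hp
  · simpa [residueAt] using h.tendsto_residue_zero hσ hx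
  · have hp0 := pos_of_mem_zetaPoles hp
    obtain ⟨n, hn, rfl⟩ := mem_zetaPoles.1 hp
    have := tendsto_residue_pole hp0 (h.residue n hn) hx
    rw [residueAt, if_neg hp0.ne', if_neg hp0.ne', sub_sub_cancel, Nat.floor_natCast]
    exact this

/-- The remainder of the expansion is an integral over the line `Re s = c₁`, which lies between the
poles of the Mellin transform and the edge of the half-plane of continuation. -/
lemma IsZetaContinuation.L_sub_mainTerm_eq (h : IsZetaContinuation κ σ Z) (hκ : 0 < κ) (hσ0 : 0 < σ)
    (hσ : σ ≤ 1) {c₁ : ℝ} (hc₁ : -σ < c₁) (hc₁0 : c₁ < 0) {x : ℝ} (hx : 0 < x) :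
    L κ x - mainTerm κ (Z 0) (deriv Z 0) x =
      verticalIntegral c₁ (fun t => (2 * Real.pi : ℂ)⁻¹ * mellinKernel Z (c₁ + t * Complex.I)) x := by
  have hα : 0 < 1 / κ := by positivity
  have hxne : (x : ℂ) ≠ 0 := by exact_mod_cast hx.ne'
  set c₂ : ℝ := 1 / κ + 1 with hc₂
  obtain ⟨C, hC⟩ := h.exists_norm_mellinKernel_le hσ (ε := c₁ + σ) (by linarith) c₂ 2
  obtain ⟨B, hB⟩ := (isCompact_Icc (a := c₁) (b := c₂)).exists_bound_of_continuousOn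
    (f := fun y : ℝ => x ^ (-y))
    ((Real.continuous_const_rpow hx.ne').comp continuous_neg).continuousOn
  have key := integral_vertical_sub (G := fun s => mellinKernel Z s * (x : ℂ) ^ (-s))
    (U := {s | -σ < s.re}) (isOpen_lt continuous_const Complex.continuous_re) (c₁ := c₁) (c₂ := c₂)
    (by linarith) (fun s h1 _ => lt_of_lt_of_le hc₁ h1) (S := insert 0 (zetaPoles (1 / κ)))
    (a := residueAt κ Z x) (b := fun p => if p = 0 then Z 0 else 0) ?_ ?_
    (fun p hp => h.tendsto_residueAt hσ0 hx hp) (C := C * B) ?_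
  · rw [sum_residueAt κ Z hx] at key
    have hL := integral_eq_L hκ h.hasSum (c := c₂) (by linarith) hx
    simp only [mellinKernel] at key
    rw [hL] at key
    have hpi : (2 * Real.pi : ℂ) ≠ 0 := by
      exact_mod_cast (by positivity : (2 * Real.pi : ℝ) ≠ 0)
    simp only [verticalIntegral, mul_assoc (2 * Real.pi : ℂ)⁻¹, mellinKernel]
    rw [MeasureTheory.integral_const_mul, eq_inv_mul_iff_mul_eq₀ hpi, mul_sub, ← key]
    ring
  · intro p hp
    rcases Finset.mem_insert.1 hp with rfl | hp
    · exact ⟨hc₁0, by linarith⟩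
    · have hp0 := pos_of_mem_zetaPoles hp
      obtain ⟨n, hn, rfl⟩ := mem_zetaPoles.1 hp
      exact ⟨by linarith, by linarith [(Nat.cast_nonneg n : (0 : ℝ) ≤ n)]⟩
  · rintro s ⟨hs, hs'⟩
    exact ((h.differentiableAt_mellinKernel hσ hs fun p hp hsp => hs' ⟨p, hp, hsp.symm⟩).mul
      (differentiable_neg.const_cpow (Or.inl hxne)).differentiableAt).differentiableWithinAt
  · intro s h1 h2 h3
    have h4 := hC s (by linarith) h2 h3
    have h5 := hB s.re ⟨h1, h2⟩
    rw [norm_mul, Complex.norm_cpow_eq_rpow_re_of_pos hx, Complex.neg_re]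
    rw [Real.norm_eq_abs, abs_of_pos (Real.rpow_pos_of_pos hx _)] at h5
    calc _ = (‖mellinKernel Z s‖ * |s.im| ^ 2) * x ^ (-s.re) := by ring
      _ ≤ _ := mul_le_mul h4 h5 (Real.rpow_pos_of_pos hx _).le
        ((by positivity : (0 : ℝ) ≤ _).trans h4)

lemma IsZetaContinuation.rapidDecay_mellinKernel (h : IsZetaContinuation κ σ Z) (hσ : σ ≤ 1)
    {c : ℝ} (hc : -σ < c) (hc0 : c < 0) :
    RapidDecay fun t => (2 * Real.pi : ℂ)⁻¹ * mellinKernel Z (c + t * Complex.I) := by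
  refine ⟨continuous_const.mul (continuous_iff_continuousAt.2 fun t => ?_), fun N => ?_⟩
  · have hd : DifferentiableAt ℂ (mellinKernel Z) (c + t * Complex.I) := by
      refine h.differentiableAt_mellinKernel hσ (by simpa using hc) fun p hp hsp => ?_
      have h1 : c = p := by simpa using congrArg Complex.re hsp
      rcases Finset.mem_insert.1 hp with rfl | hp
      · exact hc0.ne h1
      · linarith [pos_of_mem_zetaPoles hp]
    exact hd.continuousAt.comp (f := fun t : ℝ => (c : ℂ) + t * Complex.I) (by fun_prop)
  · obtain ⟨C, hC⟩ := h.exists_norm_mellinKernel_le hσ (ε := c + σ) (by linarith) c N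
    refine ⟨‖(2 * Real.pi : ℂ)⁻¹‖ * C, fun t ht => ?_⟩
    have := hC (c + t * Complex.I) (by simp) (by simp) (by simpa using ht)
    rw [norm_mul, mul_assoc]
    refine mul_le_mul_of_nonneg_left ?_ (norm_nonneg _)
    simpa using this

lemma contDiffAt_L (hκ : 0 < κ) (j : ℕ) {x : ℝ} (hx : 0 < x) :
    ContDiffAt ℝ j (fun t : ℝ => L κ (t : ℂ)) x := by
  have ho : IsOpen {z : ℂ | 0 < z.re} := isOpen_lt continuous_const Complex.continuous_re
  have h1 : ContDiffAt ℂ j (L κ) (x : ℂ) :=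
    ((differentiableOn_L hκ).contDiffOn ho).contDiffAt (ho.mem_nhds (by simpa using hx))
  exact (h1.restrict_scalars ℝ).comp x Complex.ofRealCLM.contDiff.contDiffAt

lemma contDiffAt_mainTerm (κ : ℝ) (z₀ z₁ : ℂ) (j : ℕ) {x : ℝ} (hx : 0 < x) :
    ContDiffAt ℝ j (mainTerm κ z₀ z₁) x := by
  unfold mainTerm
  refine ((ContDiffAt.sum fun h _ => ?_).sub ?_).add contDiffAt_const
  · simp only [div_eq_mul_inv]
    refine contDiffAt_const.mul ((contDiffAt_const.mul
      (Complex.ofRealCLM.contDiff.contDiffAt.comp x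
        (Real.contDiffAt_rpow_const (Or.inl hx.ne')))).inv ?_)
    exact mul_ne_zero (by exact_mod_cast Nat.factorial_ne_zero _)
      (Complex.ofReal_ne_zero.2 (Real.rpow_pos_of_pos hx _).ne')
  · exact contDiffAt_const.mul
      (Complex.ofRealCLM.contDiff.contDiffAt.comp x (Real.contDiffAt_log.2 hx.ne'))

theorem IsZetaContinuation.isBigO_iteratedDeriv (h : IsZetaContinuation κ σ Z) (hκ : 0 < κ)
    (hσ0 : 0 < σ) (hσ : σ ≤ 1) {ε : ℝ} (hε : 0 < ε) (j : ℕ) :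
    (fun x : ℝ => iteratedDeriv j (fun t : ℝ => L κ (t : ℂ)) x
      - iteratedDeriv j (mainTerm κ (Z 0) (deriv Z 0)) x)
        =O[𝓝[>] (0 : ℝ)] fun x : ℝ => x ^ (σ - ε - (j : ℝ)) := by
  -- the line of integration has to stay to the left of `0` even if `ε ≥ σ`
  obtain ⟨δ, hδ0, hδε, hδσ⟩ : ∃ δ : ℝ, 0 < δ ∧ δ ≤ ε ∧ δ < σ :=
    ⟨min ε (σ / 2), lt_min hε (by linarith), min_le_left _ _,
      (min_le_right _ _).trans_lt (by linarith)⟩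
  set c : ℝ := δ - σ with hc
  set g : ℝ → ℂ := fun t => (2 * Real.pi : ℂ)⁻¹ * mellinKernel Z (c + t * Complex.I) with hg
  obtain ⟨K, hK⟩ := exists_norm_iteratedDeriv_verticalIntegral_le j c g
    (h.rapidDecay_mellinKernel hσ (by linarith) (by linarith))
  refine IsBigO.of_bound |K| ?_
  filter_upwards [Ioo_mem_nhdsGT (one_pos : (0 : ℝ) < 1)] with x hx
  have hev : (fun y : ℝ => L κ (y : ℂ) - mainTerm κ (Z 0) (deriv Z 0) y) =ᶠ[𝓝 x]
      verticalIntegral c g := by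
    filter_upwards [lt_mem_nhds hx.1] with y hy
    exact h.L_sub_mainTerm_eq hκ hσ0 hσ (by linarith) (by linarith) hy
  rw [← iteratedDeriv_fun_sub (contDiffAt_L hκ j hx.1) (contDiffAt_mainTerm κ _ _ j hx.1),
    hev.iteratedDeriv_eq j, Real.norm_of_nonneg (Real.rpow_pos_of_pos hx.1 _).le]
  refine (hK x hx.1).trans (mul_le_mul (le_abs_self K) ?_ (Real.rpow_pos_of_pos hx.1 _).le
    (abs_nonneg K))
  exact Real.rpow_le_rpow_of_exponent_ge hx.1 hx.2.le (by linarith)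

end PSZeta

theorem proposition3 (κ : ℝ) (hκ : 0 < κ) :
    -- the series defining `L_κ` converges, to a holomorphic function, on `Re z > 0`
    (∀ z : ℂ, 0 < z.re →
      Summable fun n : ℕ => Complex.log (1 - Complex.exp (-(z * (PSZeta.psTerm κ n : ℂ))))) ∧
    DifferentiableOn ℂ (PSZeta.L κ) {z : ℂ | 0 < z.re} ∧
    -- some `σ` in `(0, 1]` is admissible
    (∃ σ ∈ Set.Ioc (0 : ℝ) 1, ∃ Z : ℂ → ℂ, PSZeta.IsZetaContinuation κ σ Z) ∧
    -- and for each admissible `σ` the expansion of every derivative holds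
    ∀ σ ∈ Set.Ioc (0 : ℝ) 1, ∀ Z : ℂ → ℂ, PSZeta.IsZetaContinuation κ σ Z →
      ∀ ε : ℝ, 0 < ε → ∀ j : ℕ,
        (fun x : ℝ => iteratedDeriv j (fun t : ℝ => PSZeta.L κ (t : ℂ)) x
            - iteratedDeriv j (PSZeta.mainTerm κ (Z 0) (deriv Z 0)) x)
          =O[𝓝[>] (0 : ℝ)] fun x : ℝ => x ^ (σ - ε - (j : ℝ)) := by
  exact ⟨fun _ hz => PSZeta.summable_log_term hκ hz, PSZeta.differentiableOn_L hκ,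
    PSZeta.exists_isZetaContinuation hκ,
    fun _ hσ _ hZ _ hε j => hZ.isBigO_iteratedDeriv hκ hσ.1 hσ.2 hε j⟩
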